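/- Let $\mathbb S^1=\mathbb R/\mathbb Z$ with its standard metric $|x,y|$ (length of the shortest arc). Let $\mathscr L$ be the class of continuous circle maps $f$ of degree one, with lift $F$, such that: there is an open non-degenerate arc $U_f$ (the flat interval, lifted to $(a,b)$ with $a<b<a+1$) with $F'=0$ on $[a,b]$ and $F'>0$ on $(b,a+1)$; $F$ is $C^2$ except at the lifts of the endpoints of $U_f$; and for some real $\ell>0$ one has $F(x)=h_r((x-b)^{\ell})$ on a right-sided neighbourhood of $b$ and $F(x)=h_l((a-x)^{\ell})$ on a left-sided neighbourhood of $a$, where $h_r,h_l$ are $C^2$-diffeomorphisms of an open neighbourhood of $0$ onto their images. Let $\rho(f)=\lim F^n(x)/n \pmod 1$ be the rotation number and, when it is irrational with continued fraction $[0;a_1,a_2,\dots]$, let $q_0=1$, $q_1=a_1$, $q_{n+1}=a_{n+1}q_n+q_{n-1}$. Let $\mathscr B\subset\mathscr L$ be the set of maps with $\rho(f)$ irrational, $(a_n)$ bounded, and bounded geometry: the ratios $$\tau_n=\frac{|U_f,f^{q_n}(U_f)|}{|U_f,f^{q_{n-2}}(U_f)|},\qquad n\ge 2,$$ are bounded away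 from $0$, where $f^{q_n}(U_f)$ is a single point and $|U_f,p|$ is the distance from $p$ to the closer endpoint of $U_f$. Let $K_f$ be the non-wandering set: the set of points $x$ such that every open $V\ni x$ satisfies $V\cap f^n(V)\neq\emptyset$ for some $n>0$. Write $f^{-i}=(f^i)^{-1}(U_f)$. For $n$ even let $F_n^0$ be the closed arc from $f^{-q_n}$ to $U_f$ (adjacent to $a$), and for $n$ odd the closed arc from $U_f$ to $f^{-q_n}$ (adjacent to $b$); put $F_n^i=(f^i)^{-1}(F_n^0)$. The gaps of the $n$-th dynamical partition are the arcs $F_n^i$, $0\le i<q_{n+1}$, and $F_{n+1}^i$, $0\le i<q_n$. For a second map $g$ denote the corresponding gaps by $G_n^i$. **Proposition.** Let $f,g\in\mathscr B$ with $\rho(f)=\rho(g)$. There is exactly one map $\varphi:K_f\to K_g$ that sends each $x\in K_f$ to a point with the same code, that is, for every $n\geq 0$, if $x$ lies in a gap of the $n$-th dynamical partition of $f$, then $\varphi(x)$ lies in the corresponding gap of that of $g$. This map is a homeomorphism of $K_f$ onto $K_g$, $f(K_f)\subset K_f$ and $\varphi\circ f=g\circ\varphi$ on $K_f$; and $\varphi$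 is quasi-symmetric in the following sense: there is a constant $C>0$ such that for all $x,y,z\in K_f$ with $x\ne y$ and $|x,y|=|y,z|$, $$C^{-1}\le\frac{|\varphi(x),\varphi(y)|}{|\varphi(y),\varphi(z)|}\le C .$$ -/

import Mathlib

open Set Filter Topology

noncomputable section

namespace FlatCircle

/-- The circle `ℝ / ℤ`, with its standard metric (length of the shortest arc). -/
abbrev Circ : Type := UnitAddCircle

/-- The class of continuous degree one circle maps with a flat interval, whose critical exponent
is a real number `ℓ > 0`. The map is given with a lift to the line and with a lift `(a, b)` of its
flat interval. -/
structure FlatMap where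
  /-- the circle map -/
  toFun : Circ → Circ
  /-- a lift to the line, `F (x + 1) = F x + 1`, weakly order preserving -/
  lift : CircleDeg1Lift
  toFun_coe : ∀ x : ℝ, toFun (x : Circ) = ((lift x : ℝ) : Circ)
  continuous_lift : Continuous lift
  /-- left endpoint of the flat interval -/
  a : ℝ
  /-- right endpoint of the flat interval -/
  b : ℝ
  a_lt_b : a < b
  b_lt : b < a + 1
  /-- the derivative vanishes on the closed flat interval -/
  flat : ∀ x ∈ Icc a b, HasDerivAt lift 0 x
  /-- the derivative exists and is positive off the closed flat interval -/
  deriv_pos : ∀ x ∈ Ioo b (a + 1), DifferentiableAt ℝ lift x ∧ 0 < deriv lift x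
  /-- twice continuously differentiable off the endpoints (inside `(a, b)` this is automatic) -/
  contDiffAt : ∀ x ∈ Ioo b (a + 1), ContDiffAt ℝ 2 lift x
  /-- the critical exponent -/
  exponent : ℝ
  exponent_pos : 0 < exponent
  /-- to the right of `b` the map is a `C²` diffeomorphism near `0` after `(x - b) ^ ℓ` -/
  right_form : ∃ h : ℝ → ℝ, ∃ ε > 0, ContDiffOn ℝ 2 h (Ioo (-ε) ε) ∧
    (∀ t ∈ Ioo (-ε) ε, deriv h t ≠ 0) ∧ ∀ᶠ x in 𝓝[≥] b, lift x = h ((x - b) ^ exponent)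
  /-- to the left of `a` the map is a `C²` diffeomorphism near `0` after `(a - x) ^ ℓ` -/
  left_form : ∃ h : ℝ → ℝ, ∃ ε > 0, ContDiffOn ℝ 2 h (Ioo (-ε) ε) ∧
    (∀ t ∈ Ioo (-ε) ε, deriv h t ≠ 0) ∧ ∀ᶠ x in 𝓝[≤] a, lift x = h ((a - x) ^ exponent)

instance : CoeFun FlatMap (fun _ => Circ → Circ) := ⟨FlatMap.toFun⟩

/-- `qDen ρ n = qₙ`: the denominators of the continued fraction convergents of `ρ`, so
`q₀ = 1`, `q₁ = a₁`, `qₙ₊₁ = aₙ₊₁ qₙ + qₙ₋₁`. (The value inside the floor is a natural number.) -/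
def qDen (ρ : ℝ) (n : ℕ) : ℕ := ⌊(GenContFract.of ρ).dens n⌋₊

/-- The partial quotients `a₁, a₂, …` of `ρ` are bounded. -/
def IsBoundedType (ρ : ℝ) : Prop :=
  ∃ M : ℝ, 0 < M ∧ ∀ n d, (GenContFract.of ρ).partDens.get? n = some d → d < M

namespace FlatMap

variable (f : FlatMap)

/-- The flat interval `U_f`, an open arc of the circle. -/
def flatInterval : Set Circ := (fun x : ℝ => (x : Circ)) '' Ioo f.a f.b

/-- The rotation number `lim F^n(x) / n (mod 1)`, as a number in `[0, 1)`. -/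
def rotationNumber : ℝ := Int.fract (CircleDeg1Lift.translationNumber f.lift)

/-- `f.q n = qₙ` for the rotation number of `f`. -/
def q (n : ℕ) : ℕ := qDen f.rotationNumber n

/-- The preimage `f^{-i}` of the flat interval. -/
def preimageFlat (i : ℕ) : Set Circ := f^[i] ⁻¹' f.flatInterval

/-- `f.gapDist n = |f^0, f^{qₙ}|`: the distance to the flat interval of the image of the flat
interval under the `qₙ`-th iterate; this image is the single point `f^{qₙ}(a)`. -/
def gapDist (n : ℕ) : ℝ := Metric.infDist (f^[f.q n] (f.a : Circ)) f.flatInterval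

/-- The scaling `τₙ = |f^0, f^{qₙ}| / |f^0, f^{qₙ₋₂}|`, for `n ≥ 2`. -/
def scaling (n : ℕ) : ℝ := f.gapDist n / f.gapDist (n - 2)

/-- Bounded geometry: the scalings are bounded away from zero. -/
def BoundedGeometry : Prop := ∃ c : ℝ, 0 < c ∧ ∀ n, 2 ≤ n → c ≤ f.scaling n

/-- Irrational rotation number of bounded type, and bounded geometry. -/
structure IsBounded : Prop where
  irrational : Irrational f.rotationNumber
  boundedType : IsBoundedType f.rotationNumber
  boundedGeometry : f.BoundedGeometry

/-- The non-wandering set `K_f`. -/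
def nonWandering : Set Circ :=
  {x | ∀ V : Set Circ, IsOpen V → x ∈ V → ∃ n : ℕ, 0 < n ∧ (V ∩ f^[n] '' V).Nonempty}

/-- The closed arc `Fₙ⁰`: for even `n` the one from the preimage `f^{-qₙ}` to the flat interval,
which ends at `a`; for odd `n` the one from the flat interval to `f^{-qₙ}`, which starts at `b`.
It consists of the points that one reaches from the flat interval, on the given side, without
crossing the open arc `f^{-qₙ}`. -/
def baseGap (n : ℕ) : Set Circ :=
  if Even n then
    (fun x : ℝ => (x : Circ)) ''
      {x | x ≤ f.a ∧ ∀ t ∈ Ioo x f.a, (t : Circ) ∉ f.preimageFlat (f.q n)}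
  else
    (fun x : ℝ => (x : Circ)) ''
      {x | f.b ≤ x ∧ ∀ t ∈ Ioo f.b x, (t : Circ) ∉ f.preimageFlat (f.q n)}

/-- The gap `Fₙⁱ = f^{-i}(Fₙ⁰)`. The gaps of the `n`-th dynamical partition are the long gaps
`Fₙⁱ` with `i < qₙ₊₁` and the short gaps `Fₙ₊₁ⁱ` with `i < qₙ`. -/
def gap (n i : ℕ) : Set Circ := f^[i] ⁻¹' f.baseGap n

end FlatMap

/-- `φ` sends every point of `K_f` to a point of `K_g` with the same code: if `x` lies in a (long
or short) gap of the `n`-th dynamical partition of `f`, then `φ x` lies in the corresponding gap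
of the `n`-th dynamical partition of `g`. -/
def PreservesCodes (f g : FlatMap) (φ : f.nonWandering → g.nonWandering) : Prop :=
  ∀ x : f.nonWandering, ∀ n i : ℕ,
    (i < f.q (n + 1) → (x : Circ) ∈ f.gap n i → (φ x : Circ) ∈ g.gap n i) ∧
    (i < f.q n → (x : Circ) ∈ f.gap (n + 1) i → (φ x : Circ) ∈ g.gap (n + 1) i)

end FlatCircle

end

/-! Work on the line with a lift `F`. Index the iterates of the flat interval, forward and backward,
and their integer translates by pairs `(k, m)`. Pushing two translates forward until both are single
orbit points shows that they are ordered as the numbers `k * τ + m` (`B_lt_A`), so the combinatorics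
depend on the rotation number alone. The non-wandering set is the complement of the preimages of the
flat interval (`mem_nonWandering`). For two lifts with the same `τ`, a point of one set is matched
with a point of the other lying on the same sides of all preimages, by a Dedekind cut
(`exists_match`). Matching commutes with the maps and respects gaps. Its uniqueness, its continuity
and its quasi-symmetry all follow from metric control of the gaps.

The metric core is `split_all`: when a gap is subdivided at the next level, every preimage and every
smaller gap that appears is a definite fraction of it. It rests on three ingredients.

Distortion: since the derivative vanishes at the ends of the flat interval, `ℓ > 1`, and off that
interval `F'` is `((x - b) (a + 1 - x)) ^ (ℓ - 1)` times the exponential of a Lipschitz function.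
Without the Lipschitz factor `F' ^ (-1/2)` is convex (non-positive Schwarzian), so comparison with a
Möbius map shows that the cross-ratio grows at most by `exp (Λ * length)` (`crossRatio_le`). Images
of a short arc are essentially disjoint, so these errors have a bounded sum, and space around an
interval survives pulling back (`pull`). One passage near the flat interval is absorbed by a power
law.

A priori bounds: the shortest pair among finitely many orbit points has space on both sides. Pulled
back to the flat interval, it yields space beyond a closest return at one of any two consecutive
levels (`exists_good`), hence at all levels (`good_all`). As the flat interval has fixed length, its
preimage at a closest return then fills a definite part of the gap next to it (`w_ge_of_good`).

Bounded geometry and bounded type: the distances of closest returns decay at most geometrically, and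
a base gap is cut into boundedly many pieces. The estimate can therefore be carried from cut to cut
and then to all gaps of the partition.

Consequently the sizes of nested gaps decay at a rate between two geometric ones. The distance of
two points is comparable to the size of the gap at the level at which a preimage separates them.
This level is the same for both maps. Equal distances force the two separation levels to differ by a
bounded amount, and this property passes to the other map (`exists_ratio`, `exists_quasiSymm`). -/

noncomputable section

namespace FlatCircle

/-! ### Cross-ratios and lifts with distortion data -/

/-- The cross-ratio of four points of the line. -/
def crossRatio (y₀ y₁ y₂ y₃ : ℝ) : ℝ := (y₁ - y₀) * (y₃ - y₂) / ((y₂ - y₀) * (y₃ - y₁))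

/-- A lift to the line of a circle map with a flat interval and irrational rotation number `τ`,
together with the two distortion estimates that the local form of the map provides: a bound for
the distortion of cross-ratios off the flat interval, and power laws at its endpoints. -/
structure FlatLift where
  F : ℝ → ℝ
  mono : Monotone F
  cont : Continuous F
  add_one : ∀ x, F (x + 1) = F x + 1
  a : ℝ
  b : ℝ
  τ : ℝ
  a_lt_b : a < b
  b_lt : b < a + 1
  flat : ∀ x ∈ Icc a b, F x = F a
  strict : StrictMonoOn F (Icc b (a + 1))
  irr : Irrational τ
  add_lt_iter : ∀ (k : ℕ) (m : ℤ) (x : ℝ), (m : ℝ) < k * τ → x + m < F^[k] x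
  iter_lt_add : ∀ (k : ℕ) (m : ℤ) (x : ℝ), (k : ℝ) * τ < m → F^[k] x < x + m
  Λ : ℝ
  Λ_nonneg : 0 ≤ Λ
  cri : ∀ y₀ y₁ y₂ y₃, b ≤ y₀ → y₀ < y₁ → y₁ ≤ y₂ → y₂ < y₃ → y₃ ≤ a + 1 →
    crossRatio (F y₀) (F y₁) (F y₂) (F y₃) ≤ Real.exp (Λ * (y₃ - y₀)) * crossRatio y₀ y₁ y₂ y₃
  P : ℝ
  P_pos : 0 < P
  powR : ∀ u v y, b ≤ u → u ≤ v → v ≤ y → y ≤ a + 1 →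
    (F v - F u) * (y - b) ≤ P * (F y - F b) * (v - u)
  powL : ∀ y u v, b ≤ y → y ≤ u → u ≤ v → v ≤ a + 1 →
    (F v - F u) * (a + 1 - y) ≤ P * (F (a + 1) - F y) * (v - u)

theorem crossRatio_neg (y₀ y₁ y₂ y₃ : ℝ) :
    crossRatio (-y₀) (-y₁) (-y₂) (-y₃) = crossRatio y₃ y₂ y₁ y₀ := by
  unfold crossRatio; congr 1 <;> ring

theorem crossRatio_add (y₀ y₁ y₂ y₃ t : ℝ) :
    crossRatio (y₀ + t) (y₁ + t) (y₂ + t) (y₃ + t) = crossRatio y₀ y₁ y₂ y₃ := by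
  unfold crossRatio; congr 1 <;> ring

theorem crossRatio_rev (y₀ y₁ y₂ y₃ : ℝ) :
    crossRatio y₃ y₂ y₁ y₀ = crossRatio y₀ y₁ y₂ y₃ := by
  unfold crossRatio; congr 1 <;> ring

/-- A translate of the lift of the orbit of the flat interval: `(k, m)` stands for the `k`-th
iterate, moved by `m`. -/
abbrev Pos : Type := ℤ × ℤ

/-! ### Translates of the flat interval and their order -/

namespace FlatLift

variable (L : FlatLift)

theorem iter_mono (k : ℕ) : Monotone L.F^[k] := L.mono.iterate k

theorem add_int (m : ℤ) (x : ℝ) : L.F (x + m) = L.F x + m := by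
  induction m using Int.induction_on generalizing x with
  | zero => simp
  | succ i ih =>
    push_cast at ih ⊢
    rw [← add_assoc, L.add_one, ih]; ring
  | pred i ih =>
    have h := L.add_one (x + ((-(i : ℤ) - 1 : ℤ) : ℝ))
    have e : x + ((-(i : ℤ) - 1 : ℤ) : ℝ) + 1 = x + ((-(i : ℤ) : ℤ) : ℝ) := by push_cast; ring
    rw [e, ih] at h
    push_cast at h ⊢; linarith

theorem iter_add_int (k : ℕ) (m : ℤ) (x : ℝ) : L.F^[k] (x + m) = L.F^[k] x + m := by
  induction k generalizing x with
  | zero => simp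
  | succ k ih => rw [Function.iterate_succ_apply, Function.iterate_succ_apply, L.add_int, ih]

theorem iter_cont (k : ℕ) : Continuous L.F^[k] := L.cont.iterate k

theorem iter_surj (k : ℕ) : Function.Surjective L.F^[k] := by
  intro y
  set c := L.F^[k] 0
  have h1 : L.F^[k] (0 + (⌊y - c⌋ : ℤ)) ≤ y := by
    rw [iter_add_int]; have := Int.floor_le (y - c); linarith
  have h2 : y ≤ L.F^[k] (0 + (⌈y - c⌉ : ℤ)) := by
    rw [iter_add_int]; have := Int.le_ceil (y - c); linarith
  exact mem_range_of_exists_le_of_exists_ge (L.iter_cont k) ⟨_, h1⟩ ⟨_, h2⟩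

/-- The reflected lift `x ↦ -F (-x)`. -/
def reflect : FlatLift where
  F x := -L.F (-x)
  mono x y h := by simpa using L.mono (neg_le_neg h)
  cont := (L.cont.comp continuous_neg).neg
  add_one x := by
    have := L.add_one (-(x + 1))
    have e : -(x + 1) + 1 = -x := by ring
    rw [e] at this; linarith
  a := -L.b
  b := -L.a
  τ := -L.τ
  a_lt_b := by linarith [L.a_lt_b]
  b_lt := by linarith [L.b_lt]
  flat x hx := by
    rw [L.flat (-x) ⟨by linarith [hx.2], by linarith [hx.1]⟩,
      L.flat (- -L.b) ⟨by linarith [L.a_lt_b], by linarith⟩]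
  strict x hx y hy h := by
    -- The mirror image of `[b, a + 1]` is `[-a - 1, -b]`; the shift by one brings it to the
    -- fundamental arc of the reflected lift.
    have := L.strict (a := -y + 1) (b := -x + 1) ⟨by linarith [hy.2], by linarith [hy.1]⟩
      ⟨by linarith [hx.2], by linarith [hx.1]⟩ (by linarith)
    rw [L.add_one, L.add_one] at this
    show -L.F (-x) < -L.F (-y)
    linarith
  irr := L.irr.neg
  add_lt_iter k m x h := by
    have e : ∀ k : ℕ, (fun x => -L.F (-x))^[k] x = -L.F^[k] (-x) := by
      intro k; induction k with
      | zero => simp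
      | succ k ih => rw [Function.iterate_succ_apply', ih, Function.iterate_succ_apply', neg_neg]
    have := L.iter_lt_add k (-m) (-x) (by push_cast; linarith)
    rw [e]; push_cast at this; linarith
  iter_lt_add k m x h := by
    have e : ∀ k : ℕ, (fun x => -L.F (-x))^[k] x = -L.F^[k] (-x) := by
      intro k; induction k with
      | zero => simp
      | succ k ih => rw [Function.iterate_succ_apply', ih, Function.iterate_succ_apply', neg_neg]
    have := L.add_lt_iter k (-m) (-x) (by push_cast; linarith)
    rw [e]; push_cast at this; linarith
  Λ := L.Λ
  Λ_nonneg := L.Λ_nonneg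
  cri y₀ y₁ y₂ y₃ h0 h1 h2 h3 h4 := by
    have := L.cri (-y₃ + 1) (-y₂ + 1) (-y₁ + 1) (-y₀ + 1) (by linarith) (by linarith) (by linarith)
      (by linarith) (by linarith)
    simp only [L.add_one, crossRatio_add] at this
    rw [crossRatio_neg, crossRatio_rev] at *
    convert this using 3
    ring
  P := L.P
  P_pos := L.P_pos
  powR u v y h0 h1 h2 h3 := by
    have := L.powL (-y + 1) (-v + 1) (-u + 1) (by linarith) (by linarith) (by linarith)
      (by linarith)
    simp only [L.add_one, neg_neg] at this ⊢
    convert this using 1 <;> ring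
  powL y u v h0 h1 h2 h3 := by
    have := L.powR (-v + 1) (-u + 1) (-y + 1) (by linarith) (by linarith) (by linarith)
      (by linarith)
    have e : -(-L.b + 1) = L.b + ((-1 : ℤ) : ℝ) := by push_cast; ring
    simp only [L.add_one, e, L.add_int] at this ⊢
    push_cast
    convert this using 1 <;> ring

/-- The position of a translate with respect to the rotation. -/
def v (p : Pos) : ℝ := p.1 * L.τ + p.2

theorem v_add (p p' : Pos) : L.v (p + p') = L.v p + L.v p' := by
  simp [v]; ring

theorem v_sub (p p' : Pos) : L.v (p - p') = L.v p - L.v p' := by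
  simp [v]; ring

theorem v_neg (p : Pos) : L.v (-p) = -L.v p := by
  simp [v]; ring

theorem v_zero : L.v 0 = 0 := by simp [v]

theorem v_int (m : ℤ) : L.v (0, m) = m := by simp [v]

/-- Irrationality of `τ`. Questions about two translates become trichotomies on `v`, with equality
of positions as the middle case. -/
theorem v_inj {p p' : Pos} (h : L.v p = L.v p') : p = p' := by
  unfold v at h
  by_cases h1 : p.1 = p'.1
  · rw [h1] at h
    have : (p.2 : ℝ) = p'.2 := by linarith
    exact Prod.ext h1 (by exact_mod_cast this)
  · exfalso
    have h2 : (p.1 - p'.1 : ℤ) ≠ 0 := sub_ne_zero.mpr h1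
    have := (L.irr.intCast_mul h2).ne_int (p'.2 - p.2)
    apply this; push_cast; linarith

/-- The left endpoint of a translate. -/
def A (p : Pos) : ℝ := sInf {x | L.F^[p.1.toNat] L.a + p.2 ≤ L.F^[(-p.1).toNat] x}

/-- The right endpoint of a translate. -/
def B (p : Pos) : ℝ := sSup {x | L.F^[(-p.1).toNat] x ≤ L.F^[p.1.toNat] L.b + p.2}

/-- One of the two `toNat` exponents is always zero, so a single formula covers images and
preimages. By continuity the infimum is attained, and the endpoint is a Galois adjoint to iteration.
-/
theorem A_le_iff {p : Pos} {x : ℝ} :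
    L.A p ≤ x ↔ L.F^[p.1.toNat] L.a + p.2 ≤ L.F^[(-p.1).toNat] x := by
  set S := {x | L.F^[p.1.toNat] L.a + p.2 ≤ L.F^[(-p.1).toNat] x} with hS
  have hcl : IsClosed S := isClosed_le continuous_const (L.iter_cont _)
  obtain ⟨x₀, hx₀⟩ := L.iter_surj (-p.1).toNat (L.F^[p.1.toNat] L.a + p.2)
  obtain ⟨x₁, hx₁⟩ := L.iter_surj (-p.1).toNat (L.F^[p.1.toNat] L.a + p.2 - 1)
  have hne : S.Nonempty := ⟨x₀, hx₀.ge⟩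
  have hb : BddBelow S := ⟨x₁, fun y hy => by
    by_contra hlt
    have := L.iter_mono (-p.1).toNat (not_le.1 hlt).le
    have hy' : L.F^[p.1.toNat] L.a + p.2 ≤ L.F^[(-p.1).toNat] y := hy
    linarith⟩
  constructor
  · intro h
    exact le_trans (hcl.csInf_mem hne hb) (L.iter_mono _ h)
  · intro h; exact csInf_le hb h

theorem le_B_iff {p : Pos} {x : ℝ} :
    x ≤ L.B p ↔ L.F^[(-p.1).toNat] x ≤ L.F^[p.1.toNat] L.b + p.2 := by
  set S := {x | L.F^[(-p.1).toNat] x ≤ L.F^[p.1.toNat] L.b + p.2} with hS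
  have hcl : IsClosed S := isClosed_le (L.iter_cont _) continuous_const
  obtain ⟨x₀, hx₀⟩ := L.iter_surj (-p.1).toNat (L.F^[p.1.toNat] L.b + p.2)
  obtain ⟨x₁, hx₁⟩ := L.iter_surj (-p.1).toNat (L.F^[p.1.toNat] L.b + p.2 + 1)
  have hne : S.Nonempty := ⟨x₀, hx₀.le⟩
  have hb : BddAbove S := ⟨x₁, fun y hy => by
    by_contra hlt
    have := L.iter_mono (-p.1).toNat (not_le.1 hlt).le
    have hy' : L.F^[(-p.1).toNat] y ≤ L.F^[p.1.toNat] L.b + p.2 := hy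
    linarith⟩
  constructor
  · intro h
    exact le_trans (L.iter_mono _ h) (hcl.csSup_mem hne hb)
  · intro h; exact le_csSup hb h

theorem iter_A (p : Pos) : L.F^[(-p.1).toNat] (L.A p) = L.F^[p.1.toNat] L.a + p.2 := by
  refine le_antisymm ?_ (L.A_le_iff.1 le_rfl)
  obtain ⟨x₀, hx₀⟩ := L.iter_surj (-p.1).toNat (L.F^[p.1.toNat] L.a + p.2)
  rw [← hx₀]
  exact L.iter_mono _ (L.A_le_iff.2 hx₀.ge)

theorem iter_B (p : Pos) : L.F^[(-p.1).toNat] (L.B p) = L.F^[p.1.toNat] L.b + p.2 := by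
  refine le_antisymm (L.le_B_iff.1 le_rfl) ?_
  obtain ⟨x₀, hx₀⟩ := L.iter_surj (-p.1).toNat (L.F^[p.1.toNat] L.b + p.2)
  rw [← hx₀]
  exact L.iter_mono _ (L.le_B_iff.2 hx₀.le)

theorem A_nat (k : ℕ) (m : ℤ) : L.A (k, m) = L.F^[k] L.a + m := by
  have := L.iter_A (k, m)
  simpa using this

theorem B_nat (k : ℕ) (m : ℤ) : L.B (k, m) = L.F^[k] L.b + m := by
  have := L.iter_B (k, m)
  simpa using this

theorem A_int (m : ℤ) : L.A (0, m) = L.a + m := by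
  simpa using L.A_nat 0 m

theorem B_int (m : ℤ) : L.B (0, m) = L.b + m := by
  simpa using L.B_nat 0 m

theorem A_zero : L.A 0 = L.a := by simpa [Prod.mk_zero_zero] using L.A_int 0

theorem B_zero : L.B 0 = L.b := by simpa [Prod.mk_zero_zero] using L.B_int 0

theorem A_succ (p : Pos) : L.A (p + (1, 0)) = L.F (L.A p) := by
  obtain ⟨k, m⟩ := p
  rcases le_or_gt 0 k with hk | hk
  · lift k to ℕ using hk
    have e : (((k : ℤ), m) : Pos) + (1, 0) = (((k + 1 : ℕ) : ℤ), m) := by simp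
    rw [e, A_nat, A_nat, L.add_int, Function.iterate_succ_apply']
  · obtain ⟨j, rfl⟩ : ∃ j : ℕ, k = -(j : ℤ) - 1 := ⟨(-k - 1).toNat, by omega⟩
    have e : ((-(j : ℤ) - 1, m) : Pos) + (1, 0) = (-(j : ℤ), m) := by simp
    have t1 : (-(-(j : ℤ))).toNat = j := by simp
    have t2 : (-(j : ℤ)).toNat = 0 := by omega
    have t3 : (-(-(j : ℤ) - 1)).toNat = j + 1 := by omega
    have t4 : (-(j : ℤ) - 1).toNat = 0 := by omega
    rw [e]
    apply le_antisymm
    · rw [A_le_iff]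
      have := L.iter_A (-(j : ℤ) - 1, m)
      simp only [t1, t2, t3, t4, Function.iterate_zero, id, Function.iterate_succ_apply] at this ⊢
      exact this.ge
    · obtain ⟨y, hy⟩ := L.iter_surj 1 (L.A (-(j : ℤ), m))
      rw [Function.iterate_one] at hy
      rw [← hy]
      apply L.mono
      rw [A_le_iff]
      have := L.iter_A (-(j : ℤ), m)
      simp only [t1, t2, t3, t4, Function.iterate_zero, id, Function.iterate_succ_apply] at this ⊢
      rw [hy]; exact this.ge

theorem B_succ (p : Pos) : L.B (p + (1, 0)) = L.F (L.B p) := by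
  obtain ⟨k, m⟩ := p
  rcases le_or_gt 0 k with hk | hk
  · lift k to ℕ using hk
    have e : (((k : ℤ), m) : Pos) + (1, 0) = (((k + 1 : ℕ) : ℤ), m) := by simp
    rw [e, B_nat, B_nat, L.add_int, Function.iterate_succ_apply']
  · obtain ⟨j, rfl⟩ : ∃ j : ℕ, k = -(j : ℤ) - 1 := ⟨(-k - 1).toNat, by omega⟩
    have e : ((-(j : ℤ) - 1, m) : Pos) + (1, 0) = (-(j : ℤ), m) := by simp
    have t1 : (-(-(j : ℤ))).toNat = j := by simp
    have t2 : (-(j : ℤ)).toNat = 0 := by omega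
    have t3 : (-(-(j : ℤ) - 1)).toNat = j + 1 := by omega
    have t4 : (-(j : ℤ) - 1).toNat = 0 := by omega
    rw [e]
    apply le_antisymm
    · obtain ⟨y, hy⟩ := L.iter_surj 1 (L.B (-(j : ℤ), m))
      rw [Function.iterate_one] at hy
      rw [← hy]
      apply L.mono
      rw [le_B_iff]
      have := L.iter_B (-(j : ℤ), m)
      simp only [t1, t2, t3, t4, Function.iterate_zero, id, Function.iterate_succ_apply] at this ⊢
      rw [hy]; exact this.le
    · rw [le_B_iff]
      have := L.iter_B (-(j : ℤ) - 1, m)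
      simp only [t1, t2, t3, t4, Function.iterate_zero, id, Function.iterate_succ_apply] at this ⊢
      exact this.le

theorem A_add_nat (p : Pos) (k : ℕ) : L.A (p + ((k : ℤ), 0)) = L.F^[k] (L.A p) := by
  induction k with
  | zero => simp [Prod.mk_zero_zero]
  | succ k ih =>
    rw [Function.iterate_succ_apply', ← ih, ← A_succ]
    congr 1; simp [add_assoc]

theorem B_add_nat (p : Pos) (k : ℕ) : L.B (p + ((k : ℤ), 0)) = L.F^[k] (L.B p) := by
  induction k with
  | zero => simp [Prod.mk_zero_zero]
  | succ k ih =>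
    rw [Function.iterate_succ_apply', ← ih, ← B_succ]
    congr 1; simp [add_assoc]

theorem A_add_int (p : Pos) (m : ℤ) : L.A (p + (0, m)) = L.A p + m := by
  have h : ∀ x, L.A (p + (0, m)) ≤ x ↔ L.A p + m ≤ x := by
    intro x
    rw [← le_sub_iff_add_le (b := (m : ℝ)) (c := x), A_le_iff, A_le_iff]
    have : L.F^[(-p.1).toNat] x = L.F^[(-p.1).toNat] (x - m) + m := by
      rw [← iter_add_int]; simp
    simp only [Prod.fst_add, Prod.snd_add, add_zero]
    rw [this]; push_cast
    constructor <;> intro h <;> linarith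
  exact le_antisymm ((h _).2 le_rfl) ((h _).1 le_rfl)

theorem B_add_int (p : Pos) (m : ℤ) : L.B (p + (0, m)) = L.B p + m := by
  have h : ∀ x, x ≤ L.B (p + (0, m)) ↔ x ≤ L.B p + m := by
    intro x
    rw [← sub_le_iff_le_add (a := x), le_B_iff, le_B_iff]
    have : L.F^[(-p.1).toNat] x = L.F^[(-p.1).toNat] (x - m) + m := by
      rw [← iter_add_int]; simp
    simp only [Prod.fst_add, Prod.snd_add, add_zero]
    rw [this]; push_cast
    constructor <;> intro h <;> linarith
  exact le_antisymm ((h _).1 le_rfl) ((h _).2 le_rfl)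

theorem orbit_lt {k k' : ℕ} {m m' : ℤ} (x : ℝ) (h : (k : ℝ) * L.τ + m < k' * L.τ + m') :
    L.F^[k] x + m < L.F^[k'] x + m' := by
  rcases le_total k k' with hk | hk
  · obtain ⟨j, rfl⟩ := Nat.exists_eq_add_of_le hk
    have := L.add_lt_iter j (m - m') (L.F^[k] x) (by push_cast at h ⊢; linarith)
    rw [← Function.iterate_add_apply, add_comm j k] at this
    push_cast at this; linarith
  · obtain ⟨j, rfl⟩ := Nat.exists_eq_add_of_le hk
    have := L.iter_lt_add j (m' - m) (L.F^[k'] x) (by push_cast at h ⊢; linarith)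
    rw [← Function.iterate_add_apply, add_comm j k'] at this
    push_cast at this; linarith

theorem iter_b {k : ℕ} (hk : 1 ≤ k) : L.F^[k] L.b = L.F^[k] L.a := by
  obtain ⟨j, rfl⟩ := Nat.exists_eq_add_of_le' hk
  rw [Function.iterate_succ_apply, Function.iterate_succ_apply,
    L.flat L.b ⟨L.a_lt_b.le, le_rfl⟩]

/-- After enough forward iterates both translates are single points of the orbit of `a`, and these
are ordered as the rotation (`orbit_lt`). Monotonicity carries a wrong order forward, where it is
impossible. -/
theorem B_lt_A {p p' : Pos} (h : L.v p < L.v p') : L.B p < L.A p' := by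
  by_contra hc
  rw [not_lt] at hc
  obtain ⟨k, m⟩ := p
  obtain ⟨k', m'⟩ := p'
  -- The extra one makes both times at least one, where the images of `a` and `b` coincide.
  set K : ℕ := k.natAbs + k'.natAbs + 1
  have h1 := L.iter_mono K hc
  rw [← A_add_nat, ← B_add_nat] at h1
  obtain ⟨i, hi⟩ : ∃ i : ℕ, k + K = i := ⟨(k + K).toNat, by omega⟩
  obtain ⟨i', hi'⟩ : ∃ i : ℕ, k' + K = i := ⟨(k' + K).toNat, by omega⟩
  have e1 : ((k, m) : Pos) + ((K : ℤ), 0) = ((i : ℤ), m) := by simp [hi]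
  have e2 : ((k', m') : Pos) + ((K : ℤ), 0) = ((i' : ℤ), m') := by simp [hi']
  rw [e1, e2, A_nat, B_nat, L.iter_b (by omega)] at h1
  have c1 : (k : ℝ) + K = i := by exact_mod_cast hi
  have c2 : (k' : ℝ) + K = i' := by exact_mod_cast hi'
  have := L.orbit_lt (k := i) (k' := i') (m := m) (m' := m') L.a (by
    rw [← c1, ← c2]; simp only [v] at h; linarith)
  linarith

theorem A_eq_B {p : Pos} (h : 1 ≤ p.1) : L.A p = L.B p := by
  obtain ⟨k, m⟩ := p
  simp only at h
  lift k to ℕ using by omega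
  rw [A_nat, B_nat, L.iter_b (by omega)]

theorem A_lt_B {p : Pos} (h : p.1 ≤ 0) : L.A p < L.B p := by
  obtain ⟨k, m⟩ := p
  obtain ⟨j, rfl⟩ : ∃ j : ℕ, k = -(j : ℤ) := ⟨(-k).toNat, by simp at h; omega⟩
  have t1 : (-(-(j : ℤ))).toNat = j := by simp
  have t2 : (-(j : ℤ)).toNat = 0 := by omega
  have h1 := L.iter_A (-(j : ℤ), m)
  have h2 := L.iter_B (-(j : ℤ), m)
  simp only [t1, t2, Function.iterate_zero, id] at h1 h2
  by_contra hc
  have := L.iter_mono j (not_lt.1 hc)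
  linarith [L.a_lt_b]

theorem A_le_B (p : Pos) : L.A p ≤ L.B p := by
  rcases le_or_gt p.1 0 with h | h
  · exact (L.A_lt_B h).le
  · exact (L.A_eq_B (by omega)).le

theorem A_lt_A {p p' : Pos} (h : L.v p < L.v p') : L.A p < L.A p' :=
  (L.A_le_B p).trans_lt (L.B_lt_A h)

theorem B_lt_B {p p' : Pos} (h : L.v p < L.v p') : L.B p < L.B p' :=
  (L.B_lt_A h).trans_le (L.A_le_B p')

theorem A_mono {p p' : Pos} (h : L.v p ≤ L.v p') : L.A p ≤ L.A p' := by
  rcases h.lt_or_eq with h | h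
  · exact (L.A_lt_A h).le
  · rw [L.v_inj h]

theorem B_mono {p p' : Pos} (h : L.v p ≤ L.v p') : L.B p ≤ L.B p' := by
  rcases h.lt_or_eq with h | h
  · exact (L.B_lt_B h).le
  · rw [L.v_inj h]

/-- Strict monotonicity on `[b, a + 1]`: a segment collapsed by `F` lies in one translate of the
flat interval. -/
theorem exists_flat_of_eq {s t : ℝ} (h : s < t) (hF : L.F s = L.F t) :
    ∃ m : ℤ, L.a + m ≤ s ∧ t ≤ L.b + m := by
  refine ⟨⌊s - L.a⌋, by linarith [Int.floor_le (s - L.a)], ?_⟩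
  set m := ⌊s - L.a⌋
  have hm : s < L.a + 1 + m := by linarith [Int.lt_floor_add_one (s - L.a)]
  by_contra hc
  rw [not_le] at hc
  have hb := L.b_lt
  have h1 : max s (L.b + m) < min t (L.a + 1 + m) :=
    max_lt (lt_min h hm) (lt_min hc (by linarith))
  have h2 := L.strict (a := max s (L.b + m) - m) (b := min t (L.a + 1 + m) - m)
    ⟨by linarith [le_max_right s (L.b + m)], by linarith [min_le_right t (L.a + 1 + m)]⟩
    ⟨by linarith [le_max_right s (L.b + m)], by linarith [min_le_right t (L.a + 1 + m)]⟩
    (by linarith)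
  have e : ∀ x : ℝ, L.F (x - m) = L.F x - m := by
    intro x
    have := L.add_int m (x - m)
    rw [sub_add_cancel] at this; linarith
  rw [e, e] at h2
  have h3 := L.mono (le_max_left s (L.b + m))
  have h4 := L.mono (min_le_left t (L.a + 1 + m))
  linarith

/-- If equality held, the segment from `A p` to `x` would be collapsed, so its image would be a
translate of time one; but `p + (1, 0)` has time at most zero. -/
theorem A_succ_lt {p : Pos} (hp : p.1 < 0) {x : ℝ} (h : L.A p < x) : L.A (p + (1, 0)) < L.F x := by
  rw [A_succ]
  refine lt_of_le_of_ne (L.mono h.le) fun he => ?_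
  obtain ⟨m, h1, h2⟩ := L.exists_flat_of_eq h he
  have h3 : L.F (L.A p) = L.A (1, m) := by
    have e : L.A (1, m) = L.F L.a + m := by simpa using L.A_nat 1 m
    rw [e, ← L.add_int]
    have := L.flat (L.A p - m) ⟨by linarith, by linarith⟩
    have h4 := L.add_int m (L.A p - m)
    rw [sub_add_cancel, this, ← L.add_int] at h4
    exact h4
  rw [← A_succ] at h3
  have h5 : p + (1, 0) = (1, m) := by
    rcases lt_trichotomy (L.v (p + (1, 0))) (L.v (1, m)) with h | h | h
    · exact absurd h3 (L.A_lt_A h).ne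
    · exact L.v_inj h
    · exact absurd h3 (L.A_lt_A h).ne'
  have : p.1 + 1 = 1 := congrArg Prod.fst h5
  omega

theorem lt_B_succ {p : Pos} (hp : p.1 < 0) {x : ℝ} (h : x < L.B p) : L.F x < L.B (p + (1, 0)) := by
  rw [B_succ]
  refine lt_of_le_of_ne (L.mono h.le) fun he => ?_
  obtain ⟨m, h1, h2⟩ := L.exists_flat_of_eq h he
  have h3 : L.F (L.B p) = L.B (1, m) := by
    have e : L.B (1, m) = L.F L.b + m := by simpa using L.B_nat 1 m
    rw [e, L.flat L.b ⟨L.a_lt_b.le, le_rfl⟩]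
    have := L.flat (L.B p - m) ⟨by linarith, by linarith⟩
    have h4 := L.add_int m (L.B p - m)
    rw [sub_add_cancel, this] at h4
    exact h4
  rw [← B_succ] at h3
  have h5 : p + (1, 0) = (1, m) := by
    rcases lt_trichotomy (L.v (p + (1, 0))) (L.v (1, m)) with h | h | h
    · exact absurd h3 (L.B_lt_B h).ne
    · exact L.v_inj h
    · exact absurd h3 (L.B_lt_B h).ne'
  have : p.1 + 1 = 1 := congrArg Prod.fst h5
  omega

/-- As long as the times stay non-positive, strict position relative to an endpoint can be tested
after iterating. This is what lets gaps be pulled back exactly. -/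
theorem lt_iter_iff {p : Pos} {i : ℕ} (hp : p.1 + i ≤ 0) {x : ℝ} :
    L.A (p + ((i : ℤ), 0)) < L.F^[i] x ↔ L.A p < x := by
  constructor
  · intro h
    by_contra hc
    rw [A_add_nat] at h
    exact absurd (L.iter_mono i (not_lt.1 hc)) (not_le.2 h)
  · intro h
    induction i with
    | zero => simpa [Prod.mk_zero_zero] using h
    | succ i ih =>
      have h1 := L.A_succ_lt (p := p + ((i : ℤ), 0)) (by simp; push_cast at hp; omega)
        (ih (by push_cast at hp; omega))
      rw [Function.iterate_succ_apply']
      convert h1 using 2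
      simp [add_assoc]

theorem iter_lt_iff {p : Pos} {i : ℕ} (hp : p.1 + i ≤ 0) {x : ℝ} :
    L.F^[i] x < L.B (p + ((i : ℤ), 0)) ↔ x < L.B p := by
  constructor
  · intro h
    by_contra hc
    rw [B_add_nat] at h
    exact absurd (L.iter_mono i (not_lt.1 hc)) (not_le.2 h)
  · intro h
    induction i with
    | zero => simpa [Prod.mk_zero_zero] using h
    | succ i ih =>
      have h1 := L.lt_B_succ (p := p + ((i : ℤ), 0)) (by simp; push_cast at hp; omega)
        (ih (by push_cast at hp; omega))
      rw [Function.iterate_succ_apply']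
      convert h1 using 2
      simp [add_assoc]

/-- The length of a translate. -/
def w (p : Pos) : ℝ := L.B p - L.A p

/-- The distance between two translates. -/
def gl (p p' : Pos) : ℝ := max (L.A p) (L.A p') - min (L.B p) (L.B p')

theorem gl_comm (p p' : Pos) : L.gl p p' = L.gl p' p := by
  unfold gl; rw [max_comm, min_comm]

theorem gl_eq {p p' : Pos} (h : L.v p < L.v p') : L.gl p p' = L.A p' - L.B p := by
  unfold gl; rw [max_eq_right (L.A_lt_A h).le, min_eq_left (L.B_lt_B h).le]

theorem gl_pos {p p' : Pos} (h : p ≠ p') : 0 < L.gl p p' := by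
  rcases lt_trichotomy (L.v p) (L.v p') with h1 | h1 | h1
  · rw [L.gl_eq h1]; linarith [L.B_lt_A h1]
  · exact absurd (L.v_inj h1) h
  · rw [gl_comm, L.gl_eq h1]; linarith [L.B_lt_A h1]

theorem w_nonneg (p : Pos) : 0 ≤ L.w p := by linarith [L.A_le_B p, show L.w p = L.B p - L.A p from rfl]

theorem w_pos {p : Pos} (h : p.1 ≤ 0) : 0 < L.w p := by
  linarith [L.A_lt_B h, show L.w p = L.B p - L.A p from rfl]

end FlatLift

/-! ### Cross-ratios, space and the macroscopic Koebe principle -/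

theorem crossRatio_nonneg {y₀ y₁ y₂ y₃ : ℝ} (h1 : y₀ < y₁) (h2 : y₁ ≤ y₂) (h3 : y₂ < y₃) :
    0 ≤ crossRatio y₀ y₁ y₂ y₃ := by
  unfold crossRatio
  apply div_nonneg <;> apply mul_nonneg <;> linarith

theorem crossRatio_le_left {y₀ y₁ y₂ y₃ : ℝ} (h1 : y₀ < y₁) (h2 : y₁ ≤ y₂) (h3 : y₂ < y₃) :
    crossRatio y₀ y₁ y₂ y₃ * (y₂ - y₀) ≤ y₁ - y₀ := by
  unfold crossRatio
  have e1 : 0 < y₂ - y₀ := by linarith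
  have e2 : 0 < y₃ - y₁ := by linarith
  rw [div_mul_eq_mul_div, div_le_iff₀ (by positivity)]
  have : 0 ≤ (y₁ - y₀) * (y₂ - y₀) * (y₂ - y₁) := by
    apply mul_nonneg (mul_nonneg _ _) <;> linarith
  nlinarith

theorem crossRatio_le_right {y₀ y₁ y₂ y₃ : ℝ} (h1 : y₀ < y₁) (h2 : y₁ ≤ y₂) (h3 : y₂ < y₃) :
    crossRatio y₀ y₁ y₂ y₃ * (y₃ - y₁) ≤ y₃ - y₂ := by
  have := crossRatio_le_left (y₀ := -y₃) (y₁ := -y₂) (y₂ := -y₁) (y₃ := -y₀) (by linarith)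
    (by linarith) (by linarith)
  rw [crossRatio_neg] at this
  linarith

/-- The cross-ratio is a product of two proportions, one for each side, and space `η` bounds each of
them below by `η / (1 + η)`. -/
theorem le_crossRatio {y₀ y₁ y₂ y₃ η : ℝ} (hη : 0 < η) (h1 : y₀ < y₁) (h2 : y₁ ≤ y₂)
    (h3 : y₂ < y₃) (hl : η * (y₂ - y₁) ≤ y₁ - y₀) (hr : η * (y₂ - y₁) ≤ y₃ - y₂) :
    (η / (1 + η)) ^ 2 ≤ crossRatio y₀ y₁ y₂ y₃ := by
  have e1 : 0 < y₂ - y₀ := by linarith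
  have e2 : 0 < y₃ - y₁ := by linarith
  have hl' : η / (1 + η) ≤ (y₁ - y₀) / (y₂ - y₀) := by
    rw [div_le_div_iff₀ (by positivity) e1]; nlinarith
  have hr' : η / (1 + η) ≤ (y₃ - y₂) / (y₃ - y₁) := by
    rw [div_le_div_iff₀ (by positivity) e2]; nlinarith
  unfold crossRatio
  rw [mul_div_mul_comm, sq]
  apply mul_le_mul hl' hr' (by positivity)
  apply div_nonneg <;> linarith

namespace FlatLift

variable (L : FlatLift)

/-- The reflection of positions. -/
def _root_.FlatCircle.Pos.refl (p : Pos) : Pos := (p.1, -p.2)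

theorem reflect_iter (k : ℕ) (x : ℝ) : L.reflect.F^[k] x = -L.F^[k] (-x) := by
  induction k with
  | zero => simp
  | succ k ih =>
    rw [Function.iterate_succ_apply', ih, Function.iterate_succ_apply']
    simp [reflect]

theorem reflect_v (p : Pos) : L.reflect.v p.refl = -L.v p := by
  simp [v, reflect, Pos.refl]; ring

theorem reflect_A (p : Pos) : L.reflect.A p.refl = -L.B p := by
  have h : ∀ x, L.reflect.A p.refl ≤ x ↔ -L.B p ≤ x := by
    intro x
    rw [A_le_iff, neg_le, le_B_iff, reflect_iter, reflect_iter]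
    simp only [Pos.refl, reflect, neg_neg]; push_cast
    constructor <;> intro h <;> linarith
  exact le_antisymm ((h _).2 le_rfl) ((h _).1 le_rfl)

theorem reflect_B (p : Pos) : L.reflect.B p.refl = -L.A p := by
  have h : ∀ x, x ≤ L.reflect.B p.refl ↔ x ≤ -L.A p := by
    intro x
    rw [le_B_iff, le_neg, A_le_iff, reflect_iter, reflect_iter]
    simp only [Pos.refl, reflect, neg_neg]; push_cast
    constructor <;> intro h <;> linarith
  exact le_antisymm ((h _).1 le_rfl) ((h _).2 le_rfl)

theorem reflect_w (p : Pos) : L.reflect.w p.refl = L.w p := by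
  unfold w; rw [reflect_A, reflect_B]; ring

theorem reflect_gl (p p' : Pos) : L.reflect.gl p.refl p'.refl = L.gl p p' := by
  unfold gl; rw [reflect_A, reflect_B, reflect_A, reflect_B, max_neg_neg, min_neg_neg]; ring

theorem gl_add {p₀ p₁ p₂ : Pos} (h : L.v p₀ < L.v p₁) (h' : L.v p₁ < L.v p₂) :
    L.gl p₀ p₂ = L.gl p₀ p₁ + L.w p₁ + L.gl p₁ p₂ := by
  rw [L.gl_eq h, L.gl_eq h', L.gl_eq (h.trans h'), w]; ring

theorem gl_mono {p₀ p₁ p₂ p₃ : Pos} (h : L.v p₀ ≤ L.v p₁) (h' : L.v p₁ < L.v p₂)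
    (h'' : L.v p₂ ≤ L.v p₃) : L.gl p₁ p₂ ≤ L.gl p₀ p₃ := by
  rw [L.gl_eq h', L.gl_eq (by linarith)]
  linarith [L.A_mono h'', L.B_mono h]

theorem w_le_gl {p₀ p₁ p₂ : Pos} (h : L.v p₀ < L.v p₁) (h' : L.v p₁ < L.v p₂) :
    L.w p₁ ≤ L.gl p₀ p₂ := by
  rw [L.gl_eq (by linarith), w]
  linarith [L.A_lt_A h', L.B_lt_A h, L.B_lt_A h']

theorem gl_add_int (p p' : Pos) (m : ℤ) : L.gl (p + (0, m)) (p' + (0, m)) = L.gl p p' := by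
  unfold gl
  rw [A_add_int, A_add_int, B_add_int, B_add_int, max_add_add_right, min_add_add_right]; ring

theorem w_add_int (p : Pos) (m : ℤ) : L.w (p + (0, m)) = L.w p := by
  unfold w; rw [A_add_int, B_add_int]; ring

theorem gl_le_one {p p' : Pos} (h : |L.v p' - L.v p| ≤ 1) : L.gl p p' ≤ 1 := by
  wlog hv : L.v p ≤ L.v p' generalizing p p'
  · rw [gl_comm]; exact this (by rwa [abs_sub_comm]) (by linarith)
  rcases hv.lt_or_eq with hv | hv
  · rw [L.gl_eq hv]
    rw [abs_of_pos (by linarith)] at h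
    have : L.v p' ≤ L.v (p + (0, 1)) := by rw [v_add, v_int]; push_cast; linarith
    have := L.A_mono this
    rw [A_add_int] at this
    push_cast at this
    linarith [L.A_le_B p]
  · rw [L.v_inj hv]
    unfold gl; rw [max_self, min_self]; linarith [L.A_le_B p']

/-- Among the first `N` iterates, an arc shorter than the distance between two of the first `N`
points of an orbit of the rotation has disjoint images. -/
theorem sum_le_one {N : ℕ} {p e : Pos} {δ : ℝ} (hδ : δ ≤ 1) (he0 : 0 ≤ L.v e) (he : L.v e ≤ δ)
    (h : ∀ j : ℕ, 0 < j → j < N → ∀ m : ℤ, δ ≤ |j * L.τ + m|) :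
    ∑ k ∈ Finset.range N, (L.A (p + e + ((k : ℤ), 0)) - L.A (p + ((k : ℤ), 0))) ≤ 1 := by
  -- The integer that moves the `k`-th image into the fundamental domain starting at `A p`.
  set m : ℕ → ℤ := fun k => -⌊(k : ℝ) * L.τ⌋ with hm
  have hm1 : ∀ k : ℕ, 0 ≤ (k : ℝ) * L.τ + m k := fun k => by
    have := Int.floor_le ((k : ℝ) * L.τ); simp only [hm]; push_cast; linarith
  have hm2 : ∀ k : ℕ, (k : ℝ) * L.τ + m k < 1 := fun k => by
    have := Int.lt_floor_add_one ((k : ℝ) * L.τ); simp only [hm]; push_cast; linarith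
  set I : ℕ → Set ℝ := fun k => Ico (L.A (p + ((k : ℤ), m k))) (L.A (p + e + ((k : ℤ), m k)))
  have hlen : ∀ k : ℕ, L.A (p + e + ((k : ℤ), m k)) - L.A (p + ((k : ℤ), m k)) =
      L.A (p + e + ((k : ℤ), 0)) - L.A (p + ((k : ℤ), 0)) := by
    intro k
    have : (((k : ℤ), m k) : Pos) = ((k : ℤ), 0) + (0, m k) := by simp
    rw [this, ← add_assoc, ← add_assoc, A_add_int, A_add_int]; ring
  have hvk : ∀ (q : Pos) (k : ℕ), L.v (q + ((k : ℤ), m k)) = L.v q + (k * L.τ + m k) := by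
    intro q k; rw [v_add]; simp [v]
  have hnn : ∀ k : ℕ, 0 ≤ L.A (p + e + ((k : ℤ), m k)) - L.A (p + ((k : ℤ), m k)) := by
    intro k
    have := L.A_mono (p := p + ((k : ℤ), m k)) (p' := p + e + ((k : ℤ), m k))
      (by rw [hvk, hvk, v_add]; linarith)
    linarith
  have hdisj : (↑(Finset.range N) : Set ℕ).PairwiseDisjoint I := by
    have key : ∀ k k' : ℕ, k' < N → k < k' → Disjoint (I k) (I k') := by
      intro k k' hk' hkk
      have h1 := h (k' - k) (by omega) (by omega) (m k' - m k)
      rw [Nat.cast_sub hkk.le] at h1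
      push_cast at h1
      rcases le_abs.1 h1 with h2 | h2
      · refine Set.disjoint_left.2 fun x hx hx' => ?_
        have : L.A (p + e + ((k : ℤ), m k)) ≤ L.A (p + ((k' : ℤ), m k')) :=
          L.A_mono (by rw [hvk, hvk, v_add]; linarith)
        linarith [hx.2, hx'.1]
      · refine Set.disjoint_left.2 fun x hx hx' => ?_
        have : L.A (p + e + ((k' : ℤ), m k')) ≤ L.A (p + ((k : ℤ), m k)) :=
          L.A_mono (by rw [hvk, hvk, v_add]; linarith)
        linarith [hx.1, hx'.2]
    intro k hk k' hk' hne
    simp only [Finset.coe_range, mem_Iio] at hk hk'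
    rcases lt_or_gt_of_ne hne with hlt | hlt
    · exact key k k' hk' hlt
    · exact (key k' k hk hlt).symm
  have hsub : (⋃ k ∈ Finset.range N, I k) ⊆ Ico (L.A p) (L.A p + 1) := by
    intro x hx
    simp only [mem_iUnion, Finset.mem_range] at hx
    obtain ⟨k, hk, hx⟩ := hx
    constructor
    · exact le_trans (L.A_mono (by rw [hvk]; linarith [hm1 k])) hx.1
    · refine lt_of_lt_of_le hx.2 ?_
      have : L.A p + 1 = L.A (p + (0, 1)) := by rw [A_add_int]; simp
      rw [this]
      apply L.A_mono
      rw [hvk, v_add, v_add, v_int]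
      push_cast
      rcases Nat.eq_zero_or_pos k with rfl | hk0
      · simp [hm]; linarith
      -- Separation from the integer one keeps the right end of the `k`-th arc inside the
      -- fundamental domain.
      · have h1 := h k hk0 hk (m k - 1)
        push_cast at h1
        rw [abs_of_neg (by linarith [hm2 k])] at h1
        linarith
  have hvol := MeasureTheory.measure_mono (μ := MeasureTheory.volume) hsub
  rw [MeasureTheory.measure_biUnion_finset hdisj (fun k _ => measurableSet_Ico)] at hvol
  simp only [I, Real.volume_Ico] at hvol
  rw [← ENNReal.ofReal_sum_of_nonneg (fun k _ => hnn k), add_sub_cancel_left,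
    ENNReal.ofReal_le_ofReal_iff zero_le_one] at hvol
  rw [← Finset.sum_congr rfl (fun k _ => hlen k)]
  exact hvol

/-- An arc of rotation length at most `r` times that of `e` is covered by `r` consecutive translates
by `e`, each with total length at most one. -/
theorem sum_le {N : ℕ} {p p' e : Pos} {δ : ℝ} (hδ : δ ≤ 1) (he0 : 0 ≤ L.v e) (he : L.v e ≤ δ)
    (h : ∀ j : ℕ, 0 < j → j < N → ∀ m : ℤ, δ ≤ |j * L.τ + m|) (r : ℕ)
    (hr : L.v p' ≤ L.v p + r * L.v e) :
    ∑ k ∈ Finset.range N, (L.A (p' + ((k : ℤ), 0)) - L.A (p + ((k : ℤ), 0))) ≤ r := by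
  have h1 : ∀ r : ℕ, ∑ k ∈ Finset.range N,
      (L.A (p + r • e + ((k : ℤ), 0)) - L.A (p + ((k : ℤ), 0))) ≤ r := by
    intro r
    induction r with
    | zero => simp
    | succ r ih =>
      have := L.sum_le_one (p := p + r • e) hδ he0 he h
      have h2 := add_le_add this ih
      rw [← Finset.sum_add_distrib] at h2
      push_cast
      rw [add_comm (r : ℝ) 1]
      refine le_trans (le_of_eq (Finset.sum_congr rfl fun k _ => ?_)) h2
      rw [succ_nsmul, ← add_assoc]; ring
  refine le_trans (Finset.sum_le_sum fun k _ => ?_) (h1 r)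
  have hve : ∀ r : ℕ, L.v (r • e) = r * L.v e := by
    intro r
    induction r with
    | zero => simp [v_zero]
    | succ r ih => rw [succ_nsmul, v_add, ih]; push_cast; ring
  have := L.A_mono (p := p' + ((k : ℤ), 0)) (p' := p + r • e + ((k : ℤ), 0)) (by
    rw [v_add, v_add, v_add, hve]; linarith)
  linarith

theorem F_lt {m : ℤ} {x y : ℝ} (h0 : L.b + m ≤ x) (h : x < y) (h1 : y ≤ L.a + 1 + m) :
    L.F x < L.F y := by
  have := L.strict (a := x - m) (b := y - m) ⟨by linarith, by linarith⟩ ⟨by linarith, by linarith⟩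
    (by linarith)
  have e : ∀ x : ℝ, L.F (x - m) = L.F x - m := by
    intro x
    have := L.add_int m (x - m)
    rw [sub_add_cancel] at this; linarith
  rw [e, e] at this
  linarith

theorem cri_int {m : ℤ} {y₀ y₁ y₂ y₃ : ℝ} (h0 : L.b + m ≤ y₀) (h1 : y₀ < y₁) (h2 : y₁ ≤ y₂)
    (h3 : y₂ < y₃) (h4 : y₃ ≤ L.a + 1 + m) : crossRatio (L.F y₀) (L.F y₁) (L.F y₂) (L.F y₃) ≤
      Real.exp (L.Λ * (y₃ - y₀)) * crossRatio y₀ y₁ y₂ y₃ := by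
  have := L.cri (y₀ + (-m : ℤ)) (y₁ + (-m : ℤ)) (y₂ + (-m : ℤ)) (y₃ + (-m : ℤ))
    (by push_cast; linarith) (by linarith) (by linarith) (by linarith) (by push_cast; linarith)
  rw [L.add_int, L.add_int, L.add_int, L.add_int, crossRatio_add, crossRatio_add] at this
  convert this using 4; ring

theorem exists_dom {y₀ y₃ : ℝ} (h : ∀ m : ℤ, L.b + m ≤ y₀ ∨ y₃ ≤ L.a + m) :
    ∃ m : ℤ, L.b + m ≤ y₀ ∧ y₃ ≤ L.a + 1 + m := by
  refine ⟨⌊y₀ - L.b⌋, by linarith [Int.floor_le (y₀ - L.b)], ?_⟩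
  have h1 := Int.lt_floor_add_one (y₀ - L.b)
  rcases h (⌊y₀ - L.b⌋ + 1) with h2 | h2 <;> push_cast at h2 <;> linarith

/-- The distortion factors multiply, so their exponents add up to `Λ` times the total length of the
images of `[y₀, y₃]`. The side condition keeps each image inside one branch on which `F` is strictly
increasing. -/
theorem cri_iter (N : ℕ) {y₀ y₁ y₂ y₃ : ℝ} (h1 : y₀ < y₁) (h2 : y₁ ≤ y₂) (h3 : y₂ < y₃)
    (hk : ∀ k < N, ∀ m : ℤ, L.b + m ≤ L.F^[k] y₀ ∨ L.F^[k] y₃ ≤ L.a + m) :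
    L.F^[N] y₀ < L.F^[N] y₁ ∧ L.F^[N] y₂ < L.F^[N] y₃ ∧
    crossRatio (L.F^[N] y₀) (L.F^[N] y₁) (L.F^[N] y₂) (L.F^[N] y₃) ≤
      Real.exp (L.Λ * ∑ k ∈ Finset.range N, (L.F^[k] y₃ - L.F^[k] y₀)) *
        crossRatio y₀ y₁ y₂ y₃ := by
  induction N with
  | zero => simp [h1, h3]
  | succ N ih =>
    obtain ⟨i1, i2, i3⟩ := ih fun k hk' => hk k (by omega)
    obtain ⟨m, d1, d2⟩ := L.exists_dom (hk N (by omega))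
    have h2' := L.iter_mono N h2
    simp only [Function.iterate_succ_apply']
    refine ⟨L.F_lt d1 i1 (by linarith), L.F_lt (by linarith) i2 d2, ?_⟩
    refine (L.cri_int d1 i1 h2' i2 d2).trans ?_
    rw [Finset.sum_range_succ, mul_add, add_comm (L.Λ * _), Real.exp_add, mul_assoc]
    exact mul_le_mul_of_nonneg_left i3 (Real.exp_pos _).le

/-- The constant in the macroscopic Koebe principle. -/
def koebe (S η : ℝ) : ℝ := (η / (1 + η)) ^ 2 * Real.exp (-(L.Λ * S))

theorem koebe_pos (S : ℝ) {η : ℝ} (hη : 0 < η) : 0 < L.koebe S η := by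
  unfold koebe; positivity

/-- Space around the last image bounds its cross-ratio below. Iteration has increased the
cross-ratio at most by `exp (Λ * S)`, so the initial one is bounded below too, and that gives space
on either side. -/
theorem pull {N : ℕ} {y₀ y₁ y₂ y₃ S η : ℝ} (hη : 0 < η) (h1 : y₀ < y₁) (h2 : y₁ ≤ y₂)
    (h3 : y₂ < y₃) (hk : ∀ k < N, ∀ m : ℤ, L.b + m ≤ L.F^[k] y₀ ∨ L.F^[k] y₃ ≤ L.a + m)
    (hS : ∑ k ∈ Finset.range N, (L.F^[k] y₃ - L.F^[k] y₀) ≤ S)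
    (hl : η * (L.F^[N] y₂ - L.F^[N] y₁) ≤ L.F^[N] y₁ - L.F^[N] y₀)
    (hr : η * (L.F^[N] y₂ - L.F^[N] y₁) ≤ L.F^[N] y₃ - L.F^[N] y₂) :
    L.koebe S η * (y₂ - y₀) ≤ y₁ - y₀ ∧ L.koebe S η * (y₃ - y₁) ≤ y₃ - y₂ := by
  obtain ⟨i1, i2, i3⟩ := L.cri_iter N h1 h2 h3 hk
  have h4 := le_crossRatio hη i1 (L.iter_mono N h2) i2 hl hr
  have h5 : L.koebe S η ≤ crossRatio y₀ y₁ y₂ y₃ := by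
    unfold koebe
    rw [Real.exp_neg, ← div_eq_mul_inv, div_le_iff₀ (Real.exp_pos _), mul_comm]
    refine h4.trans (i3.trans ?_)
    apply mul_le_mul_of_nonneg_right _ (crossRatio_nonneg h1 h2 h3)
    exact Real.exp_le_exp.2 (mul_le_mul_of_nonneg_left hS L.Λ_nonneg)
  exact ⟨(mul_le_mul_of_nonneg_right h5 (by linarith)).trans (crossRatio_le_left h1 h2 h3),
    (mul_le_mul_of_nonneg_right h5 (by linarith)).trans (crossRatio_le_right h1 h2 h3)⟩

/-- The power law read backwards: a piece whose image fills a proportion `κ` of the image of `[b,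
y]` fills at least the proportion `κ / P` of `[b, y]`. -/
theorem powR_div {u v y κ : ℝ} (h0 : L.b ≤ u) (h1 : u ≤ v) (h2 : v ≤ y) (h3 : y ≤ L.a + 1)
    (hy : L.b < y) (hκ : κ * (L.F y - L.F L.b) ≤ L.F v - L.F u) :
    κ / L.P * (y - L.b) ≤ v - u := by
  have hF : 0 < L.F y - L.F L.b := by
    have := L.strict (a := L.b) (b := y) ⟨le_rfl, by linarith⟩ ⟨hy.le, h3⟩ hy
    linarith
  have hp := L.powR u v y h0 h1 h2 h3
  have hP := L.P_pos
  have : κ * (L.F y - L.F L.b) * (y - L.b) ≤ L.P * (L.F y - L.F L.b) * (v - u) :=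
    (mul_le_mul_of_nonneg_right hκ (by linarith)).trans hp
  rw [div_mul_eq_mul_div, div_le_iff₀ hP]
  have h6 : (L.F y - L.F L.b) * (κ * (y - L.b)) ≤ (L.F y - L.F L.b) * ((v - u) * L.P) := by
    linarith
  exact le_of_mul_le_mul_left h6 hF

theorem powL_div {u v y κ : ℝ} (h0 : L.b - 1 ≤ y) (h1 : y ≤ u) (h2 : u ≤ v) (h3 : v ≤ L.a)
    (hy : y < L.a) (hκ : κ * (L.F L.a - L.F y) ≤ L.F v - L.F u) :
    κ / L.P * (L.a - y) ≤ v - u := by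
  have := L.reflect.powR_div (u := -v) (v := -u) (y := -y) (κ := κ)
    (by simp only [reflect]; linarith) (by linarith) (by linarith)
    (by simp only [reflect]; linarith) (by simp only [reflect]; linarith)
    (by simp only [reflect, neg_neg]; linarith)
  simp only [reflect] at this
  linarith

end FlatLift

/-! ### Closest returns of the rotation -/

theorem FlatLift.v_zsmul (L : FlatLift) (α : ℤ) (p : Pos) : L.v (α • p) = α * L.v p := by
  simp [FlatLift.v]; ring

/-- The closest returns of the rotation: `E n` is the position of the return with time
`Q n = (E n).1` at distance `Δ n`, on alternating sides. The sequence starts with the full turn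
`E 0 = (0, ±1)` and with `E 1 = (1, 0)`. -/
structure CF (L : FlatLift) where
  a : ℕ → ℕ
  a_pos : ∀ n, 1 ≤ a n
  E : ℕ → Pos
  Δ : ℕ → ℝ
  ε : ℝ
  ε_eq : ε = 1 ∨ ε = -1
  E_zero_fst : (E 0).1 = 0
  E_zero_snd : (E 0).2 = 1 ∨ (E 0).2 = -1
  E_one : E 1 = (1, 0)
  E_succ : ∀ n, E (n + 2) = (a n : ℤ) • E (n + 1) + E n
  v_E : ∀ n, L.v (E n) = ε * (-1) ^ n * Δ n
  Δ_pos : ∀ n, 0 < Δ n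
  Δ_lt : ∀ n, Δ (n + 1) < Δ n
  Δ_zero : Δ 0 = 1

namespace CF

variable {L : FlatLift} (C : CF L)

/-- The side of the `n`-th return. -/
def s (n : ℕ) : ℝ := C.ε * (-1) ^ n

theorem s_succ (n : ℕ) : C.s (n + 1) = -C.s n := by
  unfold s; rw [pow_succ]; ring

theorem s_eq (n : ℕ) : C.s n = 1 ∨ C.s n = -1 := by
  induction n with
  | zero => simpa [s] using C.ε_eq
  | succ n ih => rw [s_succ]; rcases ih with h | h <;> simp [h]

theorem v_E' (n : ℕ) : L.v (C.E n) = C.s n * C.Δ n := C.v_E n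

/-- The return times. -/
def Q (n : ℕ) : ℤ := (C.E n).1

theorem Q_zero : C.Q 0 = 0 := C.E_zero_fst

theorem Q_one : C.Q 1 = 1 := by rw [Q, C.E_one]

theorem Q_succ (n : ℕ) : C.Q (n + 2) = C.a n * C.Q (n + 1) + C.Q n := by
  simp [Q, C.E_succ]

theorem Q_pos (n : ℕ) : 1 ≤ C.Q (n + 1) ∧ 0 ≤ C.Q n := by
  induction n with
  | zero => rw [Q_one, Q_zero]; simp
  | succ n ih =>
    have h1 := C.Q_succ n
    have h2 : (1 : ℤ) ≤ C.a n := by exact_mod_cast C.a_pos n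
    refine ⟨?_, by omega⟩
    nlinarith

theorem Q_add_le (n : ℕ) : C.Q (n + 1) + C.Q n ≤ C.Q (n + 2) := by
  have h2 : (1 : ℤ) ≤ C.a n := by exact_mod_cast C.a_pos n
  rw [C.Q_succ n]
  nlinarith [C.Q_pos n]

theorem Q_le_succ (n : ℕ) : C.Q n ≤ C.Q (n + 1) := by
  rcases n with _ | n
  · rw [Q_zero, Q_one]; simp
  · linarith [C.Q_add_le n, (C.Q_pos n).2]

theorem Δ_anti : Antitone C.Δ := antitone_nat_of_succ_le fun n => (C.Δ_lt n).le

theorem Δ_le_one (n : ℕ) : C.Δ n ≤ 1 := by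
  rw [← C.Δ_zero]; exact C.Δ_anti (Nat.zero_le n)

theorem Δ_succ (n : ℕ) : C.Δ n = C.a n * C.Δ (n + 1) + C.Δ (n + 2) := by
  have h := congrArg L.v (C.E_succ n)
  rw [L.v_add, L.v_zsmul, v_E', v_E', v_E', s_succ, s_succ] at h
  push_cast at h
  rcases C.s_eq n with hs | hs <;> rw [hs] at h <;> linarith

theorem Δ_add_le (n : ℕ) : C.Δ (n + 1) + C.Δ (n + 2) ≤ C.Δ n := by
  have h2 : (1 : ℝ) ≤ C.a n := by exact_mod_cast C.a_pos n
  rw [C.Δ_succ n]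
  nlinarith [C.Δ_pos (n + 1)]

/-- The recursion is unimodular, so two consecutive returns always generate the lattice of
positions. -/
theorem basis (n : ℕ) (p : Pos) : ∃ α β : ℤ, p = α • C.E n + β • C.E (n + 1) := by
  induction n with
  | zero =>
    refine ⟨p.2 * (C.E 0).2, p.1, ?_⟩
    rw [zero_add, C.E_one]
    ext
    · simp [C.E_zero_fst]
    · rcases C.E_zero_snd with h | h <;> simp [h]
  | succ n ih =>
    obtain ⟨α, β, h⟩ := ih
    refine ⟨β - C.a n * α, α, ?_⟩
    rw [C.E_succ, h]
    module

/-- The reflected closest returns. -/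
def reflect : CF L.reflect where
  a := C.a
  a_pos := C.a_pos
  E n := (C.E n).refl
  Δ := C.Δ
  ε := -C.ε
  ε_eq := by rcases C.ε_eq with h | h <;> simp [h]
  E_zero_fst := C.E_zero_fst
  E_zero_snd := by rcases C.E_zero_snd with h | h <;> simp [h, Pos.refl]
  E_one := by simp [C.E_one, Pos.refl]
  E_succ n := by
    rw [C.E_succ]; ext <;> simp [Pos.refl]; ring
  v_E n := by rw [L.reflect_v, C.v_E]; ring
  Δ_pos := C.Δ_pos
  Δ_lt := C.Δ_lt
  Δ_zero := C.Δ_zero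

theorem reflect_s (n : ℕ) : C.reflect.s n = -C.s n := by
  simp [s, reflect]

theorem v_comb (n : ℕ) (α β : ℤ) :
    L.v (α • C.E n + β • C.E (n + 1)) = C.s n * (α * C.Δ n - β * C.Δ (n + 1)) := by
  rw [L.v_add, L.v_zsmul, L.v_zsmul, v_E', v_E', s_succ]; ring

theorem fst_comb (n : ℕ) (α β : ℤ) :
    (α • C.E n + β • C.E (n + 1)).1 = α * C.Q n + β * C.Q (n + 1) := by
  simp [Q]

/-- Best approximation. In the basis of two consecutive returns the bound on the time makes the
first coefficient non-zero and excludes equal signs. As these returns lie on opposite sides, the two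
contributions to the distance add up. -/
theorem le_abs_v {n : ℕ} {p : Pos} (hp : p ≠ 0) (h : |p.1| < C.Q (n + 1)) :
    C.Δ n ≤ |L.v p| := by
  obtain ⟨α, β, rfl⟩ := C.basis n p
  rw [C.fst_comb] at h
  have hQ := C.Q_pos n
  have hs : |L.v (α • C.E n + β • C.E (n + 1))| = |α * C.Δ n - β * C.Δ (n + 1)| := by
    rw [C.v_comb, abs_mul]
    rcases C.s_eq n with h | h <;> simp [h]
  rw [hs]
  rw [abs_lt] at h
  have d1 := C.Δ_pos n
  have d2 := C.Δ_pos (n + 1)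
  rcases lt_trichotomy α 0 with hα | hα | hα
  · have hβ : 0 ≤ β := by
      by_contra hc
      have : β ≤ -1 := by omega
      nlinarith
    have hα' : (α : ℝ) ≤ -1 := by exact_mod_cast (show α ≤ -1 by omega)
    have hβ' : (0 : ℝ) ≤ β := by exact_mod_cast hβ
    rw [le_abs]; right; nlinarith
  · exfalso
    subst hα
    have hβ : β = 0 := by
      by_contra hc
      rcases lt_or_gt_of_ne hc with h1 | h1 <;> nlinarith
    subst hβ
    simp at hp
  · have hβ : β ≤ 0 := by
      by_contra hc
      have : 1 ≤ β := by omega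
      nlinarith
    have hα' : (1 : ℝ) ≤ α := by exact_mod_cast (show 1 ≤ α by omega)
    have hβ' : (β : ℝ) ≤ 0 := by exact_mod_cast hβ
    rw [le_abs]; left; nlinarith

theorem le_abs_nat {n : ℕ} {j : ℕ} (h0 : 0 < j) (h : (j : ℤ) < C.Q (n + 1)) (m : ℤ) :
    C.Δ n ≤ |j * L.τ + m| := by
  have := C.le_abs_v (n := n) (p := ((j : ℤ), m)) (by
    intro h; have := congrArg Prod.fst h; simp at this; omega) (by
    rw [abs_of_nonneg (by positivity)]; exact h)
  simpa [FlatLift.v] using this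

end CF

/-! ### Closest returns from the continued fraction -/

/-- The orbit of `ρ` under the Gauss map. -/
def gauss (ρ : ℝ) : ℕ → ℝ
  | 0 => ρ
  | n + 1 => Int.fract (gauss ρ n)⁻¹

/-- The partial quotients. -/
def quot (ρ : ℝ) (n : ℕ) : ℕ := ⌊(gauss ρ n)⁻¹⌋₊

/-- The positions of the closest returns. -/
def returns (ρ : ℝ) : ℕ → Pos
  | 0 => (0, -1)
  | 1 => (1, 0)
  | n + 2 => (quot ρ n : ℤ) • returns ρ (n + 1) + returns ρ n

/-- The distances of the closest returns. -/
def returnDist (ρ : ℝ) : ℕ → ℝ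
  | 0 => 1
  | n + 1 => gauss ρ n * returnDist ρ n

theorem gauss_mem {ρ : ℝ} (hirr : Irrational ρ) (h0 : 0 < ρ) (h1 : ρ < 1)
    (n : ℕ) : Irrational (gauss ρ n) ∧ 0 < gauss ρ n ∧ gauss ρ n < 1 := by
  induction n with
  | zero => exact ⟨hirr, h0, h1⟩
  | succ n ih =>
    have h2 : Irrational (gauss ρ (n + 1)) := by
      have : Irrational ((gauss ρ n)⁻¹ - (⌊(gauss ρ n)⁻¹⌋ : ℤ)) := (ih.1.inv).sub_intCast _
      exact this
    refine ⟨h2, lt_of_le_of_ne (Int.fract_nonneg _) ?_, Int.fract_lt_one _⟩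
    exact fun h => h2.ne_zero h.symm

theorem stream_eq {ρ : ℝ} (hirr : Irrational ρ) (h0 : 0 < ρ) (h1 : ρ < 1)
    (n : ℕ) : ∃ k, GenContFract.IntFractPair.stream ρ n = some ⟨k, gauss ρ n⟩ := by
  induction n with
  | zero =>
    refine ⟨⌊ρ⌋, ?_⟩
    rw [GenContFract.IntFractPair.stream_zero]
    simp only [GenContFract.IntFractPair.of, gauss]
    rw [Int.fract_eq_self.2 ⟨h0.le, h1⟩]
  | succ n ih =>
    obtain ⟨k, hk⟩ := ih
    refine ⟨⌊(gauss ρ n)⁻¹⌋, ?_⟩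
    rw [GenContFract.IntFractPair.stream_succ_of_some hk (gauss_mem hirr h0 h1 n).2.1.ne']
    rfl

theorem quot_cast {ρ : ℝ} (hirr : Irrational ρ) (h0 : 0 < ρ) (h1 : ρ < 1)
    (n : ℕ) : (quot ρ n : ℝ) = (⌊(gauss ρ n)⁻¹⌋ : ℤ) := by
  have h := (gauss_mem hirr h0 h1 n).2.1
  have : (0 : ℤ) ≤ ⌊(gauss ρ n)⁻¹⌋ := Int.floor_nonneg.2 (by positivity)
  have h2 := Int.natCast_floor_eq_floor (a := (gauss ρ n)⁻¹) (by positivity)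
  rw [← h2]; rfl

theorem s_get {ρ : ℝ} (hirr : Irrational ρ) (h0 : 0 < ρ) (h1 : ρ < 1)
    (n : ℕ) : (GenContFract.of ρ).s.get? n = some ⟨1, (quot ρ n : ℝ)⟩ := by
  obtain ⟨k, hk⟩ := stream_eq hirr h0 h1 n
  rw [GenContFract.get?_of_eq_some_of_get?_intFractPair_stream_fr_ne_zero hk
    (gauss_mem hirr h0 h1 n).2.1.ne', quot_cast hirr h0 h1]
  rfl

/-- The sequence of returns begins one step earlier than the denominators, with the full turn; hence
`qₙ` is the time of return `n + 1`, a shift that persists throughout. -/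
theorem dens_eq {ρ : ℝ} (hirr : Irrational ρ) (h0 : 0 < ρ) (h1 : ρ < 1)
    (n : ℕ) : (GenContFract.of ρ).dens n = ((returns ρ (n + 1)).1 : ℝ) := by
  induction n using Nat.twoStepInduction with
  | zero => simp [returns]
  | one =>
    rw [GenContFract.first_den_eq (s_get hirr h0 h1 0)]
    simp [returns]
  | more n ih1 ih2 =>
    rw [GenContFract.dens_recurrence (s_get hirr h0 h1 (n + 1)) ih1 ih2]
    simp [returns]
    ring

theorem one_le_quot {ρ : ℝ} (hirr : Irrational ρ) (h0 : 0 < ρ) (h1 : ρ < 1)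
    (n : ℕ) : 1 ≤ quot ρ n := by
  have h := (gauss_mem hirr h0 h1 n).2
  exact Nat.le_floor (by push_cast; exact (one_le_inv₀ h.1).2 h.2.le)

theorem quot_lt_of_isBoundedType {ρ : ℝ} (hirr : Irrational ρ) (h0 : 0 < ρ) (h1 : ρ < 1)
    (hb : IsBoundedType ρ) : ∃ M : ℕ, ∀ n, quot ρ n ≤ M := by
  obtain ⟨M, hM, h⟩ := hb
  refine ⟨⌈M⌉₊, fun n => ?_⟩
  have := h n (quot ρ n) (by
    rw [GenContFract.partDens, Stream'.Seq.map_get?, s_get hirr h0 h1 n]; rfl)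
  exact_mod_cast this.le.trans (Nat.le_ceil M)

theorem returnDist_pos {ρ : ℝ} (hirr : Irrational ρ) (h0 : 0 < ρ) (h1 : ρ < 1)
    (n : ℕ) : 0 < returnDist ρ n := by
  induction n with
  | zero => simp [returnDist]
  | succ n ih => exact mul_pos (gauss_mem hirr h0 h1 n).2.1 ih

theorem returnDist_lt {ρ : ℝ} (hirr : Irrational ρ) (h0 : 0 < ρ) (h1 : ρ < 1)
    (n : ℕ) : returnDist ρ (n + 1) < returnDist ρ n := by
  have := (gauss_mem hirr h0 h1 n).2.2
  have h := returnDist_pos hirr h0 h1 n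
  rw [returnDist]; nlinarith

theorem returnDist_succ {ρ : ℝ} (hirr : Irrational ρ) (h0 : 0 < ρ) (h1 : ρ < 1)
    (n : ℕ) :
    returnDist ρ (n + 2) = returnDist ρ n - quot ρ n * returnDist ρ (n + 1) := by
  have h := (gauss_mem hirr h0 h1 n).2.1
  have e : gauss ρ (n + 1) = (gauss ρ n)⁻¹ - (quot ρ n : ℝ) := by
    rw [quot_cast hirr h0 h1]; rfl
  rw [returnDist, returnDist, e]
  field_simp

theorem v_returns {ρ : ℝ} (hirr : Irrational ρ) (h0 : 0 < ρ) (h1 : ρ < 1)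
    (n : ℕ) :
    ((returns ρ n).1 : ℝ) * ρ + (returns ρ n).2 = -1 * (-1) ^ n * returnDist ρ n := by
  induction n using Nat.twoStepInduction with
  | zero => simp [returns, returnDist]
  | one => simp [returns, returnDist, gauss]
  | more n ih1 ih2 =>
    rw [returnDist_succ hirr h0 h1, returns]
    simp only [Prod.fst_add, Prod.snd_add, Prod.smul_fst, Prod.smul_snd, smul_eq_mul]
    push_cast
    rw [pow_succ] at *
    rw [pow_succ]
    linear_combination (quot ρ n : ℝ) * ih2 + ih1

/-- The closest returns given by the continued fraction expansion. -/
def FlatLift.cf (L : FlatLift) (h0 : 0 < L.τ) (h1 : L.τ < 1) : CF L where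
  a := quot L.τ
  a_pos := one_le_quot L.irr h0 h1
  E := returns L.τ
  Δ := returnDist L.τ
  ε := -1
  ε_eq := Or.inr rfl
  E_zero_fst := rfl
  E_zero_snd := Or.inr rfl
  E_one := rfl
  E_succ _ := rfl
  v_E := v_returns L.irr h0 h1
  Δ_pos := returnDist_pos L.irr h0 h1
  Δ_lt := returnDist_lt L.irr h0 h1
  Δ_zero := rfl

/-! ### A priori bounds: space around closest returns -/

namespace FlatLift

variable (L : FlatLift)

/-- The Koebe principle handles the `N` iterates after the first one. It yields a proportion inside
`[F y₀, F a]`, which the power law at `a` turns into a proportion inside `[y₀, a]`. -/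
theorem pull_crit {N : ℕ} {y₀ y₁ z S η : ℝ} (hη : 0 < η) (h0 : L.b - 1 ≤ y₀) (h01 : y₀ < y₁)
    (h1a : y₁ ≤ L.a) (hz : L.F L.a < z)
    (hk : ∀ k < N, ∀ m : ℤ, L.b + m ≤ L.F^[k] (L.F y₀) ∨ L.F^[k] z ≤ L.a + m)
    (hS : ∑ k ∈ Finset.range N, (L.F^[k] z - L.F^[k] (L.F y₀)) ≤ S)
    (hl : η * (L.F^[N] (L.F L.a) - L.F^[N] (L.F y₁)) ≤ L.F^[N] (L.F y₁) - L.F^[N] (L.F y₀))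
    (hr : η * (L.F^[N] (L.F L.a) - L.F^[N] (L.F y₁)) ≤ L.F^[N] z - L.F^[N] (L.F L.a)) :
    L.koebe S η / L.P * (L.a - y₀) ≤ y₁ - y₀ := by
  have hF : L.F y₀ < L.F y₁ :=
    L.F_lt (m := -1) (by push_cast; linarith) h01 (by push_cast; linarith)
  have h := (L.pull hη hF (L.mono h1a) hz hk hS hl hr).1
  exact L.powL_div h0 le_rfl h01.le h1a (by linarith) h

theorem sum_iter_le {N : ℕ} {p p' e : Pos} {y z δ : ℝ} (hy : L.A p ≤ y) (hz : z ≤ L.A p')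
    (hδ : δ ≤ 1) (he0 : 0 ≤ L.v e) (he : L.v e ≤ δ)
    (h : ∀ j : ℕ, 0 < j → j < N → ∀ m : ℤ, δ ≤ |j * L.τ + m|) (r : ℕ)
    (hr : L.v p' ≤ L.v p + r * L.v e) :
    ∑ k ∈ Finset.range N, (L.F^[k] z - L.F^[k] y) ≤ r := by
  refine le_trans (Finset.sum_le_sum fun k _ => ?_) (L.sum_le hδ he0 he h r hr)
  rw [A_add_nat, A_add_nat]
  linarith [L.iter_mono k hy, L.iter_mono k hz]

theorem A_one : L.A (1, 0) = L.F L.a := by simpa using L.A_nat 1 0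

end FlatLift

namespace CF

variable {L : FlatLift} (C : CF L)

theorem iter_F_A {n N : ℕ} (hN : (N : ℤ) + 1 = C.Q n) (p : Pos) :
    L.F^[N] (L.F (L.A p)) = L.A (p + C.E n) - (C.E n).2 := by
  rw [← Function.iterate_succ_apply, ← L.A_add_nat, eq_sub_iff_add_eq, ← L.A_add_int]
  congr 1
  push_cast
  rw [hN]
  ext <;> simp [Q, add_assoc]

theorem iter_F_B {n N : ℕ} (hN : (N : ℤ) + 1 = C.Q n) (p : Pos) :
    L.F^[N] (L.F (L.B p)) = L.B (p + C.E n) - (C.E n).2 := by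
  rw [← Function.iterate_succ_apply, ← L.B_add_nat, eq_sub_iff_add_eq, ← L.B_add_int]
  congr 1
  push_cast
  rw [hN]
  ext <;> simp [Q, add_assoc]

theorem A_E {n : ℕ} : L.A (C.E (n + 1)) = L.B (C.E (n + 1)) :=
  L.A_eq_B (C.Q_pos n).1

theorem exists_nat_Q (n : ℕ) : ∃ N : ℕ, (N : ℤ) + 1 = C.Q (n + 1) :=
  ⟨(C.Q (n + 1) - 1).toNat, by have := C.Q_pos n; omega⟩

theorem v_E_of_s {n : ℕ} (h : C.s n = 1) : L.v (C.E n) = C.Δ n := by rw [C.v_E', h, one_mul]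

theorem v_E_of_s' {n : ℕ} (h : C.s n = -1) : L.v (C.E n) = -C.Δ n := by
  rw [C.v_E', h, neg_one_mul]

/-- The space beyond the `n + 1`-st return is comparable to its distance. -/
def Good (c : ℝ) (n : ℕ) : Prop :=
  c * L.gl 0 (C.E (n + 1)) ≤ L.gl (C.E (n + 1)) (C.E (n + 1) - C.E n)

theorem refl_sub (p q : Pos) : Pos.refl (p - q) = p.refl - q.refl := by
  ext <;> simp [Pos.refl]; ring

theorem refl_add (p q : Pos) : Pos.refl (p + q) = p.refl + q.refl := by
  ext <;> simp [Pos.refl]; ring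

theorem refl_neg (p : Pos) : Pos.refl (-p) = -p.refl := by
  ext <;> simp [Pos.refl]

theorem refl_zero : Pos.refl 0 = 0 := by
  ext <;> simp [Pos.refl]

theorem refl_zsmul (k : ℤ) (p : Pos) : Pos.refl (k • p) = k • p.refl := by
  ext <;> simp [Pos.refl]

theorem reflect_E (n : ℕ) : C.reflect.E n = (C.E n).refl := rfl

theorem reflect_good (c : ℝ) (n : ℕ) : C.reflect.Good c n ↔ C.Good c n := by
  unfold Good
  rw [reflect_E, reflect_E, ← refl_sub, L.reflect_gl, ← L.reflect_gl 0, refl_zero]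

/-- Pulling back intervals next to the critical point by a closest return: the space on the far
side comes from the earlier returns. -/
theorem pull_return {n : ℕ} (hs : C.s (n + 1) = 1) {y₀ y₁ η : ℝ} (hη : 0 < η)
    (h0 : L.A (-C.E (n + 1)) ≤ y₀) (h01 : y₀ < y₁) (h1a : y₁ ≤ L.a) {N : ℕ}
    (hN : (N : ℤ) + 1 = C.Q (n + 1))
    (hl : η * (L.A (C.E (n + 1)) - (C.E (n + 1)).2 - L.F^[N] (L.F y₁)) ≤
      L.F^[N] (L.F y₁) - L.F^[N] (L.F y₀))
    (hr : η * (L.A (C.E (n + 1)) - (C.E (n + 1)).2 - L.F^[N] (L.F y₁)) ≤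
      L.gl (C.E (n + 1)) (C.E (n + 1) - C.E n)) :
    L.koebe 2 η / L.P * (L.a - y₀) ≤ y₁ - y₀ := by
  have hs' : C.s n = -1 := by have := C.s_succ n; linarith
  have v1 := C.v_E_of_s hs
  have v0 := C.v_E_of_s' hs'
  have d0 := C.Δ_pos n
  have d1 := C.Δ_pos (n + 1)
  have d01 := C.Δ_lt n
  have eA : L.F^[N] (L.F L.a) = L.A (C.E (n + 1)) - (C.E (n + 1)).2 := by
    have := C.iter_F_A hN 0
    rwa [L.A_zero, zero_add] at this
  have ez : L.F^[N] (L.A (-C.E n + (1, 0))) = L.A (C.E (n + 1) - C.E n) - (C.E (n + 1)).2 := by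
    have := C.iter_F_A hN (-C.E n)
    rw [L.A_succ, this]; congr 2; abel
  have hgl : L.gl (C.E (n + 1)) (C.E (n + 1) - C.E n) =
      L.A (C.E (n + 1) - C.E n) - L.A (C.E (n + 1)) := by
    rw [L.gl_eq (by rw [L.v_sub]; linarith), C.A_E]
  -- The far end `z` is chosen so that after the remaining `N` steps it reaches the translate `E (n
  -- + 1) - E n`, the end of the space beyond the return.
  refine L.pull_crit (N := N) (z := L.A (-C.E n + (1, 0))) hη ?_ h01 h1a ?_ ?_ ?_ ?_ ?_
  · refine le_trans ?_ h0
    have : L.v (0, -1) < L.v (-C.E (n + 1)) := by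
      rw [L.v_neg, v1, L.v_int]; push_cast; linarith [C.Δ_le_one n]
    have := L.B_lt_A this
    rw [L.B_int] at this; push_cast at this; linarith
  · rw [← L.A_one]
    apply L.A_lt_A
    rw [L.v_add, L.v_neg]; linarith
  · intro k hk m
    by_contra hc
    push Not at hc
    obtain ⟨c1, c2⟩ := hc
    rw [← L.A_add_nat, ← L.A_int] at c2
    have c1' : L.F^[k] (L.F (L.A (-C.E (n + 1)))) < L.B (0, m) := by
      rw [L.B_int]
      exact lt_of_le_of_lt (L.iter_mono k (L.mono h0)) c1
    rw [← L.A_succ, ← L.A_add_nat] at c1'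
    have b1 : L.v (-C.E (n + 1) + (1, 0) + ((k : ℤ), 0)) ≤ L.v (0, m) := by
      by_contra hcc
      exact absurd (L.B_lt_A (not_le.1 hcc)) (not_lt.2 c1'.le)
    have b2 : L.v (0, m) < L.v (-C.E n + (1, 0) + ((k : ℤ), 0)) := by
      by_contra hcc
      exact absurd (L.A_mono (not_lt.1 hcc)) (not_le.2 c2)
    -- A flat translate met on the way would be a return of time below `Q (n + 1)` with signed
    -- distance above `-Δ n` and at most `Δ (n + 1)`, against best approximation.
    have hx := C.le_abs_v (n := n) (p := ((k : ℤ) + 1, -m)) (by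
      intro h; have := congrArg Prod.fst h; simp at this; omega) (by
      rw [abs_of_nonneg (by positivity)]; show (k : ℤ) + 1 < _; omega)
    have hv : L.v ((k : ℤ) + 1, -m) = L.v (1, 0) + L.v ((k : ℤ), 0) - L.v (0, m) := by
      simp [FlatLift.v]; ring
    rw [L.v_add, L.v_add, L.v_neg] at b1 b2
    rcases le_abs.1 hx with h | h <;> linarith
  -- The rotation length is `Δ n + Δ (n + 1)`, less than two arcs of length `Δ n`; hence the total
  -- `2`.
  · refine L.sum_iter_le (p := -C.E (n + 1) + (1, 0)) (p' := -C.E n + (1, 0)) (e := -C.E n)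
      (δ := C.Δ n) ?_ le_rfl (C.Δ_le_one n) ?_ ?_ ?_ 2 ?_
    · rw [L.A_succ]; exact L.mono h0
    · rw [L.v_neg]; linarith
    · rw [L.v_neg]; linarith
    · intro j hj hj' m
      exact C.le_abs_nat hj (by omega) m
    · rw [L.v_add, L.v_add, L.v_neg, L.v_neg]; push_cast; linarith
  · rw [eA]; exact hl
  · rw [eA, ez]; rw [hgl] at hr; linarith

/-- The return carries the preimage `-E (n + 1)` onto a translate of the flat interval, whose length
`b - a` is fixed. This is the space on one side; `Good` is the space on the other. -/
theorem w_ge_of_good_aux {c : ℝ} (hc : 0 < c) : ∃ c' > 0, ∀ n, C.s (n + 1) = 1 → C.Good c n →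
    c' * L.gl (-C.E (n + 1)) 0 ≤ L.w (-C.E (n + 1)) := by
  have hab : 0 < L.b - L.a := by linarith [L.a_lt_b]
  set η := min c (L.b - L.a)
  have hη : 0 < η := lt_min hc hab
  refine ⟨L.koebe 2 η / L.P, div_pos (L.koebe_pos 2 hη) L.P_pos, fun n hs hg => ?_⟩
  obtain ⟨N, hN⟩ := C.exists_nat_Q n
  have v1 := C.v_E_of_s hs
  have d1 := C.Δ_pos (n + 1)
  have hneg : (-C.E (n + 1)).1 ≤ 0 := by
    have := (C.Q_pos n).1; simp only [Q, Prod.fst_neg] at this ⊢; omega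
  have hlt : L.v (-C.E (n + 1)) < L.v 0 := by rw [L.v_neg, L.v_zero]; linarith
  have eB : L.F^[N] (L.F (L.B (-C.E (n + 1)))) = L.b - (C.E (n + 1)).2 := by
    have := C.iter_F_B hN (-C.E (n + 1))
    rwa [neg_add_cancel, L.B_zero] at this
  have eA : L.F^[N] (L.F (L.A (-C.E (n + 1)))) = L.a - (C.E (n + 1)).2 := by
    have := C.iter_F_A hN (-C.E (n + 1))
    rwa [neg_add_cancel, L.A_zero] at this
  have hD : L.gl 0 (C.E (n + 1)) = L.A (C.E (n + 1)) - L.b := by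
    rw [L.gl_eq (by rw [L.v_zero]; linarith), L.B_zero]
  have hD0 : 0 < L.gl 0 (C.E (n + 1)) := L.gl_pos (by
    intro h; rw [← h, L.v_zero] at v1; linarith)
  have hD1 : L.gl 0 (C.E (n + 1)) ≤ 1 := L.gl_le_one (by
    rw [L.v_zero, v1, sub_zero, abs_of_pos d1]; exact C.Δ_le_one _)
  have hba := L.B_lt_A hlt
  rw [L.A_zero] at hba
  have h := C.pull_return hs hη le_rfl (L.A_lt_B hneg) hba.le hN ?_ ?_
  · rw [L.gl_eq hlt, L.A_zero]
    refine le_trans (mul_le_mul_of_nonneg_left ?_ ?_) h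
    · linarith [L.A_le_B (-C.E (n + 1))]
    · exact (div_pos (L.koebe_pos 2 hη) L.P_pos).le
  · rw [eA, eB]
    have : η ≤ L.b - L.a := min_le_right _ _
    nlinarith
  · rw [eB]
    refine le_trans ?_ hg
    have : η ≤ c := min_le_left _ _
    nlinarith

theorem w_ge_of_good {c : ℝ} (hc : 0 < c) : ∃ c' > 0, ∀ n, C.Good c n →
    c' * L.gl (-C.E (n + 1)) 0 ≤ L.w (-C.E (n + 1)) := by
  obtain ⟨c1, hc1, h1⟩ := C.w_ge_of_good_aux hc
  obtain ⟨c2, hc2, h2⟩ := C.reflect.w_ge_of_good_aux hc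
  refine ⟨min c1 c2, lt_min hc1 hc2, fun n hg => ?_⟩
  have hpos : 0 < L.gl (-C.E (n + 1)) 0 := L.gl_pos (by
    intro h
    have := (C.Q_pos n).1
    have h2 := congrArg Prod.fst h
    simp only [Prod.fst_neg, Prod.fst_zero, Q] at this h2; omega)
  rcases C.s_eq (n + 1) with hs | hs
  · exact (mul_le_mul_of_nonneg_right (min_le_left _ _) hpos.le).trans (h1 n hs hg)
  · have := h2 n (by rw [reflect_s, hs]; norm_num) ((C.reflect_good c n).2 hg)
    rw [reflect_E, ← refl_neg, L.reflect_w, ← refl_zero, L.reflect_gl] at this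
    exact (mul_le_mul_of_nonneg_right (min_le_right _ _) hpos.le).trans this

end CF

namespace FlatLift

variable (L : FlatLift)

theorem exists_next {N : ℤ} (hN : 1 ≤ N) (q : Pos) : ∃ Z : Pos, 1 ≤ Z.1 ∧ Z.1 ≤ N ∧
    L.v q < L.v Z ∧ ∀ q' : Pos, 1 ≤ q'.1 → q'.1 ≤ N → L.v q < L.v q' → L.v Z ≤ L.v q' := by
  set z : ℤ → Pos := fun k => (k, ⌊L.v q - k * L.τ⌋ + 1)
  have hz : ∀ k, L.v (z k) = k * L.τ + ⌊L.v q - k * L.τ⌋ + 1 := by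
    intro k; simp [z, v]; ring
  obtain ⟨k, hk, hmin⟩ := Finset.exists_min_image (Finset.Icc 1 N) (fun k => L.v (z k))
    ⟨1, by simp [hN]⟩
  rw [Finset.mem_Icc] at hk
  refine ⟨z k, hk.1, hk.2, ?_, fun q' h1 h2 h3 => ?_⟩
  · rw [hz]; linarith [Int.lt_floor_add_one (L.v q - k * L.τ)]
  · refine (hmin q'.1 (Finset.mem_Icc.2 ⟨h1, h2⟩)).trans ?_
    rw [hz]
    have : (⌊L.v q - q'.1 * L.τ⌋ : ℤ) < q'.2 := by
      rw [Int.floor_lt]; simp only [v] at h3 ⊢; linarith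
    have : (⌊L.v q - q'.1 * L.τ⌋ : ℝ) + 1 ≤ q'.2 := by exact_mod_cast this
    have e : L.v q' = q'.1 * L.τ + q'.2 := rfl
    linarith

theorem exists_prev {N : ℤ} (hN : 1 ≤ N) (q : Pos) : ∃ Z : Pos, 1 ≤ Z.1 ∧ Z.1 ≤ N ∧
    L.v Z < L.v q ∧ ∀ q' : Pos, 1 ≤ q'.1 → q'.1 ≤ N → L.v q' < L.v q → L.v q' ≤ L.v Z := by
  have hr : ∀ q : Pos, q.refl.refl = q := fun q => by ext <;> simp [Pos.refl]
  obtain ⟨Z, h1, h2, h3, h4⟩ := L.reflect.exists_next hN q.refl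
  refine ⟨Z.refl, h1, h2, ?_, fun q' h5 h6 h7 => ?_⟩
  · have := L.reflect_v Z.refl
    rw [hr] at this; rw [this, L.reflect_v] at h3; linarith
  · have h8 := h4 q'.refl h5 h6 (by rw [L.reflect_v, L.reflect_v]; linarith)
    have := L.reflect_v Z.refl
    rw [hr] at this; rw [this, L.reflect_v] at h8; linarith

end FlatLift

namespace CF

variable {L : FlatLift} (C : CF L)

/-- Among the times up to `Q n + Q (n + 1)` one can move in either direction by adding one of the
two returns or subtracting the other, and one of these moves always stays in range. -/
theorem exists_near (n : ℕ) (t : ℝ) (ht : t = 1 ∨ t = -1) {q : Pos} (h1 : 1 ≤ q.1)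
    (h2 : q.1 ≤ C.Q n + C.Q (n + 1)) : ∃ q' : Pos, 1 ≤ q'.1 ∧ q'.1 ≤ C.Q n + C.Q (n + 1) ∧
      0 < t * (L.v q' - L.v q) ∧ t * (L.v q' - L.v q) ≤ C.Δ n := by
  have hQ := C.Q_pos n
  have d0 := C.Δ_pos n
  have d1 := C.Δ_pos (n + 1)
  have d01 := C.Δ_lt n
  have e0 := C.v_E' n
  have e1 := C.v_E' (n + 1)
  rw [C.s_succ] at e1
  have f0 : (C.E n).1 = C.Q n := rfl
  have f1 : (C.E (n + 1)).1 = C.Q (n + 1) := rfl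
  have hcase : C.s n = t ∨ C.s n = -t := by
    rcases C.s_eq n with h | h <;> rcases ht with h' | h' <;> simp [h, h']
  have htt : t * t = 1 := by rcases ht with h | h <;> simp [h]
  rcases hcase with hs | hs <;> rw [hs] at e0 e1
  · rcases le_or_gt q.1 (C.Q (n + 1)) with hq | hq
    · refine ⟨q + C.E n, by simp [f0]; omega, by simp [f0]; omega, ?_⟩
      have : t * (L.v (q + C.E n) - L.v q) = C.Δ n := by
        rw [L.v_add, e0]; linear_combination C.Δ n * htt
      rw [this]; exact ⟨d0, le_rfl⟩
    · refine ⟨q - C.E (n + 1), by simp [f1]; omega, by simp [f1]; omega, ?_⟩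
      have : t * (L.v (q - C.E (n + 1)) - L.v q) = C.Δ (n + 1) := by
        rw [L.v_sub, e1]; linear_combination C.Δ (n + 1) * htt
      rw [this]; exact ⟨d1, d01.le⟩
  · rcases le_or_gt q.1 (C.Q n) with hq | hq
    · refine ⟨q + C.E (n + 1), by simp [f1]; omega, by simp [f1]; omega, ?_⟩
      have : t * (L.v (q + C.E (n + 1)) - L.v q) = C.Δ (n + 1) := by
        rw [L.v_add, e1]; linear_combination C.Δ (n + 1) * htt
      rw [this]; exact ⟨d1, d01.le⟩
    · refine ⟨q - C.E n, by simp [f0]; omega, by simp [f0]; omega, ?_⟩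
      have : t * (L.v (q - C.E n) - L.v q) = C.Δ n := by
        rw [L.v_sub, e0]; linear_combination C.Δ n * htt
      rw [this]; exact ⟨d0, le_rfl⟩

/-- For such times neighbours can differ only by one of the two closest returns: in their basis all
other coefficients violate the bound on the time or on the distance. -/
theorem eq_E_of_fst_pos {n : ℕ} {e : Pos} (h1 : 0 < e.1) (h2 : e.1 < C.Q n + C.Q (n + 1))
    (hv : |L.v e| ≤ C.Δ n) : e = C.E n ∨ e = C.E (n + 1) := by
  obtain ⟨α, β, rfl⟩ := C.basis n e
  rw [C.fst_comb] at h1 h2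
  have hQ := C.Q_pos n
  have d0 := C.Δ_pos n
  have d1 := C.Δ_pos (n + 1)
  have hs : |L.v (α • C.E n + β • C.E (n + 1))| = |α * C.Δ n - β * C.Δ (n + 1)| := by
    rw [C.v_comb, abs_mul]
    rcases C.s_eq n with h | h <;> simp [h]
  rw [hs, abs_le] at hv
  rcases lt_trichotomy α 0 with hα | rfl | hα
  · exfalso
    have hβ : 1 ≤ β := by by_contra hc; nlinarith
    have hα' : (α : ℝ) ≤ -1 := by exact_mod_cast (show α ≤ -1 by omega)
    have hβ' : (1 : ℝ) ≤ β := by exact_mod_cast hβ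
    nlinarith
  · right
    have hβ : 1 ≤ β := by by_contra hc; nlinarith
    have hβ2 : β = 1 := by
      by_contra hc
      have : 2 ≤ β := by omega
      have h3 := C.Q_le_succ n
      nlinarith
    simp [hβ2]
  · left
    have hβ : β ≤ 0 := by
      by_contra hc
      have : 1 ≤ β := by omega
      nlinarith
    have hα' : (1 : ℝ) ≤ α := by exact_mod_cast hα
    have hβ' : (β : ℝ) ≤ 0 := by exact_mod_cast hβ
    have hβ0 : β = 0 := by
      by_contra hc
      have : (β : ℝ) ≤ -1 := by exact_mod_cast (show β ≤ -1 by omega)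
      nlinarith
    have hα1 : α = 1 := by
      by_contra hc
      have : (2 : ℝ) ≤ α := by exact_mod_cast (show 2 ≤ α by omega)
      nlinarith
    simp [hα1, hβ0]

/-- The closest pair of points among the first iterates of the flat interval provides a closest
return with space. -/
theorem good_of_closest_left {M : ℕ} (hM : ∀ n, C.a n ≤ M) {n : ℕ} {P R : Pos} (hP1 : 1 ≤ P.1)
    (hPR : P.1 < R.1) (hR : R.1 ≤ C.Q (n + 2) + C.Q (n + 3)) (hv : L.v R < L.v P)
    (hmin : ∀ q q' : Pos, q ≠ q' → 1 ≤ q.1 → q.1 ≤ C.Q (n + 2) + C.Q (n + 3) → 1 ≤ q'.1 →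
      q'.1 ≤ C.Q (n + 2) + C.Q (n + 3) → L.A P - L.A R ≤ |L.A q - L.A q'|) :
    C.Good (L.koebe ((3 * (M + 1) : ℕ) : ℝ) 1 / L.P) (n + 1) ∨
      C.Good (L.koebe ((3 * (M + 1) : ℕ) : ℝ) 1 / L.P) (n + 2) := by
  set N := C.Q (n + 2) + C.Q (n + 3) with hN
  have hN1 : 1 ≤ N := by omega
  have eQ : C.Q (n + 2 + 1) = C.Q (n + 3) := rfl
  have d2 := C.Δ_pos (n + 2)
  have d3 := C.Δ_pos (n + 3)
  obtain ⟨Y, hY1, hY2, hY3, hY4⟩ := L.exists_next hN1 P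
  obtain ⟨Z, hZ1, hZ2, hZ3, hZ4⟩ := L.exists_prev hN1 R
  have hvY : L.v Y ≤ L.v P + C.Δ (n + 2) := by
    obtain ⟨q, h1, h2, h3, h4⟩ := C.exists_near (n + 2) 1 (Or.inl rfl) hP1 (by omega)
    have := hY4 q h1 h2 (by linarith); linarith
  have hvZ : L.v R - C.Δ (n + 2) ≤ L.v Z := by
    obtain ⟨q, h1, h2, h3, h4⟩ := C.exists_near (n + 2) (-1) (Or.inr rfl)
      (show 1 ≤ R.1 by omega) (by omega)
    have := hZ4 q h1 h2 (by linarith); linarith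
  -- A point strictly between `R` and `P` would form a shorter pair, so `R` is the left neighbour of
  -- `P`.
  have hadj : ∀ q : Pos, 1 ≤ q.1 → q.1 ≤ N → L.v q < L.v P → L.v q ≤ L.v R := by
    intro q h1 h2 h3
    by_contra hc
    rw [not_le] at hc
    have h4 := hmin P q (by rintro rfl; exact lt_irrefl _ h3) hP1 (by omega) h1 h2
    have h5 := L.A_lt_A h3
    have h6 := L.A_lt_A hc
    rw [abs_of_pos (by linarith)] at h4
    linarith
  have hvPR : L.v P - L.v R ≤ C.Δ (n + 2) := by
    obtain ⟨q, h1, h2, h3, h4⟩ := C.exists_near (n + 2) (-1) (Or.inr rfl) hP1 (by omega)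
    have := hadj q h1 h2 (by linarith); linarith
  have he : R - P = C.E (n + 2) ∨ R - P = C.E (n + 3) := by
    apply C.eq_E_of_fst_pos
    · simp; omega
    · simp; omega
    · rw [L.v_sub, abs_le]; constructor <;> linarith
  obtain ⟨i, hi⟩ : ∃ i : ℕ, P.1 = i + 1 := ⟨(P.1 - 1).toNat, by omega⟩
  have hsh : ∀ q : Pos, q - P + (1, 0) + ((i : ℤ), 0) = q + (0, -P.2) := by
    intro q; ext
    · simp; omega
    · simp; ring
  have hitA : ∀ q : Pos, L.F^[i] (L.F (L.A (q - P))) = L.A q - P.2 := by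
    intro q
    rw [← L.A_succ, ← L.A_add_nat, hsh, L.A_add_int]; push_cast; ring
  have hitB : ∀ q : Pos, L.F^[i] (L.F (L.B (q - P))) = L.B q - P.2 := by
    intro q
    rw [← L.B_succ, ← L.B_add_nat, hsh, L.B_add_int]; push_cast; ring
  have hvd : 2 * C.Δ (n + 2) ≤ 1 := by
    have h1 := C.Δ_add_le n
    have h2 := C.Δ_lt (n + 1)
    have h3 := C.Δ_le_one n
    have : C.Δ (n + 1 + 1) = C.Δ (n + 2) := rfl
    linarith
  have hAB : L.A (R - P) = L.B (R - P) := L.A_eq_B (by simp; omega)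
  have hAR : L.A R = L.B R := L.A_eq_B (by omega)
  have hAZ : L.A Z = L.B Z := L.A_eq_B (by omega)
  have hκ := L.koebe_pos ((3 * (M + 1) : ℕ) : ℝ) one_pos
  have ePP : L.A (P - P) = L.a := by rw [sub_self, L.A_zero]
  have main : L.koebe ((3 * (M + 1) : ℕ) : ℝ) 1 / L.P * (L.a - L.B (Z - P)) ≤
      L.A (R - P) - L.B (Z - P) := by
    have hPA := hitA P
    rw [ePP] at hPA
    -- Going back `P.1` steps moves `P` to the flat interval. Minimality of the pair makes the arcs
    -- to the outer neighbours `Z` and `Y` at least as long as the one from `R` to `P`, that is,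
    -- space one.
    refine L.pull_crit (N := i) (z := L.F (L.A (Y - P))) one_pos ?_ ?_ ?_ ?_ ?_ ?_ ?_ ?_
    · have : L.v (0, -1) ≤ L.v (Z - P) := by
        rw [L.v_int, L.v_sub]; push_cast; linarith
      have := L.B_mono this
      rw [L.B_int] at this; push_cast at this; linarith
    · apply L.B_lt_A; rw [L.v_sub, L.v_sub]; linarith
    · rw [← L.A_zero]; apply L.A_mono; rw [L.v_sub, L.v_zero]; linarith
    · rw [← L.A_succ, ← L.A_one]; apply L.A_lt_A
      rw [L.v_add, L.v_sub]; linarith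
    · intro k hk m
      by_contra hc
      push Not at hc
      obtain ⟨c1, c2⟩ := hc
      rw [← L.A_succ, ← L.A_add_nat, ← L.A_int] at c2
      rw [← L.B_succ, ← L.B_add_nat, ← L.B_int] at c1
      -- A flat translate met at step `k` would end as an orbit point strictly between `Z` and `Y`,
      -- hence at `P` or `R`; but its time is smaller than both of theirs.
      set q : Pos := (P.1 - 1 - k, m + P.2) with hq
      have hvq : ∀ x : Pos, L.v (x - P + (1, 0) + ((k : ℤ), 0)) = L.v x - L.v q + L.v (0, m) := by
        intro x; simp [FlatLift.v, hq]; ring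
      have b1 : L.v (Z - P + (1, 0) + ((k : ℤ), 0)) < L.v (0, m) := by
        by_contra hcc
        exact absurd (L.B_mono (not_lt.1 hcc)) (not_le.2 c1)
      have b2 : L.v (0, m) < L.v (Y - P + (1, 0) + ((k : ℤ), 0)) := by
        by_contra hcc
        exact absurd (L.A_mono (not_lt.1 hcc)) (not_le.2 c2)
      rw [hvq] at b1 b2
      have hq1 : 1 ≤ q.1 := by simp only [hq]; omega
      have hq2 : q.1 ≤ N := by simp only [hq]; omega
      rcases lt_trichotomy (L.v q) (L.v P) with h | h | h
      · rcases (hadj q hq1 hq2 h).lt_or_eq with h' | h'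
        · linarith [hZ4 q hq1 hq2 h']
        · have := congrArg Prod.fst (L.v_inj h'); simp only [hq] at this; omega
      · have := congrArg Prod.fst (L.v_inj h); simp only [hq] at this; omega
      · linarith [hY4 q hq1 hq2 h]
    -- From `Z` to `Y` there are at most three arcs of length `Δ (n + 2)`, and each is at most `M +
    -- 1` arcs of length `Δ (n + 3)`, the separation valid for this many iterates.
    · have ha : (C.a (n + 2) : ℝ) ≤ M := by exact_mod_cast hM (n + 2)
      have hΔ := C.Δ_succ (n + 2)
      have d4 := C.Δ_lt (n + 3)
      have hlen : C.Δ (n + 2) ≤ (M + 1) * C.Δ (n + 3) := by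
        have : C.Δ (n + 3 + 1) = C.Δ (n + 2 + 2) := rfl
        have : C.Δ (n + 2 + 1) = C.Δ (n + 3) := rfl
        nlinarith
      obtain ⟨e, he⟩ : ∃ e : Pos, L.v e = C.Δ (n + 3) := by
        rcases C.s_eq (n + 3) with h | h
        · exact ⟨_, C.v_E_of_s h⟩
        · exact ⟨-C.E (n + 3), by rw [L.v_neg, C.v_E_of_s' h, neg_neg]⟩
      refine L.sum_iter_le (p := Z - P + (1, 0)) (p' := Y - P + (1, 0)) (e := e)
        (δ := C.Δ (n + 3)) ?_ ?_ (C.Δ_le_one _) (by rw [he]; exact d3.le) he.le ?_ _ ?_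
      · rw [L.A_succ]; exact L.mono (L.A_le_B _)
      · rw [L.A_succ]
      · intro j hj hj' m
        refine C.le_abs_nat hj ?_ m
        have h1 := C.Q_add_le (n + 2)
        have : C.Q (n + 3 + 1) = C.Q (n + 2 + 2) := rfl
        have : C.Q (n + 2 + 1) = C.Q (n + 3) := rfl
        omega
      · rw [he, L.v_add, L.v_add, L.v_sub, L.v_sub]
        push_cast
        nlinarith
    · rw [hPA, hitA, hitB, one_mul]
      have := hmin R Z (by rintro rfl; exact lt_irrefl _ hZ3) (by omega) hR hZ1 hZ2
      rw [abs_of_pos (by linarith [L.A_lt_A hZ3])] at this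
      linarith
    · rw [hPA, hitA, hitA, one_mul]
      have := hmin Y P (by rintro rfl; exact lt_irrefl _ hY3) hY1 hY2 hP1 (by omega)
      rw [abs_of_pos (by linarith [L.A_lt_A hY3])] at this
      linarith
  have fin : ∀ k, R - P = C.E (k + 1) → L.v (C.E (k + 1) - C.E k) ≤ L.v (Z - P) →
      C.Good (L.koebe ((3 * (M + 1) : ℕ) : ℝ) 1 / L.P) k := by
    intro k hk hle
    unfold Good
    rw [← hk] at hle ⊢
    have h1 : L.v (R - P) < L.v 0 := by rw [L.v_sub, L.v_zero]; linarith
    have h2 : L.v (R - P - C.E k) < L.v (R - P) :=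
      hle.trans_lt (by rw [L.v_sub, L.v_sub]; linarith)
    have h3 := L.B_mono hle
    have h4 := L.B_mono (p := Z - P) (p' := R - P) (by rw [L.v_sub, L.v_sub]; linarith)
    rw [L.gl_comm, L.gl_eq h1, L.gl_comm, L.gl_eq h2, L.A_zero]
    refine le_trans ?_ (main.trans (by linarith))
    apply mul_le_mul_of_nonneg_left _ (div_pos hκ L.P_pos).le
    linarith
  have hvZP : -(C.Δ (n + 2)) + L.v (R - P) ≤ L.v (Z - P) := by
    rw [L.v_sub, L.v_sub]; linarith
  have hneg : L.v (R - P) < 0 := by rw [L.v_sub]; linarith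
  rcases he with he | he
  · left
    refine fin (n + 1) he ?_
    have hs : C.s (n + 2) = -1 := by
      rcases C.s_eq (n + 2) with h | h
      · rw [he, C.v_E_of_s h] at hneg; linarith
      · exact h
    have hs' : C.s (n + 1) = 1 := by have : C.s (n + 2) = -C.s (n + 1) := C.s_succ (n + 1); linarith
    rw [L.v_sub, C.v_E_of_s hs', show n + 1 + 1 = n + 2 from rfl]
    rw [he] at hvZP
    have : C.Δ (n + 2) < C.Δ (n + 1) := C.Δ_lt (n + 1)
    linarith
  · right
    refine fin (n + 2) he ?_
    have hs : C.s (n + 3) = -1 := by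
      rcases C.s_eq (n + 3) with h | h
      · rw [he, C.v_E_of_s h] at hneg; linarith
      · exact h
    have hs' : C.s (n + 2) = 1 := by have : C.s (n + 3) = -C.s (n + 2) := C.s_succ (n + 2); linarith
    rw [L.v_sub, C.v_E_of_s hs', show n + 2 + 1 = n + 3 from rfl]
    rw [he] at hvZP
    linarith

/-- Take the pair of distinct times up to `Q (n + 2) + Q (n + 3)` whose orbit points are closest
modulo one. If the later point lies to the right of the earlier one, reflect. -/
theorem exists_good {M : ℕ} (hM : ∀ n, C.a n ≤ M) (n : ℕ) :
    C.Good (L.koebe ((3 * (M + 1) : ℕ) : ℝ) 1 / L.P) (n + 1) ∨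
      C.Good (L.koebe ((3 * (M + 1) : ℕ) : ℝ) 1 / L.P) (n + 2) := by
  set N := C.Q (n + 2) + C.Q (n + 3) with hN
  have hN2 : 2 ≤ N := by
    have h1 := (C.Q_pos (n + 1)).1
    have h2 := (C.Q_pos (n + 2)).1
    simp only [hN]
    have e1 : C.Q (n + 1 + 1) = C.Q (n + 2) := rfl
    have e2 : C.Q (n + 2 + 1) = C.Q (n + 3) := rfl
    omega
  set g : ℤ × ℤ → ℝ := fun x => |(L.A (x.1, 0) - L.A (x.2, 0)) -
    round (L.A (x.1, 0) - L.A (x.2, 0))| with hg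
  obtain ⟨⟨i, j⟩, hij, hmin⟩ := Finset.exists_min_image
    ((Finset.Icc 1 N ×ˢ Finset.Icc 1 N).filter fun x => x.1 ≠ x.2) g
    ⟨(1, 2), by simp; omega⟩
  simp only [Finset.mem_filter, Finset.mem_product, Finset.mem_Icc] at hij
  have hsplit : ∀ q : Pos, L.A q = L.A (q.1, 0) + q.2 := by
    intro q; rw [← L.A_add_int]; congr 1; simp
  set r := round (L.A (i, 0) - L.A (j, 0))
  have hgij : g (i, j) = |L.A (i, 0) - L.A (j, r)| := by
    rw [hsplit (j, r)]; simp only [hg]; congr 1; ring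
  have hne : L.A (i, 0) ≠ L.A (j, r) := by
    intro h
    rcases lt_trichotomy (L.v (i, 0)) (L.v (j, r)) with h' | h' | h'
    · exact (L.A_lt_A h').ne h
    · exact hij.2 (congrArg Prod.fst (L.v_inj h'))
    · exact (L.A_lt_A h').ne' h
  have hle1 : |L.A (i, 0) - L.A (j, r)| ≤ 1 := by
    rw [← hgij]
    exact (abs_sub_round _).trans (by norm_num)
  have hminA : ∀ q q' : Pos, q ≠ q' → 1 ≤ q.1 → q.1 ≤ N → 1 ≤ q'.1 → q'.1 ≤ N →
      |L.A (i, 0) - L.A (j, r)| ≤ |L.A q - L.A q'| := by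
    intro q q' hqq h1 h2 h3 h4
    by_cases h5 : q.1 = q'.1
    · refine hle1.trans ?_
      rw [hsplit q, hsplit q', h5]
      have h6 : q.2 - q'.2 ≠ 0 := fun h => hqq (Prod.ext h5 (by omega))
      have : (1 : ℝ) ≤ |((q.2 - q'.2 : ℤ) : ℝ)| := by
        exact_mod_cast Int.one_le_abs h6
      push_cast at this
      rwa [add_sub_add_left_eq_sub]
    · rw [← hgij]
      refine (hmin (q.1, q'.1) (by simp only [Finset.mem_filter,
        Finset.mem_product, Finset.mem_Icc]; exact ⟨⟨⟨h1, h2⟩, h3, h4⟩, h5⟩)).trans ?_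
      rw [hsplit q, hsplit q']
      refine (round_le _ (q'.2 - q.2)).trans (le_of_eq ?_)
      push_cast; congr 1; ring
  obtain ⟨P, R, hP1, hPR, hR, hPR', hne'⟩ : ∃ P R : Pos, 1 ≤ P.1 ∧ P.1 < R.1 ∧ R.1 ≤ N ∧
      |L.A P - L.A R| = |L.A (i, 0) - L.A (j, r)| ∧ L.A P ≠ L.A R := by
    rcases lt_or_gt_of_ne hij.2 with h | h
    · exact ⟨(i, 0), (j, r), hij.1.1.1, h, hij.1.2.2, rfl, hne⟩
    · exact ⟨(j, r), (i, 0), hij.1.2.1, h, hij.1.1.2, abs_sub_comm _ _, hne.symm⟩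
  have hvne : L.v P ≠ L.v R := fun h => hne' (by rw [L.v_inj h])
  rcases lt_or_gt_of_ne hvne with hv | hv
  · have hR1 : 1 ≤ R.1 := by omega
    have := C.reflect.good_of_closest_left (M := M) hM (n := n) (P := P.refl) (R := R.refl)
      hP1 hPR hR (by rw [L.reflect_v, L.reflect_v]; linarith) (by
        have hr : ∀ q : Pos, q.refl.refl = q := fun q => by ext <;> simp [Pos.refl]
        have hrA : ∀ q : Pos, 1 ≤ q.1 → L.reflect.A q = -L.A q.refl := by
          intro q hq
          have := L.reflect_A q.refl
          rw [hr] at this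
          rw [this, L.A_eq_B (p := q.refl) hq]
        intro q q' hqq h1 h2 h3 h4
        rw [hrA q h1, hrA q' h3, L.reflect_A, L.reflect_A, ← L.A_eq_B hP1, ← L.A_eq_B hR1]
        have := hminA q.refl q'.refl (fun h => hqq (by rw [← hr q, ← hr q', h])) h1 h2 h3 h4
        rw [← hPR', abs_of_neg (by linarith [L.A_lt_A hv])] at this
        have e : |-L.A q.refl - -L.A q'.refl| = |L.A q.refl - L.A q'.refl| := by
          rw [neg_sub_neg, abs_sub_comm]
        rw [e]
        linarith)
    rw [reflect_good, reflect_good] at this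
    exact this
  · refine C.good_of_closest_left hM hP1 hPR hR hv ?_
    intro q q' hqq h1 h2 h3 h4
    have := hminA q q' hqq h1 h2 h3 h4
    rwa [← hPR', abs_of_pos (by linarith [L.A_lt_A hv])] at this

theorem Good.mono {C : CF L} {c c' : ℝ} (h : c' ≤ c) {n : ℕ} (hg : C.Good c n) : C.Good c' n := by
  have hpos : 0 < L.gl 0 (C.E (n + 1)) := L.gl_pos (by
    intro h
    have := (C.Q_pos n).1
    have h2 := congrArg Prod.fst h
    simp only [Prod.fst_zero, Q] at this h2; omega)
  exact (mul_le_mul_of_nonneg_right h hpos.le).trans hg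

theorem ne_zero_of_fst {p : Pos} (h : p.1 ≠ 0) : p ≠ 0 := fun e => h (by rw [e]; rfl)

theorem E_ne_zero (n : ℕ) : C.E n ≠ 0 := by
  intro h
  have := C.v_E n
  rw [h, L.v_zero] at this
  have h2 := C.Δ_pos n
  have h3 : C.s n * C.Δ n = 0 := this.symm
  rcases C.s_eq n with h | h <;> rw [h] at h3 <;> linarith

theorem exists_good_single (n : ℕ) : ∃ c > 0, C.Good c n := by
  refine ⟨L.gl (C.E (n + 1)) (C.E (n + 1) - C.E n), L.gl_pos ?_, ?_⟩
  · intro h; exact C.E_ne_zero n (sub_eq_self.1 h.symm)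
  · unfold Good
    have h1 : L.gl 0 (C.E (n + 1)) ≤ 1 := L.gl_le_one (by
      rw [L.v_zero, sub_zero, C.v_E', abs_mul, abs_of_pos (C.Δ_pos _)]
      rcases C.s_eq (n + 1) with h | h <;> simp [h, C.Δ_le_one])
    have : 0 ≤ L.gl (C.E (n + 1)) (C.E (n + 1) - C.E n) := (L.gl_pos (by
      intro h; exact C.E_ne_zero n (sub_eq_self.1 h.symm))).le
    nlinarith

/-- The return `E (n + 2)` lies inside the base gap that ends at `-E (n + 1)`. -/
theorem gl_E_le (n : ℕ) : L.gl 0 (C.E (n + 2)) ≤ L.gl (-C.E (n + 1)) 0 := by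
  have d := C.Δ_lt (n + 1)
  have d1 := C.Δ_pos (n + 2)
  have e : C.s (n + 2) = - C.s (n + 1) := C.s_succ (n + 1)
  have e' : C.Δ (n + 1 + 1) = C.Δ (n + 2) := rfl
  rcases C.s_eq (n + 1) with h | h <;> rw [h] at e
  · rw [L.gl_comm]
    apply L.gl_mono
    · rw [L.v_neg, C.v_E_of_s h, C.v_E_of_s' e]; linarith
    · rw [L.v_zero, C.v_E_of_s' e]; linarith
    · exact le_rfl
  · rw [L.gl_comm (-C.E (n + 1))]
    rw [neg_neg] at e
    apply L.gl_mono
    · exact le_rfl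
    · rw [L.v_zero, C.v_E_of_s e]; linarith
    · rw [L.v_neg, C.v_E_of_s' h, C.v_E_of_s e]; linarith

/-- The arc beyond `E (n + 2)` contains the preimage `-E (n + 1)`, which by the previous level is
comparable to its base gap, and that gap contains `E (n + 2)`. -/
theorem good_succ {c : ℝ} (hc : 0 < c) : ∃ c' > 0, ∀ n, C.Good c n → C.Good c' (n + 1) := by
  obtain ⟨c', hc', h⟩ := C.w_ge_of_good hc
  refine ⟨c', hc', fun n hg => ?_⟩
  unfold Good
  refine le_trans (mul_le_mul_of_nonneg_left (C.gl_E_le n) hc'.le) ((h n hg).trans ?_)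
  have d := C.Δ_lt (n + 1)
  have d1 := C.Δ_pos (n + 2)
  have e : C.s (n + 2) = - C.s (n + 1) := C.s_succ (n + 1)
  have e' : C.Δ (n + 1 + 1) = C.Δ (n + 2) := rfl
  rcases C.s_eq (n + 1) with h | h <;> rw [h] at e
  · rw [L.gl_comm]
    apply L.w_le_gl
    · rw [L.v_sub, L.v_neg, C.v_E_of_s h, C.v_E_of_s' e]; linarith
    · rw [L.v_neg, C.v_E_of_s h, C.v_E_of_s' e]; linarith
  · rw [neg_neg] at e
    apply L.w_le_gl
    · rw [L.v_neg, C.v_E_of_s' h, C.v_E_of_s e]; linarith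
    · rw [L.v_sub, L.v_neg, C.v_E_of_s' h, C.v_E_of_s e]; linarith

/-- Iterating `good_succ` would let the constant degenerate. As `exists_good` gives a fixed constant
at one of any two consecutive levels from level one on, a single step is enough. -/
theorem good_all {M : ℕ} (hM : ∀ n, C.a n ≤ M) : ∃ c > 0, ∀ n, C.Good c n := by
  set c₀ := L.koebe ((3 * (M + 1) : ℕ) : ℝ) 1 / L.P with hc₀
  have h0 : 0 < c₀ := div_pos (L.koebe_pos _ one_pos) L.P_pos
  obtain ⟨c₁, h1, hs⟩ := C.good_succ h0
  obtain ⟨c₂, h2, g0⟩ := C.exists_good_single 0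
  obtain ⟨c₃, h3, g1⟩ := C.exists_good_single 1
  refine ⟨min (min c₀ c₁) (min c₂ c₃), lt_min (lt_min h0 h1) (lt_min h2 h3), fun n => ?_⟩
  rcases n with _ | _ | n
  · exact g0.mono ((min_le_right _ _).trans (min_le_left _ _))
  · exact g1.mono ((min_le_right _ _).trans (min_le_right _ _))
  · rcases C.exists_good hM n with h | h
    · exact (hs _ h).mono ((min_le_left _ _).trans (min_le_right _ _))
    · exact h.mono ((min_le_left _ _).trans (min_le_left _ _))

end CF

/-! ### Bounded geometry of the dynamical partitions -/

theorem exists_uniform {P : ℕ → ℝ → Prop} (hmono : ∀ j c c', c' ≤ c → P j c → P j c')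
    (h : ∀ j, ∃ c > 0, P j c) (M : ℕ) : ∃ c > 0, ∀ j ≤ M, P j c := by
  induction M with
  | zero =>
    obtain ⟨c, hc, h0⟩ := h 0
    exact ⟨c, hc, fun j hj => by rwa [Nat.le_zero.1 hj]⟩
  | succ M ih =>
    obtain ⟨c, hc, h0⟩ := ih
    obtain ⟨c', hc', h1⟩ := h (M + 1)
    refine ⟨min c c', lt_min hc hc', fun j hj => ?_⟩
    rcases Nat.lt_or_ge M j with hj' | hj'
    · have : j = M + 1 := by omega
      subst this
      exact hmono _ _ _ (min_le_right _ _) h1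
    · exact hmono _ _ _ (min_le_left _ _) (h0 j hj')

namespace CF

variable {L : FlatLift} (C : CF L)

/-- Bounded geometry: the distances of the closest returns decay at most geometrically. -/
def BG (c : ℝ) : Prop := ∀ n, c * L.gl 0 (C.E n) ≤ L.gl 0 (C.E (n + 2))

theorem gl_neg_E_pos (n : ℕ) : 0 < L.gl (-C.E n) 0 :=
  L.gl_pos (neg_ne_zero.2 (C.E_ne_zero n))

theorem gl_neg_E_le_one (n : ℕ) : L.gl (-C.E n) 0 ≤ 1 := L.gl_le_one (by
  rw [L.v_zero, zero_sub, L.v_neg, neg_neg, C.v_E', abs_mul, abs_of_pos (C.Δ_pos _)]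
  rcases C.s_eq n with h | h <;> simp [h, C.Δ_le_one])

/-- With `gl_E_le` this places the size of a base gap between the distances of `E (n + 2)` and `E
n`, which are the two that `BG` compares. -/
theorem gl_neg_E_le (n : ℕ) : L.gl (-C.E (n + 1)) 0 ≤ L.gl 0 (C.E n) := by
  have d := C.Δ_lt n
  have d1 := C.Δ_pos (n + 1)
  have e := C.s_succ n
  rcases C.s_eq n with h | h <;> rw [h] at e
  · rw [L.gl_comm]
    apply L.gl_mono
    · exact le_rfl
    · rw [L.v_neg, L.v_zero, C.v_E_of_s' e]; linarith
    · rw [L.v_neg, C.v_E_of_s h, C.v_E_of_s' e]; linarith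
  · rw [neg_neg] at e
    rw [L.gl_comm 0]
    apply L.gl_mono
    · rw [L.v_neg, C.v_E_of_s' h, C.v_E_of_s e]; linarith
    · rw [L.v_neg, L.v_zero, C.v_E_of_s e]; linarith
    · exact le_rfl

theorem gl_tail {c : ℝ} (hc : 0 < c) (hB : C.BG c) (n : ℕ) :
    c ^ 2 * L.gl (-C.E (n + 1)) 0 ≤ L.gl (-C.E (n + 3)) 0 := by
  have h1 := C.gl_neg_E_le n
  have h2 := hB n
  have h3 := hB (n + 2)
  have h4 := C.gl_E_le (n + 2)
  have e1 : n + 2 + 2 = n + 4 := rfl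
  have e2 : n + 2 + 1 = n + 3 := rfl
  rw [e1] at h3 h4
  rw [e2] at h4
  calc c ^ 2 * L.gl (-C.E (n + 1)) 0 ≤ c ^ 2 * L.gl 0 (C.E n) :=
        mul_le_mul_of_nonneg_left h1 (by positivity)
    _ = c * (c * L.gl 0 (C.E n)) := by ring
    _ ≤ c * L.gl 0 (C.E (n + 2)) := mul_le_mul_of_nonneg_left h2 hc.le
    _ ≤ _ := h3.trans h4

/-- The preimages that split the `n`-th base gap. -/
def cut (n j : ℕ) : Pos := -C.E n - (j : ℤ) • C.E (n + 1)

theorem cut_zero (n : ℕ) : C.cut n 0 = -C.E n := by simp [cut]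

theorem cut_last (n : ℕ) : C.cut n (C.a n) = -C.E (n + 2) := by
  rw [cut, C.E_succ]; abel

theorem cut_succ (n j : ℕ) : C.cut n (j + 1) + C.E (n + 1) = C.cut n j := by
  unfold cut; push_cast; module

theorem cut_fst (n j : ℕ) : (C.cut n j).1 = -C.Q n - j * C.Q (n + 1) := by
  simp [cut, Q]

theorem cut_fst_nonpos (n j : ℕ) : (C.cut n j).1 ≤ 0 := by
  rw [cut_fst]
  have := C.Q_pos n
  nlinarith [this.1, this.2, (Nat.cast_nonneg j : (0 : ℤ) ≤ j)]

theorem v_cut (n j : ℕ) : L.v (C.cut n j) = -(C.s n * (C.Δ n - j * C.Δ (n + 1))) := by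
  rw [cut, L.v_sub, L.v_neg, L.v_zsmul, C.v_E', C.v_E', C.s_succ]; push_cast; ring

theorem mul_Δ_lt {n j : ℕ} (h : j ≤ C.a n) : j * C.Δ (n + 1) < C.Δ n := by
  rw [C.Δ_succ n]
  have : (j : ℝ) ≤ C.a n := by exact_mod_cast h
  have := mul_le_mul_of_nonneg_right this (C.Δ_pos (n + 1)).le
  linarith [C.Δ_pos (n + 2)]

/-- The return `E (n + 1)` carries the first piece onto the gap between the flat interval and `-E (n
+ 2)`. By bounded geometry that gap is comparable to the distance of `E (n + 1)`, and `Good`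
supplies the space beyond. -/
theorem first_gap_aux {cB cG : ℝ} (hcB : 0 < cB) (hB : C.BG cB) (hcG : 0 < cG)
    (hG : ∀ n, C.Good cG n) : ∃ c > 0, ∀ n, C.s (n + 1) = 1 →
      c * L.gl (-C.E (n + 1)) 0 ≤ L.gl (C.cut (n + 1) 0) (C.cut (n + 1) 1) := by
  set η := min cB cG
  have hη : 0 < η := lt_min hcB hcG
  refine ⟨L.koebe 2 η / L.P, div_pos (L.koebe_pos 2 hη) L.P_pos, fun n hs => ?_⟩
  obtain ⟨N, hN⟩ := C.exists_nat_Q n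
  have hs' : C.s (n + 1 + 1) = -1 := by rw [C.s_succ, hs]
  have hs'' : C.s (n + 1 + 2) = 1 := by rw [C.s_succ, hs', neg_neg]
  have v1 := C.v_E_of_s hs
  have v2 := C.v_E_of_s' hs'
  have v3 := C.v_E_of_s hs''
  have d1 := C.Δ_pos (n + 1)
  have d2 := C.Δ_pos (n + 1 + 1)
  have d3 := C.Δ_pos (n + 1 + 2)
  have d12 := C.Δ_lt (n + 1)
  have d23 : C.Δ (n + 1 + 2) < C.Δ (n + 1 + 1) := C.Δ_lt (n + 1 + 1)
  have c0 : L.v (C.cut (n + 1) 0) = -C.Δ (n + 1) := by rw [C.v_cut, hs]; simp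
  have c1 : L.v (C.cut (n + 1) 1) = -C.Δ (n + 1) + C.Δ (n + 1 + 1) := by
    rw [C.v_cut, hs]; push_cast; ring
  have hD : L.gl 0 (C.E (n + 1)) = L.A (C.E (n + 1)) - L.b := by
    rw [L.gl_eq (by rw [L.v_zero]; linarith), L.B_zero]
  have hD' : L.gl 0 (-C.E (n + 1 + 1)) = L.A (-C.E (n + 1 + 1)) - L.b := by
    rw [L.gl_eq (by rw [L.v_zero, L.v_neg]; linarith), L.B_zero]
  have hD0 : 0 < L.gl 0 (-C.E (n + 1 + 1)) := L.gl_pos (neg_ne_zero.2 (C.E_ne_zero _)).symm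
  have hBG : cB * L.gl 0 (C.E (n + 1)) ≤ L.gl 0 (-C.E (n + 1 + 1)) := by
    refine (hB (n + 1)).trans ?_
    have := C.gl_E_le (n + 1)
    rwa [L.gl_comm (-_)] at this
  have e0 : L.F^[N] (L.F (L.B (C.cut (n + 1) 0))) = L.b - (C.E (n + 1)).2 := by
    have := C.iter_F_B hN (C.cut (n + 1) 0)
    rwa [C.cut_zero, neg_add_cancel, L.B_zero, ← C.cut_zero] at this
  have e1 : L.F^[N] (L.F (L.A (C.cut (n + 1) 1))) =
      L.A (-C.E (n + 1 + 1)) - (C.E (n + 1)).2 := by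
    have := C.iter_F_A hN (C.cut (n + 1) 1)
    rw [this]; congr 2; unfold cut; push_cast; module
  have hAA : L.A (-C.E (n + 1 + 1)) ≤ L.A (C.E (n + 1)) :=
    L.A_mono (by rw [L.v_neg]; linarith)
  have h := C.pull_return hs hη (y₀ := L.B (C.cut (n + 1) 0)) (y₁ := L.A (C.cut (n + 1) 1))
    (by rw [C.cut_zero]; exact L.A_le_B _) (L.B_lt_A (by linarith))
    (by rw [← L.A_zero]; exact L.A_mono (by rw [L.v_zero]; linarith)) hN ?_ ?_
  · rw [L.gl_eq (p := C.cut (n + 1) 0) (by linarith), ← C.cut_zero,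
      L.gl_eq (p := C.cut (n + 1) 0) (by rw [L.v_zero]; linarith), L.A_zero]
    exact h
  · rw [e0, e1]
    have : η ≤ cB := min_le_left _ _
    nlinarith
  · rw [e1]
    have : η ≤ cG := min_le_right _ _
    have hg : cG * L.gl 0 (C.E (n + 1)) ≤ _ := hG n
    refine le_trans ?_ hg
    nlinarith

/-- The return `E (n + 2)` moves each cut to the previous one. The space on the far side is the arc
from `E (n + 2)` to the flat interval, comparable to the base gap by bounded geometry. -/
theorem pull_short_aux {cB : ℝ} (hcB : 0 < cB) (hB : C.BG cB) {η : ℝ} (hη : 0 < η) :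
    ∃ c > 0, ∀ n, C.s (n + 1) = 1 → ∀ u v : ℝ, L.A (C.cut (n + 1) 1) ≤ u →
      u ≤ L.B (-C.E (n + 3)) → L.B (C.cut (n + 1) 1) ≤ v → v ≤ L.a → u < v →
      ∀ N : ℕ, (N : ℤ) + 1 = C.Q (n + 2) →
      η * L.gl (-C.E (n + 1)) 0 ≤ L.F^[N] (L.F v) - L.F^[N] (L.F u) →
      c * L.gl (-C.E (n + 1)) 0 ≤ v - u := by
  set η' := min η cB
  have hη' : 0 < η' := lt_min hη hcB
  have hκ := div_pos (L.koebe_pos 1 hη') L.P_pos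
  -- The total length is at most `1` since the rotation length is exactly `Δ (n + 1)`. The factor
  -- `cB ^ 2` comes from `gl_tail`: `[u, a]` contains the gap behind `-E (n + 3)`.
  refine ⟨L.koebe 1 η' / L.P * cB ^ 2, by positivity, ?_⟩
  intro n hs u v hu hu' hv hva huv N hN hS
  have hs' : C.s (n + 2) = -1 := by rw [C.s_succ, hs]
  have hs'' : C.s (n + 3) = 1 := by rw [C.s_succ, hs', neg_neg]
  have v1 := C.v_E_of_s hs
  have v2 := C.v_E_of_s' hs'
  have v3 := C.v_E_of_s hs''
  have d1 := C.Δ_pos (n + 1)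
  have d2 := C.Δ_pos (n + 2)
  have d3 := C.Δ_pos (n + 3)
  have d12 : C.Δ (n + 2) < C.Δ (n + 1) := C.Δ_lt (n + 1)
  have c1 : L.v (C.cut (n + 1) 1) = -C.Δ (n + 1) + C.Δ (n + 2) := by
    rw [C.v_cut, hs]; push_cast; ring
  have hlt : L.v (-C.E (n + 1)) < L.v 0 := by rw [L.v_neg, L.v_zero]; linarith
  have hlt3 : L.v (-C.E (n + 3)) < L.v 0 := by rw [L.v_neg, L.v_zero]; linarith
  have eFl := L.gl_eq hlt
  have eFl3 := L.gl_eq hlt3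
  have hFl0 := C.gl_neg_E_pos (n + 1)
  rw [L.A_zero] at eFl eFl3
  have eA : L.F^[N] (L.F L.a) = L.A (C.E (n + 2)) - (C.E (n + 2)).2 := by
    have := C.iter_F_A hN 0
    rwa [L.A_zero, zero_add] at this
  have ez : L.F^[N] (L.A (-C.E (n + 2) + (1, 0))) = L.a - (C.E (n + 2)).2 := by
    have := C.iter_F_A hN (-C.E (n + 2))
    rw [L.A_succ, this, neg_add_cancel, L.A_zero]
  have eB : L.F^[N] (L.F (L.B (C.cut (n + 1) 1))) = L.B (-C.E (n + 1)) - (C.E (n + 2)).2 := by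
    have := C.iter_F_B hN (C.cut (n + 1) 1)
    rw [this]; congr 2; unfold cut; push_cast; module
  have hNv := L.iter_mono N (L.mono hv)
  rw [eB] at hNv
  have hM : L.A (C.E (n + 2)) - (C.E (n + 2)).2 - L.F^[N] (L.F v) ≤ L.gl (-C.E (n + 1)) 0 := by
    have : L.A (C.E (n + 2)) ≤ L.a := by
      rw [← L.A_zero]; exact L.A_mono (by rw [L.v_zero]; linarith)
    linarith
  have hR : cB * L.gl (-C.E (n + 1)) 0 ≤ L.a - L.A (C.E (n + 2)) := by
    have h1 : L.gl 0 (C.E (n + 2)) = L.a - L.A (C.E (n + 2)) := by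
      rw [L.gl_comm, L.gl_eq (by rw [L.v_zero]; linarith), L.A_zero, ← C.A_E]
    rw [← h1]
    exact (mul_le_mul_of_nonneg_left (C.gl_neg_E_le n) hcB.le).trans (hB n)
  have h := L.pull_crit (N := N) (z := L.A (-C.E (n + 2) + (1, 0))) (S := ((1 : ℕ) : ℝ)) hη'
    (y₀ := u) (y₁ := v) ?_ huv hva ?_ ?_ ?_ ?_ ?_
  · rw [Nat.cast_one] at h
    refine le_trans ?_ h
    rw [mul_assoc]
    refine mul_le_mul_of_nonneg_left ?_ hκ.le
    refine (C.gl_tail hcB hB n).trans ?_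
    linarith
  · refine le_trans ?_ hu
    have : L.v (0, -1) < L.v (C.cut (n + 1) 1) := by
      rw [c1, L.v_int]; push_cast; linarith [C.Δ_le_one (n + 1)]
    have := L.B_lt_A this
    rw [L.B_int] at this; push_cast at this; linarith
  · rw [← L.A_one]
    apply L.A_lt_A
    rw [L.v_add, L.v_neg]; linarith
  · intro k hk m
    by_contra hc
    push Not at hc
    obtain ⟨h1, h2⟩ := hc
    rw [← L.A_add_nat, ← L.A_int] at h2
    have h1' : L.F^[k] (L.F (L.A (C.cut (n + 1) 1))) < L.B (0, m) := by
      rw [L.B_int]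
      exact lt_of_le_of_lt (L.iter_mono k (L.mono hu)) h1
    rw [← L.A_succ, ← L.A_add_nat] at h1'
    have b1 : L.v (C.cut (n + 1) 1 + (1, 0) + ((k : ℤ), 0)) ≤ L.v (0, m) := by
      by_contra hcc
      exact absurd (L.B_lt_A (not_le.1 hcc)) (not_lt.2 h1'.le)
    have b2 : L.v (0, m) < L.v (-C.E (n + 2) + (1, 0) + ((k : ℤ), 0)) := by
      by_contra hcc
      exact absurd (L.A_mono (not_lt.1 hcc)) (not_le.2 h2)
    have hx := C.le_abs_v (n := n + 1) (p := ((k : ℤ) + 1, -m)) (by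
      intro h; have := congrArg Prod.fst h; simp at this; omega) (by
      rw [abs_of_nonneg (by positivity)]
      show (k : ℤ) + 1 < C.Q (n + 2)
      omega)
    have hv : L.v ((k : ℤ) + 1, -m) = L.v (1, 0) + L.v ((k : ℤ), 0) - L.v (0, m) := by
      simp [FlatLift.v]; ring
    rw [L.v_add, L.v_add] at b1 b2
    rw [L.v_neg] at b2
    rcases le_abs.1 hx with h | h <;> linarith
  · refine L.sum_iter_le (p := C.cut (n + 1) 1 + (1, 0)) (p' := -C.E (n + 2) + (1, 0))
      (e := C.E (n + 1)) (δ := C.Δ (n + 1)) ?_ le_rfl (C.Δ_le_one _) (by linarith) v1.le ?_ 1 ?_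
    · rw [L.A_succ]; exact L.mono hu
    · intro j hj hj' m
      refine C.le_abs_nat hj ?_ m
      show (j : ℤ) < C.Q (n + 2)
      omega
    · rw [L.v_add, L.v_add, L.v_neg]; push_cast; linarith
  · rw [eA]
    have : η' ≤ η := min_le_left _ _
    refine le_trans ?_ hS
    exact (mul_le_mul_of_nonneg_left hM hη'.le).trans (mul_le_mul_of_nonneg_right this hFl0.le)
  · rw [eA, ez]
    have : η' ≤ cB := min_le_right _ _
    have := (mul_le_mul_of_nonneg_left hM hη'.le).trans (mul_le_mul_of_nonneg_right this hFl0.le)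
    linarith

/-- Induction along the cuts, starting from `w_ge_of_good`. The constant worsens with `j`, which is
harmless because `j` is bounded by the partial quotients. -/
theorem cut_w_aux {cB cG : ℝ} (hcB : 0 < cB) (hB : C.BG cB) (hcG : 0 < cG)
    (hG : ∀ n, C.Good cG n) (j : ℕ) : ∃ c > 0, ∀ n, C.s (n + 1) = 1 → j ≤ C.a (n + 1) →
      c * L.gl (-C.E (n + 1)) 0 ≤ L.w (C.cut (n + 1) j) := by
  induction j with
  | zero =>
    obtain ⟨c, hc, h⟩ := C.w_ge_of_good hcG
    refine ⟨c, hc, fun n _ _ => ?_⟩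
    rw [C.cut_zero]; exact h n (hG n)
  | succ j ih =>
    obtain ⟨η, hη, ih⟩ := ih
    obtain ⟨c, hc, h⟩ := C.pull_short_aux hcB hB hη
    refine ⟨c, hc, fun n hs hj => ?_⟩
    obtain ⟨N, hN⟩ := C.exists_nat_Q (n + 1)
    have d2 := C.Δ_pos (n + 1 + 1)
    have hvc : ∀ k, L.v (C.cut (n + 1) k) = -C.Δ (n + 1) + k * C.Δ (n + 1 + 1) := by
      intro k; rw [C.v_cut, hs]; ring
    have hj1 : (1 : ℝ) ≤ ((j + 1 : ℕ) : ℝ) := by exact_mod_cast (show 1 ≤ j + 1 by omega)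
    have hja : ((j + 1 : ℕ) : ℝ) ≤ C.a (n + 1) := by exact_mod_cast hj
    have m1 := mul_le_mul_of_nonneg_right hj1 d2.le
    have m2 := mul_le_mul_of_nonneg_right hja d2.le
    refine h n hs _ _ ?_ ?_ ?_ ?_ (L.A_lt_B (C.cut_fst_nonpos _ _)) N hN ?_
    · apply L.A_mono; rw [hvc, hvc]; push_cast at m1 ⊢; linarith
    · refine (L.A_le_B _).trans ?_
      have := C.cut_last (n + 1)
      rw [show n + 3 = n + 1 + 2 from rfl, ← this]
      apply L.B_mono; rw [hvc, hvc]; linarith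
    · apply L.B_mono; rw [hvc, hvc]; push_cast at m1 ⊢; linarith
    · rw [← L.A_zero]; refine (L.B_lt_A ?_).le
      rw [hvc, L.v_zero]; linarith [C.mul_Δ_lt hj]
    · rw [C.iter_F_A hN, C.iter_F_B hN, C.cut_succ]
      have := ih n hs (by omega)
      rw [FlatLift.w] at this; linarith

theorem cut_gl_aux {cB cG : ℝ} (hcB : 0 < cB) (hB : C.BG cB) (hcG : 0 < cG)
    (hG : ∀ n, C.Good cG n) (j : ℕ) : ∃ c > 0, ∀ n, C.s (n + 1) = 1 → j + 1 ≤ C.a (n + 1) →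
      c * L.gl (-C.E (n + 1)) 0 ≤ L.gl (C.cut (n + 1) j) (C.cut (n + 1) (j + 1)) := by
  induction j with
  | zero =>
    obtain ⟨c, hc, h⟩ := C.first_gap_aux hcB hB hcG hG
    exact ⟨c, hc, fun n hs _ => h n hs⟩
  | succ j ih =>
    obtain ⟨η, hη, ih⟩ := ih
    obtain ⟨c, hc, h⟩ := C.pull_short_aux hcB hB hη
    refine ⟨c, hc, fun n hs hj => ?_⟩
    obtain ⟨N, hN⟩ := C.exists_nat_Q (n + 1)
    have d2 := C.Δ_pos (n + 1 + 1)
    have hvc : ∀ k, L.v (C.cut (n + 1) k) = -C.Δ (n + 1) + k * C.Δ (n + 1 + 1) := by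
      intro k; rw [C.v_cut, hs]; ring
    have hlt : ∀ k, L.v (C.cut (n + 1) k) < L.v (C.cut (n + 1) (k + 1)) := by
      intro k; rw [hvc, hvc]; push_cast; linarith
    have hj1 : (1 : ℝ) ≤ ((j + 1 : ℕ) : ℝ) := by exact_mod_cast (show 1 ≤ j + 1 by omega)
    have hja : ((j + 1 : ℕ) : ℝ) ≤ C.a (n + 1) := by exact_mod_cast (show j + 1 ≤ _ by omega)
    have m1 := mul_le_mul_of_nonneg_right hj1 d2.le
    have m2 := mul_le_mul_of_nonneg_right hja d2.le
    rw [L.gl_eq (hlt (j + 1))]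
    refine h n hs _ _ ?_ ?_ ?_ ?_ (L.B_lt_A (hlt _)) N hN ?_
    · refine le_trans (L.A_mono ?_) (L.A_le_B _)
      rw [hvc, hvc]; push_cast at m1 ⊢; linarith
    · have := C.cut_last (n + 1)
      rw [show n + 3 = n + 1 + 2 from rfl, ← this]
      apply L.B_mono; rw [hvc, hvc]; linarith
    · refine (L.B_lt_A (lt_of_le_of_lt ?_ (hlt (j + 1)))).le
      rw [hvc, hvc]; push_cast at m1 ⊢; linarith
    · rw [← L.A_zero]; apply L.A_mono
      rw [hvc, L.v_zero]; linarith [C.mul_Δ_lt hj]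
    · rw [C.iter_F_A hN, C.iter_F_B hN, C.cut_succ, C.cut_succ]
      have := ih n hs (by omega)
      rw [L.gl_eq (hlt j)] at this; linarith

/-- Pulling back the parts of a base gap to the gaps of the dynamical partition. -/
theorem pull_gap_aux {η : ℝ} (hη : 0 < η) : ∃ c > 0, ∀ n, C.s (n + 1) = 1 →
    η * L.gl (-C.E (n + 1)) 0 ≤ L.w (-C.E (n + 1)) → ∀ (i : ℕ) (m : ℤ), (i : ℤ) < C.Q (n + 2) →
    ∀ u v : ℝ, L.B ((-(i : ℤ), m) - C.E (n + 1)) ≤ u → v ≤ L.A (-(i : ℤ), m) → u < v →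
    η * L.gl (-C.E (n + 1)) 0 ≤ L.F^[i] v - L.F^[i] u →
    c * L.gl ((-(i : ℤ), m) - C.E (n + 1)) (-(i : ℤ), m) ≤ v - u := by
  have hab : 0 < L.b - L.a := by linarith [L.a_lt_b]
  set η' := min η (L.b - L.a)
  have hη' : 0 < η' := lt_min hη hab
  have hκ := L.koebe_pos ((2 : ℕ) : ℝ) hη'
  refine ⟨L.koebe ((2 : ℕ) : ℝ) η' / 2, by positivity, ?_⟩
  intro n hs hw i m hi u v hu hv huv hS
  have v1 := C.v_E_of_s hs
  have d1 := C.Δ_pos (n + 1)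
  set p : Pos := (-(i : ℤ), m) with hp
  set Fl := L.gl (-C.E (n + 1)) 0 with hFl
  have hFl0 : 0 < Fl := C.gl_neg_E_pos (n + 1)
  have hFl1 : Fl ≤ 1 := C.gl_neg_E_le_one (n + 1)
  have hlt : L.v (p - C.E (n + 1)) < L.v p := by rw [L.v_sub]; linarith
  have hsh : p + ((i : ℤ), 0) = 0 + (0, m) := by simp [hp]
  have hsh' : p - C.E (n + 1) + ((i : ℤ), 0) = -C.E (n + 1) + (0, m) := by
    rw [sub_add_eq_add_sub, hsh]; abel
  have eAp : L.F^[i] (L.A p) = L.a + m := by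
    rw [← L.A_add_nat, hsh, L.A_add_int, L.A_zero]
  have eBp : L.F^[i] (L.B p) = L.b + m := by
    rw [← L.B_add_nat, hsh, L.B_add_int, L.B_zero]
  have eAq : L.F^[i] (L.A (p - C.E (n + 1))) = L.A (-C.E (n + 1)) + m := by
    rw [← L.A_add_nat, hsh', L.A_add_int]
  have eBq : L.F^[i] (L.B (p - C.E (n + 1))) = L.B (-C.E (n + 1)) + m := by
    rw [← L.B_add_nat, hsh', L.B_add_int]
  have eFl : Fl = L.a - L.B (-C.E (n + 1)) := by
    rw [hFl, L.gl_eq (by rw [L.v_neg, L.v_zero]; linarith), L.A_zero]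
  have hk : ∀ y₀ y₃ : ℝ, L.A (p - C.E (n + 1)) ≤ y₀ → y₃ ≤ L.B p → ∀ k < i, ∀ m' : ℤ,
      L.b + m' ≤ L.F^[k] y₀ ∨ L.F^[k] y₃ ≤ L.a + m' := by
    intro y₀ y₃ h0 h3 k hk m'
    by_contra hc
    push Not at hc
    obtain ⟨h1, h2⟩ := hc
    rw [← L.A_int] at h2
    rw [← L.B_int] at h1
    have h2' := h2.trans_le (L.iter_mono k h3)
    have h1' := (L.iter_mono k h0).trans_lt h1
    rw [← L.A_add_nat] at h1'
    rw [← L.B_add_nat] at h2'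
    have b1 : L.v (p - C.E (n + 1) + ((k : ℤ), 0)) ≤ L.v (0, m') := by
      by_contra hcc
      exact absurd (L.B_lt_A (not_le.1 hcc)) (not_lt.2 h1'.le)
    have b2 : L.v (0, m') ≤ L.v (p + ((k : ℤ), 0)) := by
      by_contra hcc
      exact absurd (L.B_lt_A (not_le.1 hcc)) (not_lt.2 h2'.le)
    set x : Pos := (-(i : ℤ) + k, m - m')
    have hvx : L.v x = L.v p + L.v ((k : ℤ), 0) - L.v (0, m') := by
      simp [FlatLift.v, x, hp]; ring
    have hx1 : x.1 < 0 := by simp only [x]; omega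
    -- A flat translate inside would give `x` with signed distance between `0` and `Δ (n + 1)`; best
    -- approximation forces `x` to be `E (n + 1)`, whose time is positive whereas that of `x` is
    -- negative.
    have hx := C.le_abs_v (n := n + 1) (p := x) (ne_zero_of_fst (by omega)) (by
      rw [abs_of_neg hx1]
      show -(-(i : ℤ) + k) < C.Q (n + 2)
      omega)
    rw [L.v_add] at b1 b2
    rw [L.v_sub] at b1
    rw [abs_of_nonneg (by linarith)] at hx
    have hxE : L.v x = L.v (C.E (n + 1)) := by linarith
    have := congrArg Prod.fst (L.v_inj hxE)
    have h5 : 1 ≤ (C.E (n + 1)).1 := (C.Q_pos n).1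
    omega
  have hsum : ∀ y₀ y₃ : ℝ, L.A (p - C.E (n + 1)) ≤ y₀ → y₃ ≤ L.B p →
      ∑ k ∈ Finset.range i, (L.F^[k] y₃ - L.F^[k] y₀) ≤ ((2 : ℕ) : ℝ) := by
    intro y₀ y₃ h0 h3
    refine L.sum_iter_le (p := p - C.E (n + 1)) (p' := p + C.E (n + 1)) (e := C.E (n + 1))
      (δ := C.Δ (n + 1)) h0 ?_ (C.Δ_le_one _) (by linarith) v1.le ?_ 2 ?_
    · exact h3.trans (L.B_lt_A (by rw [L.v_add]; linarith)).le
    · intro j hj hj' m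
      refine C.le_abs_nat hj ?_ m
      show (j : ℤ) < C.Q (n + 2)
      omega
    · rw [L.v_add, L.v_sub]; push_cast; linarith
  have hη1 : η' ≤ η := min_le_left _ _
  have hη2 : η' ≤ L.b - L.a := min_le_right _ _
  have hm1 := mul_le_mul_of_nonneg_right hη1 hFl0.le
  have hm2 := mul_le_mul_of_nonneg_right hη2 hFl0.le
  have iu := L.iter_mono i hu
  have iv := L.iter_mono i hv
  have iuv := L.iter_mono i huv.le
  rw [eBq] at iu
  rw [eAp] at iv
  have hAB : L.A p < L.B p := L.A_lt_B (by simp [hp])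
  have hAB' : L.A (p - C.E (n + 1)) < L.B (p - C.E (n + 1)) := L.A_lt_B (by
    have h5 : 1 ≤ (C.E (n + 1)).1 := (C.Q_pos n).1
    simp [hp]; omega)
  -- Two Koebe arguments: with the preimage at `p` as right-hand space, `[u, v]` is a definite part
  -- of what lies to the right of `u`; with the other bounding preimage, of what lies to the left of
  -- `v`. Together these cover the gap, hence the factor `2`.
  have r1 := (L.pull (N := i) hη' huv hv hAB (hk _ _ (hAB'.le.trans hu) le_rfl)
    (hsum _ _ (hAB'.le.trans hu) le_rfl) (by
      rw [eAp]
      have : η' * (L.a + m - L.F^[i] v) ≤ η' * Fl :=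
        mul_le_mul_of_nonneg_left (by linarith) hη'.le
      linarith) (by
      rw [eAp, eBp]
      have : η' * (L.a + m - L.F^[i] v) ≤ η' * Fl :=
        mul_le_mul_of_nonneg_left (by linarith) hη'.le
      nlinarith)).1
  have r2 := (L.pull (N := i) hη' hAB' hu huv (hk _ _ le_rfl (hv.trans hAB.le))
    (hsum _ _ le_rfl (hv.trans hAB.le)) (by
      rw [eAq, eBq]
      have : η' * (L.F^[i] u - (L.B (-C.E (n + 1)) + m)) ≤ η' * Fl :=
        mul_le_mul_of_nonneg_left (by linarith) hη'.le
      rw [FlatLift.w] at hw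
      linarith) (by
      rw [eBq]
      have : η' * (L.F^[i] u - (L.B (-C.E (n + 1)) + m)) ≤ η' * Fl :=
        mul_le_mul_of_nonneg_left (by linarith) hη'.le
      linarith)).2
  rw [L.gl_eq hlt]
  have r3 := mul_pos hκ (sub_pos.2 huv)
  have r4 : L.koebe ((2 : ℕ) : ℝ) η' * (L.A p - u) + L.koebe ((2 : ℕ) : ℝ) η' *
      (v - L.B (p - C.E (n + 1))) = L.koebe ((2 : ℕ) : ℝ) η' * (L.A p - L.B (p - C.E (n + 1))) +
      L.koebe ((2 : ℕ) : ℝ) η' * (v - u) := by ring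
  have r5 : L.koebe ((2 : ℕ) : ℝ) η' * (L.A p - L.B (p - C.E (n + 1))) ≤ 2 * (v - u) := by
    linarith
  rw [div_mul_eq_mul_div, div_le_iff₀ two_pos]
  linarith

/-- The parts into which the gaps of the `n`-th partition are divided by the next partition are
comparable to the gaps. -/
def Split (c : ℝ) (n : ℕ) : Prop := ∀ (i : ℕ) (m : ℤ), (i : ℤ) < C.Q (n + 1) →
  (∀ j : ℕ, 1 ≤ j → j ≤ C.a n → c * L.gl ((-(i : ℤ), m) - C.E n) (-(i : ℤ), m) ≤
    L.w ((-(i : ℤ), m) + C.cut n j)) ∧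
  (∀ j : ℕ, j < C.a n → c * L.gl ((-(i : ℤ), m) - C.E n) (-(i : ℤ), m) ≤
    L.gl ((-(i : ℤ), m) + C.cut n j) ((-(i : ℤ), m) + C.cut n (j + 1))) ∧
  c * L.gl ((-(i : ℤ), m) - C.E n) (-(i : ℤ), m) ≤
    L.gl ((-(i : ℤ), m) - C.E (n + 2)) (-(i : ℤ), m)

theorem Split.mono {C : CF L} {c c' : ℝ} (h : c' ≤ c) {n : ℕ} (hg : C.Split c n) :
    C.Split c' n := by
  intro i m hi
  have hpos : 0 ≤ L.gl ((-(i : ℤ), m) - C.E n) (-(i : ℤ), m) :=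
    (L.gl_pos fun h => C.E_ne_zero n (sub_eq_self.1 h)).le
  have h1 := mul_le_mul_of_nonneg_right h hpos
  obtain ⟨a1, a2, a3⟩ := hg i m hi
  exact ⟨fun j hj hj' => h1.trans (a1 j hj hj'), fun j hj => h1.trans (a2 j hj), h1.trans a3⟩

theorem split_aux {M : ℕ} (hM : ∀ n, C.a n ≤ M) {cB : ℝ} (hcB : 0 < cB) (hB : C.BG cB) :
    ∃ c > 0, ∀ n, C.s (n + 1) = 1 → C.Split c (n + 1) := by
  obtain ⟨cG, hcG, hG⟩ := C.good_all hM
  obtain ⟨c₁, hc₁, h₁⟩ := exists_uniform (P := fun j c => ∀ n, C.s (n + 1) = 1 →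
    j ≤ C.a (n + 1) → c * L.gl (-C.E (n + 1)) 0 ≤ L.w (C.cut (n + 1) j))
    (fun j c c' hcc h n hs hj =>
      (mul_le_mul_of_nonneg_right hcc (C.gl_neg_E_pos _).le).trans (h n hs hj))
    (C.cut_w_aux hcB hB hcG hG) M
  obtain ⟨c₂, hc₂, h₂⟩ := exists_uniform (P := fun j c => ∀ n, C.s (n + 1) = 1 →
    j + 1 ≤ C.a (n + 1) →
    c * L.gl (-C.E (n + 1)) 0 ≤ L.gl (C.cut (n + 1) j) (C.cut (n + 1) (j + 1)))
    (fun j c c' hcc h n hs hj =>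
      (mul_le_mul_of_nonneg_right hcc (C.gl_neg_E_pos _).le).trans (h n hs hj))
    (C.cut_gl_aux hcB hB hcG hG) M
  set η := min (min c₁ c₂) (cB ^ 2) with hηdef
  have hη : 0 < η := lt_min (lt_min hc₁ hc₂) (by positivity)
  have hη1 : η ≤ c₁ := (min_le_left _ _).trans (min_le_left _ _)
  have hη2 : η ≤ c₂ := (min_le_left _ _).trans (min_le_right _ _)
  have hη3 : η ≤ cB ^ 2 := min_le_right _ _
  obtain ⟨c, hc, h⟩ := C.pull_gap_aux hη
  refine ⟨c, hc, fun n hs i m hi => ?_⟩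
  have hle : ∀ {x y : ℝ}, x ≤ y → x * L.gl (-C.E (n + 1)) 0 ≤ y * L.gl (-C.E (n + 1)) 0 :=
    fun hxy => mul_le_mul_of_nonneg_right hxy (C.gl_neg_E_pos _).le
  have hw0 : η * L.gl (-C.E (n + 1)) 0 ≤ L.w (-C.E (n + 1)) := by
    have h3 := h₁ 0 (Nat.zero_le _) n hs (Nat.zero_le _)
    rw [C.cut_zero] at h3
    exact (hle hη1).trans h3
  have key := h n hs hw0 i m hi
  set p : Pos := (-(i : ℤ), m) with hp
  have d2 := C.Δ_pos (n + 1 + 1)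
  have d3 := C.Δ_pos (n + 1 + 2)
  have v1 := C.v_E_of_s hs
  have hvc : ∀ k, L.v (C.cut (n + 1) k) = -C.Δ (n + 1) + k * C.Δ (n + 1 + 1) := by
    intro k; rw [C.v_cut, hs]; ring
  have hlt : ∀ k, L.v (C.cut (n + 1) k) < L.v (C.cut (n + 1) (k + 1)) := by
    intro k; rw [hvc, hvc]; push_cast; linarith
  have hneg : ∀ k, k ≤ C.a (n + 1) → L.v (C.cut (n + 1) k) < 0 := by
    intro k hk; rw [hvc]; linarith [C.mul_Δ_lt hk]
  have hsh : ∀ q : Pos, p + q + ((i : ℤ), 0) = q + (0, m) := by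
    intro q; ext
    · simp [hp]
    · simp [hp, add_comm]
  have iA : ∀ q : Pos, L.F^[i] (L.A (p + q)) = L.A q + m := by
    intro q; rw [← L.A_add_nat, hsh, L.A_add_int]
  have iB : ∀ q : Pos, L.F^[i] (L.B (p + q)) = L.B q + m := by
    intro q; rw [← L.B_add_nat, hsh, L.B_add_int]
  refine ⟨fun j hj hj' => ?_, fun j hj => ?_, ?_⟩
  · refine key _ _ ?_ ?_ (L.A_lt_B (p := p + C.cut (n + 1) j) ?_) ?_
    · refine (L.B_lt_A ?_).le
      have : (1 : ℝ) ≤ j := by exact_mod_cast hj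
      rw [L.v_sub, L.v_add, hvc]
      nlinarith
    · exact (L.B_lt_A (by rw [L.v_add]; linarith [hneg j hj'])).le
    · have := C.cut_fst_nonpos (n + 1) j
      simp [hp]; omega
    · rw [iA, iB]
      have := (hle hη1).trans (h₁ j (hj'.trans (hM _)) n hs hj')
      rw [FlatLift.w] at this; linarith
  · rw [L.gl_eq (p := p + C.cut (n + 1) j) (by rw [L.v_add, L.v_add]; linarith [hlt j])]
    refine key _ _ ?_ ?_ (L.B_lt_A (by rw [L.v_add, L.v_add]; linarith [hlt j])) ?_
    · apply L.B_mono
      rw [L.v_sub, L.v_add, hvc]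
      have : (0 : ℝ) ≤ j * C.Δ (n + 1 + 1) := by positivity
      linarith
    · apply L.A_mono; rw [L.v_add]; linarith [hneg (j + 1) hj]
    · rw [iA, iB]
      have := (hle hη2).trans (h₂ j (hj.le.trans (hM _)) n hs hj)
      rw [L.gl_eq (hlt j)] at this; linarith
  · have e : p - C.E (n + 1 + 2) = p + C.cut (n + 1) (C.a (n + 1)) := by
      rw [C.cut_last]; abel
    have hl := hneg _ (le_refl (C.a (n + 1)))
    rw [e, L.gl_eq (p := p + C.cut (n + 1) (C.a (n + 1))) (by rw [L.v_add]; linarith)]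
    refine key _ _ ?_ le_rfl (L.B_lt_A (by rw [L.v_add]; linarith)) ?_
    · apply L.B_mono
      rw [L.v_sub, L.v_add, hvc]
      have : (0 : ℝ) ≤ C.a (n + 1) * C.Δ (n + 1 + 1) := by positivity
      linarith
    · have h0 := iA 0
      rw [add_zero, L.A_zero] at h0
      rw [iB, h0]
      have := (hle hη3).trans (C.gl_tail hcB hB n)
      rw [show n + 3 = n + 1 + 2 from rfl, ← C.cut_last,
        L.gl_eq (p := C.cut (n + 1) (C.a (n + 1))) (p' := 0) (by rw [L.v_zero]; exact hl),
        L.A_zero] at this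
      linarith

theorem reflect_cut (n j : ℕ) : C.reflect.cut n j = (C.cut n j).refl := by
  unfold cut
  rw [reflect_E, reflect_E, refl_sub, refl_neg, refl_zsmul]

theorem reflect_split (c : ℝ) (n : ℕ) (h : C.reflect.Split c n) : C.Split c n := by
  intro i m hi
  obtain ⟨a1, a2, a3⟩ := h i (-m) hi
  have e : ((-(i : ℤ), -m) : Pos) = Pos.refl (-(i : ℤ), m) := rfl
  refine ⟨fun j hj hj' => ?_, fun j hj => ?_, ?_⟩
  · have := a1 j hj hj'
    rwa [e, reflect_E, reflect_cut, ← refl_sub, ← refl_add, L.reflect_w, L.reflect_gl] at this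
  · have := a2 j hj
    rwa [e, reflect_E, reflect_cut, reflect_cut, ← refl_sub, ← refl_add, ← refl_add,
      L.reflect_gl, L.reflect_gl] at this
  · rwa [e, reflect_E, reflect_E, ← refl_sub, ← refl_sub, L.reflect_gl, L.reflect_gl] at a3

theorem cut_ne (n j : ℕ) : C.cut n j ≠ C.cut n (j + 1) := by
  intro h
  have h1 := C.v_cut n j
  have h2 := C.v_cut n (j + 1)
  rw [h, h2] at h1
  have h3 := C.Δ_pos (n + 1)
  push_cast at h1
  rcases C.s_eq n with hs | hs <;> rw [hs] at h1 <;> linarith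

/-- At level zero there is only one gap up to integer translation, so finitely many positive lengths
are involved. -/
theorem split_zero : ∃ c > 0, C.Split c 0 := by
  obtain ⟨c₁, hc₁, h₁⟩ := exists_uniform (P := fun j c => c ≤ L.w (C.cut 0 j))
    (fun j c c' hcc h => hcc.trans h)
    (fun j => ⟨_, L.w_pos (C.cut_fst_nonpos 0 j), le_rfl⟩) (C.a 0)
  obtain ⟨c₂, hc₂, h₂⟩ := exists_uniform (P := fun j c => c ≤ L.gl (C.cut 0 j) (C.cut 0 (j + 1)))
    (fun j c c' hcc h => hcc.trans h)
    (fun j => ⟨_, L.gl_pos (C.cut_ne 0 j), le_rfl⟩) (C.a 0)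
  have hc₃ := C.gl_neg_E_pos 2
  set c₃ := L.gl (-C.E 2) 0 with hdef
  set c := min (min c₁ c₂) c₃
  have hc : 0 < c := lt_min (lt_min hc₁ hc₂) hc₃
  have hm1 : c ≤ c₁ := (min_le_left _ _).trans (min_le_left _ _)
  have hm2 : c ≤ c₂ := (min_le_left _ _).trans (min_le_right _ _)
  have hm3 : c ≤ c₃ := min_le_right _ _
  refine ⟨c, hc, fun i m hi => ?_⟩
  rw [zero_add, C.Q_one] at hi
  have hi0 : i = 0 := by omega
  subst hi0
  have hp : ∀ q : Pos, ((-((0 : ℕ) : ℤ), m) : Pos) + q = q + (0, m) := by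
    intro q; rw [add_comm]; simp
  have hp0 : ((-((0 : ℕ) : ℤ), m) : Pos) = 0 + (0, m) := by simp
  have hle : c * L.gl ((-((0 : ℕ) : ℤ), m) - C.E 0) (-((0 : ℕ) : ℤ), m) ≤ c := by
    rw [sub_eq_add_neg, hp, hp0, L.gl_add_int]
    have := C.gl_neg_E_le_one 0
    nlinarith
  refine ⟨fun j hj hj' => hle.trans ?_, fun j hj => hle.trans ?_, hle.trans ?_⟩
  · rw [hp, L.w_add_int]; exact hm1.trans (h₁ j hj')
  · rw [hp, hp, L.gl_add_int]; exact hm2.trans (h₂ j hj.le)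
  · rw [sub_eq_add_neg, hp, hp0, L.gl_add_int]; exact hm3

theorem reflect_BG {c : ℝ} (h : C.BG c) : C.reflect.BG c := by
  intro n
  rw [reflect_E, reflect_E, ← refl_zero, L.reflect_gl, L.reflect_gl]
  exact h n

theorem split_all {M : ℕ} (hM : ∀ n, C.a n ≤ M) {cB : ℝ} (hcB : 0 < cB) (hB : C.BG cB) :
    ∃ c > 0, ∀ n, C.Split c n := by
  obtain ⟨c₀, h0, g0⟩ := C.split_zero
  obtain ⟨c₁, h1, g1⟩ := C.split_aux hM hcB hB
  obtain ⟨c₂, h2, g2⟩ := C.reflect.split_aux hM hcB (C.reflect_BG hB)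
  refine ⟨min c₀ (min c₁ c₂), lt_min h0 (lt_min h1 h2), fun n => ?_⟩
  rcases n with _ | n
  · exact g0.mono (min_le_left _ _)
  · rcases C.s_eq (n + 1) with hs | hs
    · exact (g1 n hs).mono ((min_le_right _ _).trans (min_le_left _ _))
    · exact (C.reflect_split _ _ (g2 n (by rw [reflect_s, hs, neg_neg]))).mono
        ((min_le_right _ _).trans (min_le_right _ _))

end CF

/-! ### Cross-ratio distortion of power-like maps -/

/-- A function on `[b, c]` whose derivative is `((x - b) (c - x)) ^ κ`, up to a positive factor
with a Lipschitz logarithm `u`. -/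
structure PowerLike (F u : ℝ → ℝ) (b c κ Λ : ℝ) : Prop where
  lt : b < c
  κ_nonneg : 0 ≤ κ
  Λ_nonneg : 0 ≤ Λ
  cont : ContinuousOn F (Icc b c)
  deriv : ∀ x ∈ Ioo b c,
    HasDerivAt F (Real.exp (u x + κ * (Real.log (x - b) + Real.log (c - x)))) x
  lip : ∀ x ∈ Ioo b c, ∀ y ∈ Ioo b c, |u x - u y| ≤ Λ * |x - y|

namespace PowerLike

variable {F u : ℝ → ℝ} {b c κ Λ : ℝ}

theorem reflect (h : PowerLike F u b c κ Λ) :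
    PowerLike (fun x => -F (-x)) (fun x => u (-x)) (-c) (-b) κ Λ where
  lt := neg_lt_neg h.lt
  κ_nonneg := h.κ_nonneg
  Λ_nonneg := h.Λ_nonneg
  cont := by
    refine (h.cont.comp continuous_neg.continuousOn fun x hx => ?_).neg
    exact ⟨by linarith [hx.2], by linarith [hx.1]⟩
  deriv x hx := by
    have h1 := h.deriv (-x) ⟨by linarith [hx.2], by linarith [hx.1]⟩
    have h2 := (h1.comp x (hasDerivAt_neg x)).neg
    have e : -(Real.exp (u (-x) + κ * (Real.log (-x - b) + Real.log (c - -x))) * -1) =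
        Real.exp (u (-x) + κ * (Real.log (x - -c) + Real.log (-b - x))) := by
      rw [show x - -c = c - -x by ring, show -b - x = -x - b by ring]; ring_nf
    rw [e] at h2
    exact h2
  lip x hx y hy := by
    have := h.lip (-x) ⟨by linarith [hx.2], by linarith [hx.1]⟩ (-y)
      ⟨by linarith [hy.2], by linarith [hy.1]⟩
    rwa [show -x - -y = -(x - y) by ring, abs_neg] at this

theorem strictMonoOn (h : PowerLike F u b c κ Λ) : StrictMonoOn F (Icc b c) := by
  refine strictMonoOn_of_deriv_pos (convex_Icc b c) h.cont fun x hx => ?_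
  rw [interior_Icc] at hx
  rw [(h.deriv x hx).deriv]
  exact Real.exp_pos _

theorem exists_slope (h : PowerLike F u b c κ Λ) {s t : ℝ} (hs : b ≤ s) (hst : s < t)
    (ht : t ≤ c) : ∃ ξ ∈ Ioo s t,
      F t - F s = Real.exp (u ξ + κ * (Real.log (ξ - b) + Real.log (c - ξ))) * (t - s) := by
  obtain ⟨ξ, hξ, e⟩ := exists_hasDerivAt_eq_slope F
    (fun x => Real.exp (u x + κ * (Real.log (x - b) + Real.log (c - x)))) hst
    (h.cont.mono (Icc_subset_Icc hs ht))
    (fun x hx => h.deriv x ⟨hs.trans_lt hx.1, hx.2.trans_le ht⟩)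
  refine ⟨ξ, hξ, ?_⟩
  have : t - s ≠ 0 := (sub_pos.2 hst).ne'
  rw [e]; field_simp

/-- The slope anywhere in `[b, y]` is at most a constant times a slope in the second quarter of `[b,
y]`: there the factor `x - b` has lost at most `4` and `c - x` at most `2`, whence `log 8`. -/
theorem pow_left (h : PowerLike F u b c κ Λ) (h1 : c - b ≤ 1) {s t y : ℝ} (hs : b ≤ s)
    (hst : s ≤ t) (hty : t ≤ y) (hy : y ≤ c) :
    (F t - F s) * (y - b) ≤ 4 * Real.exp (Λ + κ * Real.log 8) * (F y - F b) * (t - s) := by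
  rcases hst.eq_or_lt with rfl | hst
  · simp
  have hby : b < y := by linarith
  obtain ⟨ξ, hξ, e⟩ := h.exists_slope hs hst (hty.trans hy)
  obtain ⟨ζ, hζ, e'⟩ := h.exists_slope (s := b + (y - b) / 4) (t := b + (y - b) / 2)
    (by linarith) (by linarith) (by linarith)
  have hm := h.strictMonoOn.monotoneOn
  have m1 : F b ≤ F (b + (y - b) / 4) := hm ⟨le_rfl, h.lt.le⟩ ⟨by linarith, by linarith⟩ (by linarith)
  have m2 : F (b + (y - b) / 2) ≤ F y := hm ⟨by linarith, by linarith⟩ ⟨by linarith, by linarith⟩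
    (by linarith)
  obtain ⟨ξ1, ξ2⟩ := hξ
  obtain ⟨ζ1, ζ2⟩ := hζ
  have l1 : Real.log (ξ - b) ≤ Real.log (ζ - b) + Real.log 4 := by
    rw [← Real.log_mul (by linarith) (by norm_num)]
    exact Real.log_le_log (by linarith) (by linarith)
  have l2 : Real.log (c - ξ) ≤ Real.log (c - ζ) + Real.log 2 := by
    rw [← Real.log_mul (by linarith) (by norm_num)]
    exact Real.log_le_log (by linarith) (by linarith)
  have l3 : Real.log 8 = Real.log 4 + Real.log 2 := by
    rw [← Real.log_mul (by norm_num) (by norm_num)]; norm_num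
  have l4 : u ξ - u ζ ≤ Λ := by
    have a1 := (le_abs_self _).trans (h.lip ξ ⟨by linarith, by linarith⟩ ζ ⟨by linarith, by linarith⟩)
    have a2 : |ξ - ζ| ≤ 1 := by rw [abs_le]; constructor <;> linarith
    nlinarith [h.Λ_nonneg]
  have key : Real.exp (u ξ + κ * (Real.log (ξ - b) + Real.log (c - ξ))) ≤
      Real.exp (Λ + κ * Real.log 8) *
        Real.exp (u ζ + κ * (Real.log (ζ - b) + Real.log (c - ζ))) := by
    rw [← Real.exp_add]
    apply Real.exp_le_exp.2
    have := mul_le_mul_of_nonneg_left (add_le_add l1 l2) h.κ_nonneg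
    rw [l3]; linarith
  rw [e]
  have e2 : Real.exp (u ζ + κ * (Real.log (ζ - b) + Real.log (c - ζ))) * (y - b) ≤
      4 * (F y - F b) := by
    have : b + (y - b) / 2 - (b + (y - b) / 4) = (y - b) / 4 := by ring
    rw [this] at e'
    linarith
  have e3 := mul_le_mul_of_nonneg_right key (by linarith : 0 ≤ y - b)
  have e4 := mul_le_mul_of_nonneg_left e2 (Real.exp_pos (Λ + κ * Real.log 8)).le
  have e5 : Real.exp (u ξ + κ * (Real.log (ξ - b) + Real.log (c - ξ))) * (y - b) ≤
      4 * Real.exp (Λ + κ * Real.log 8) * (F y - F b) := by linarith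
  have := mul_le_mul_of_nonneg_right e5 (by linarith : 0 ≤ t - s)
  linarith

theorem pow_right (h : PowerLike F u b c κ Λ) (h1 : c - b ≤ 1) {y s t : ℝ} (hy : b ≤ y)
    (hys : y ≤ s) (hst : s ≤ t) (ht : t ≤ c) :
    (F t - F s) * (c - y) ≤ 4 * Real.exp (Λ + κ * Real.log 8) * (F c - F y) * (t - s) := by
  have := h.reflect.pow_left (by linarith) (s := -t) (t := -s) (y := -y) (by linarith)
    (by linarith) (by linarith) (by linarith)
  simp only [neg_neg] at this
  rw [show -F s - -F t = F t - F s by ring, show -y - -c = c - y by ring,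
    show -F y - -F c = F c - F y by ring, show -s - -t = t - s by ring] at this
  exact this

/-- This function is the derivative to the power `-1/2` without the Lipschitz factor. Its convexity
expresses a non-positive Schwarzian derivative. -/
theorem convexOn_exp_log {b c κ : ℝ} (hκ : 0 ≤ κ) :
    ConvexOn ℝ (Ioo b c)
      (fun x => Real.exp (-(κ / 2) * (Real.log (x - b) + Real.log (c - x)))) := by
  have hl := strictConcaveOn_log_Ioi.concaveOn
  have h1 : ConvexOn ℝ (Ioo b c)
      (fun x => -(κ / 2) * (Real.log (x - b) + Real.log (c - x))) := by
    refine ⟨convex_Ioo b c, fun x hx y hy p q hp hq hpq => ?_⟩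
    have a1 := hl.2 (x := x - b) (y := y - b) (by simpa using hx.1) (by simpa using hy.1) hp hq hpq
    have a2 := hl.2 (x := c - x) (y := c - y) (by simpa using hx.2) (by simpa using hy.2) hp hq hpq
    simp only [smul_eq_mul] at *
    have e1 : p * (x - b) + q * (y - b) = p * x + q * y - b := by
      linear_combination (-b) * hpq
    have e2 : p * (c - x) + q * (c - y) = c - (p * x + q * y) := by
      linear_combination c * hpq
    rw [e1] at a1
    rw [e2] at a2
    have := mul_le_mul_of_nonneg_left (add_le_add a1 a2) (by linarith : 0 ≤ κ / 2)
    linarith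
  exact ⟨convex_Ioo b c, fun x hx y hy p q hp hq hpq =>
    (Real.exp_le_exp.2 (h1.2 hx hy hp hq hpq)).trans
      (convexOn_exp.2 (mem_univ _) (mem_univ _) hp hq hpq)⟩

/-- The increment of `F`, compared with the increment of a Möbius map. -/
theorem exists_moebius (h : PowerLike F u b c κ Λ) {s t p q : ℝ} (hs : b ≤ s) (hst : s < t)
    (ht : t ≤ c) (hps : 0 < p + q * s) (hpt : 0 < p + q * t) : ∃ ξ ∈ Ioo s t,
      F t - F s = (t - s) / ((p + q * s) * (p + q * t)) *
        (Real.exp (u ξ) * ((p + q * ξ) /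
          Real.exp (-(κ / 2) * (Real.log (ξ - b) + Real.log (c - ξ)))) ^ 2) := by
  have hl : ∀ x ∈ Icc s t, 0 < p + q * x := by
    intro x hx
    rcases le_total 0 q with hq | hq
    · nlinarith [mul_le_mul_of_nonneg_left hx.1 hq]
    · nlinarith [mul_le_mul_of_nonpos_left hx.2 hq]
  obtain ⟨ξ, hξ, e⟩ := exists_ratio_hasDerivAt_eq_ratio_slope F
    (fun x => Real.exp (u x + κ * (Real.log (x - b) + Real.log (c - x)))) hst
    (h.cont.mono (Icc_subset_Icc hs ht))
    (fun x hx => h.deriv x ⟨hs.trans_lt hx.1, hx.2.trans_le ht⟩)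
    (fun x => (x - s) / ((p + q * s) * (p + q * x))) (fun x => 1 / (p + q * x) ^ 2)
    (by
      refine ContinuousOn.div (by fun_prop) (by fun_prop) fun x hx => ?_
      exact (mul_pos hps (hl x hx)).ne')
    (by
      intro x hx
      have hx' := hl x ⟨hx.1.le, hx.2.le⟩
      have d1 : HasDerivAt (fun x => x - s) 1 x := (hasDerivAt_id x).sub_const s
      have d2 : HasDerivAt (fun x => (p + q * s) * (p + q * x)) ((p + q * s) * q) x := by
        have := (((hasDerivAt_id x).const_mul q).const_add p).const_mul (p + q * s)
        simpa using this
      have d3 := d1.div d2 (mul_pos hps hx').ne'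
      refine d3.congr_deriv ?_
      field_simp
      ring)
  have hξ' := hl ξ ⟨hξ.1.le, hξ.2.le⟩
  refine ⟨ξ, hξ, ?_⟩
  simp only [sub_self, zero_div, sub_zero] at e
  have e1 : Real.exp (u ξ + κ * (Real.log (ξ - b) + Real.log (c - ξ))) =
      Real.exp (u ξ) / Real.exp (-(κ / 2) * (Real.log (ξ - b) + Real.log (c - ξ))) ^ 2 := by
    rw [← Real.exp_nat_mul, ← Real.exp_sub]
    congr 1; push_cast; ring
  rw [e1] at e
  have hne := (Real.exp_pos (-(κ / 2) * (Real.log (ξ - b) + Real.log (c - ξ)))).ne'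
  set W := Real.exp (-(κ / 2) * (Real.log (ξ - b) + Real.log (c - ξ)))
  rw [div_pow, ← mul_div_assoc (Real.exp (u ξ)), mul_div_right_comm, ← mul_assoc, e]
  field_simp

/-- Comparison with a Möbius map whose derivative is the inverse square of an affine function, with
values `l₀, l₁, l₂, l₃` at the four points. The identity `h5` splits `l + m + r` to match the three
terms of `M (L + M + R)`. If the affine function is non-positive at an outer point, one term alone
suffices. -/
theorem crossRatio_algebra {l m r l₀ q θ L M R : ℝ} (hl : 0 < l) (hm : 0 < m) (hr : 0 < r)
    (hθ : 0 < θ) (hθ1 : θ ≤ 1) (hL : 0 < L) (hM : 0 < M) (hR : 0 < R)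
    (h1 : 0 < l₀ + q * l) (h2 : 0 < l₀ + q * (l + m))
    (hM' : θ * (m / ((l₀ + q * l) * (l₀ + q * (l + m)))) ≤ M)
    (hL' : 0 < l₀ → θ * L ≤ l / (l₀ * (l₀ + q * l)))
    (hR' : 0 < l₀ + q * (l + m + r) →
      θ * R ≤ r / ((l₀ + q * (l + m)) * (l₀ + q * (l + m + r)))) :
    θ ^ 4 * (m * (l + m + r) * (L * R)) ≤ M * (L + M + R) * (l * r) := by
  set l₁ := l₀ + q * l with hl₁
  set l₂ := l₀ + q * (l + m) with hl₂
  set l₃ := l₀ + q * (l + m + r) with hl₃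
  have hθ2 : θ ^ 4 ≤ θ ^ 2 := pow_le_pow_of_le_one hθ.le hθ1 (by norm_num)
  have hp : 0 < m * (L * R) := by positivity
  have hM0 : 0 < θ * (m / (l₁ * l₂)) := by positivity
  have a1 : 0 < l₃ → θ ^ 2 * (m * (L * R)) * (l * l₃ / l₁) ≤ M * L * (l * r) := by
    intro h3
    have b1 := hR' h3
    rw [le_div_iff₀ (by positivity)] at b1
    calc θ ^ 2 * (m * (L * R)) * (l * l₃ / l₁)
        = θ * (m / (l₁ * l₂)) * (L * l) * (θ * R * (l₂ * l₃)) := by field_simp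
      _ ≤ M * (L * l) * r := by gcongr
      _ = _ := by ring
  have a3 : 0 < l₀ → θ ^ 2 * (m * (L * R)) * (r * l₀ / l₂) ≤ M * R * (l * r) := by
    intro h0
    have b1 := hL' h0
    rw [le_div_iff₀ (by positivity)] at b1
    calc θ ^ 2 * (m * (L * R)) * (r * l₀ / l₂)
        = θ * (m / (l₁ * l₂)) * (R * r) * (θ * L * (l₀ * l₁)) := by field_simp
      _ ≤ M * (R * r) * l := by gcongr
      _ = _ := by ring
  have p1 : 0 < M * L * (l * r) := by positivity
  have p2 : 0 < M * M * (l * r) := by positivity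
  have p3 : 0 < M * R * (l * r) := by positivity
  have e : M * (L + M + R) * (l * r) = M * L * (l * r) + M * M * (l * r) + M * R * (l * r) := by
    ring
  rw [e]
  rcases le_or_gt l₀ 0 with h0 | h0
  · have h3 : 0 < l₃ := by nlinarith
    have h4 : l + m + r ≤ l * l₃ / l₁ := by
      rw [le_div_iff₀ h1]
      have : l * l₃ - (l + m + r) * l₁ = -(l₀ * (m + r)) := by rw [hl₃, hl₁]; ring
      nlinarith
    calc θ ^ 4 * (m * (l + m + r) * (L * R)) = θ ^ 4 * (m * (L * R)) * (l + m + r) := by ring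
      _ ≤ θ ^ 2 * (m * (L * R)) * (l * l₃ / l₁) := by gcongr
      _ ≤ _ := by linarith [a1 h3]
  rcases le_or_gt l₃ 0 with h3 | h3
  · have h4 : l + m + r ≤ r * l₀ / l₂ := by
      rw [le_div_iff₀ h2]
      have : r * l₀ - (l + m + r) * l₂ = -(l₃ * (l + m)) := by rw [hl₃, hl₂]; ring
      nlinarith
    calc θ ^ 4 * (m * (l + m + r) * (L * R)) = θ ^ 4 * (m * (L * R)) * (l + m + r) := by ring
      _ ≤ θ ^ 2 * (m * (L * R)) * (r * l₀ / l₂) := by gcongr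
      _ ≤ _ := by linarith [a3 h0]
  have a2 : θ ^ 4 * (m * (L * R)) * (m * (l₀ * l₃) / (l₁ * l₂)) ≤ M * M * (l * r) := by
    have b1 := hL' h0
    have b2 := hR' h3
    rw [le_div_iff₀ (by positivity)] at b1 b2
    calc θ ^ 4 * (m * (L * R)) * (m * (l₀ * l₃) / (l₁ * l₂))
        = θ * (m / (l₁ * l₂)) * (θ * (m / (l₁ * l₂))) *
          (θ * L * (l₀ * l₁) * (θ * R * (l₂ * l₃))) := by field_simp
      _ ≤ M * M * (l * r) := by gcongr
  have h5 : l + m + r = l * l₃ / l₁ + r * l₀ / l₂ + m * (l₀ * l₃) / (l₁ * l₂) := by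
    field_simp
    rw [hl₁, hl₂, hl₃]; ring
  have a1' := a1 h3
  have a3' := a3 h0
  have c1 : θ ^ 4 * (m * (L * R)) * (l * l₃ / l₁) ≤ θ ^ 2 * (m * (L * R)) * (l * l₃ / l₁) := by
    gcongr
  have c3 : θ ^ 4 * (m * (L * R)) * (r * l₀ / l₂) ≤ θ ^ 2 * (m * (L * R)) * (r * l₀ / l₂) := by
    gcongr
  calc θ ^ 4 * (m * (l + m + r) * (L * R)) = θ ^ 4 * (m * (L * R)) * (l + m + r) := by ring
    _ = θ ^ 4 * (m * (L * R)) * (l * l₃ / l₁) + θ ^ 4 * (m * (L * R)) * (r * l₀ / l₂) +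
        θ ^ 4 * (m * (L * R)) * (m * (l₀ * l₃) / (l₁ * l₂)) := by rw [h5]; ring
    _ ≤ _ := by linarith

set_option maxHeartbeats 1000000 in
/-- Cross-ratios are increased at most by a factor that depends on the length. -/
theorem crossRatio_le (h : PowerLike F u b c κ Λ) {y₀ y₁ y₂ y₃ : ℝ} (h0 : b ≤ y₀) (h01 : y₀ < y₁)
    (h12 : y₁ ≤ y₂) (h23 : y₂ < y₃) (h3 : y₃ ≤ c) :
    crossRatio (F y₀) (F y₁) (F y₂) (F y₃) ≤
      Real.exp (4 * Λ * (y₃ - y₀)) * crossRatio y₀ y₁ y₂ y₃ := by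
  have hF := h.strictMonoOn
  have i0 : y₀ ∈ Icc b c := ⟨h0, by linarith⟩
  have i1 : y₁ ∈ Icc b c := ⟨by linarith, by linarith⟩
  have i2 : y₂ ∈ Icc b c := ⟨by linarith, by linarith⟩
  have i3 : y₃ ∈ Icc b c := ⟨by linarith, h3⟩
  have hL := sub_pos.2 (hF i0 i1 h01)
  have hR := sub_pos.2 (hF i2 i3 h23)
  have he : 1 ≤ Real.exp (4 * Λ * (y₃ - y₀)) := by
    apply Real.one_le_exp
    have := h.Λ_nonneg
    have : 0 ≤ y₃ - y₀ := by linarith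
    positivity
  rcases h12.eq_or_lt with rfl | h12
  · have c1 : ∀ {x y z : ℝ}, x < y → y < z → crossRatio x y y z = 1 := by
      intro x y z hxy hyz
      exact div_self (mul_pos (sub_pos.2 hxy) (sub_pos.2 hyz)).ne'
    rw [c1 h01 h23, c1 (hF i0 i1 h01) (hF i1 i3 h23), mul_one]
    exact he
  have hM := sub_pos.2 (hF i1 i2 h12)
  set W : ℝ → ℝ := fun x => Real.exp (-(κ / 2) * (Real.log (x - b) + Real.log (c - x))) with hW
  have hWpos : ∀ x, 0 < W x := fun x => Real.exp_pos _
  have hconv : ConvexOn ℝ (Ioo b c) W := convexOn_exp_log h.κ_nonneg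
  have j1 : y₁ ∈ Ioo b c := ⟨by linarith, by linarith⟩
  have j2 : y₂ ∈ Ioo b c := ⟨by linarith, by linarith⟩
  -- `p + q x` is the chord of the convex `W` over `[y₁, y₂]`: above `W` inside, below it outside.
  -- The associated Möbius map therefore moves less than `F` in the middle and, where the chord is
  -- positive, more at the sides, up to the Lipschitz factor.
  set q := (W y₂ - W y₁) / (y₂ - y₁) with hq
  have hq' : q * (y₂ - y₁) = W y₂ - W y₁ := div_mul_cancel₀ _ (by linarith)
  set p := W y₁ - q * y₁ with hp
  have e1 : p + q * y₁ = W y₁ := by rw [hp]; ring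
  have e2 : p + q * y₂ = W y₂ := by rw [hp]; linarith
  have wL : ∀ x ∈ Ioo y₀ y₁, p + q * x ≤ W x := by
    intro x hx
    have := hconv.slope_mono_adjacent (x := x) (y := y₁) (z := y₂) ⟨by linarith [hx.1], by linarith [hx.2]⟩
      j2 hx.2 h12
    rw [← hq, div_le_iff₀ (by linarith [hx.2])] at this
    rw [hp]; linarith
  have wR : ∀ x ∈ Ioo y₂ y₃, p + q * x ≤ W x := by
    intro x hx
    have := hconv.slope_mono_adjacent (x := y₁) (y := y₂) (z := x) j1
      ⟨by linarith [hx.1], by linarith [hx.2]⟩ h12 hx.1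
    rw [← hq, le_div_iff₀ (by linarith [hx.1])] at this
    linarith
  have wM : ∀ x ∈ Ioo y₁ y₂, W x ≤ p + q * x := by
    intro x hx
    have := hconv.slope_mono_adjacent (x := y₁) (y := x) (z := y₂) j1 j2 hx.1 hx.2
    rw [div_le_div_iff₀ (by linarith [hx.1]) (by linarith [hx.2])] at this
    have e : (p + q * x - W x) * (y₂ - y₁) =
        (W y₂ - W x) * (x - y₁) - (W x - W y₁) * (y₂ - x) := by
      rw [hp]; linear_combination (x - y₁) * hq'
    have h5 : 0 ≤ (p + q * x - W x) * (y₂ - y₁) := by rw [e]; linarith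
    have := nonneg_of_mul_nonneg_left h5 (by linarith)
    linarith
  set α := Real.exp (u y₁) with hα
  have hαpos : 0 < α := Real.exp_pos _
  set θ := Real.exp (-(Λ * (y₃ - y₀))) with hθ
  have hθpos : 0 < θ := Real.exp_pos _
  have hθ1 : θ ≤ 1 := by
    rw [hθ, Real.exp_le_one_iff]
    have := h.Λ_nonneg
    have : 0 ≤ y₃ - y₀ := by linarith
    have : 0 ≤ Λ * (y₃ - y₀) := by positivity
    linarith
  have hu : ∀ x ∈ Ioo y₀ y₃, |u x - u y₁| ≤ Λ * (y₃ - y₀) := by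
    intro x hx
    refine (h.lip x ⟨by linarith [hx.1], by linarith [hx.2]⟩ y₁ j1).trans ?_
    refine mul_le_mul_of_nonneg_left ?_ h.Λ_nonneg
    rw [abs_le]; constructor <;> linarith [hx.1, hx.2]
  have hu1 : ∀ x ∈ Ioo y₀ y₃, θ * Real.exp (u x) ≤ α := by
    intro x hx
    rw [hθ, hα, ← Real.exp_add]
    apply Real.exp_le_exp.2
    linarith [(abs_le.1 (hu x hx)).2]
  have hu2 : ∀ x ∈ Ioo y₀ y₃, θ * α ≤ Real.exp (u x) := by
    intro x hx
    rw [hθ, hα, ← Real.exp_add]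
    apply Real.exp_le_exp.2
    linarith [(abs_le.1 (hu x hx)).1]
  have pos1 : 0 < p + q * y₁ := e1 ▸ hWpos _
  have pos2 : 0 < p + q * y₂ := e2 ▸ hWpos _
  have up : ∀ s t : ℝ, b ≤ s → s < t → t ≤ c → y₀ ≤ s → t ≤ y₃ → 0 < p + q * s → 0 < p + q * t →
      (∀ x ∈ Ioo s t, p + q * x ≤ W x) →
      θ * ((F t - F s) / α) ≤ (t - s) / ((p + q * s) * (p + q * t)) := by
    intro s t hs hst ht hs' ht' hps hpt hw
    obtain ⟨ξ, hξ, e⟩ := h.exists_moebius hs hst ht hps hpt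
    have hlξ : 0 ≤ p + q * ξ := by
      rcases le_total 0 q with hq | hq
      · nlinarith [mul_le_mul_of_nonneg_left hξ.1.le hq]
      · nlinarith [mul_le_mul_of_nonpos_left hξ.2.le hq]
    have k1 : ((p + q * ξ) / W ξ) ^ 2 ≤ 1 :=
      pow_le_one₀ (div_nonneg hlξ (hWpos _).le) ((div_le_one (hWpos _)).2 (hw ξ hξ))
    have k2 := hu1 ξ ⟨by linarith [hξ.1], by linarith [hξ.2]⟩
    rw [e, ← mul_div_assoc, div_le_iff₀ hαpos]
    have hX : 0 ≤ (t - s) / ((p + q * s) * (p + q * t)) :=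
      div_nonneg (by linarith) (mul_pos hps hpt).le
    calc θ * ((t - s) / ((p + q * s) * (p + q * t)) *
          (Real.exp (u ξ) * ((p + q * ξ) / W ξ) ^ 2))
        = (t - s) / ((p + q * s) * (p + q * t)) *
          (θ * Real.exp (u ξ) * ((p + q * ξ) / W ξ) ^ 2) := by ring
      _ ≤ (t - s) / ((p + q * s) * (p + q * t)) * (α * 1) := by gcongr
      _ = _ := by ring
  have low : θ * ((y₂ - y₁) / ((p + q * y₁) * (p + q * y₂))) ≤ (F y₂ - F y₁) / α := by
    obtain ⟨ξ, hξ, e⟩ := h.exists_moebius i1.1 h12 i2.2 pos1 pos2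
    have k1 : 1 ≤ ((p + q * ξ) / W ξ) ^ 2 :=
      one_le_pow₀ ((one_le_div (hWpos _)).2 (wM ξ hξ))
    have k2 := hu2 ξ ⟨by linarith [hξ.1], by linarith [hξ.2]⟩
    rw [e, le_div_iff₀ hαpos]
    have hX : 0 ≤ (y₂ - y₁) / ((p + q * y₁) * (p + q * y₂)) :=
      div_nonneg (by linarith) (mul_pos pos1 pos2).le
    calc θ * ((y₂ - y₁) / ((p + q * y₁) * (p + q * y₂))) * α
        = (y₂ - y₁) / ((p + q * y₁) * (p + q * y₂)) * (θ * α * 1) := by ring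
      _ ≤ (y₂ - y₁) / ((p + q * y₁) * (p + q * y₂)) *
          (Real.exp (u ξ) * ((p + q * ξ) / W ξ) ^ 2) := by gcongr
  have l1 : p + q * y₀ + q * (y₁ - y₀) = p + q * y₁ := by ring
  have l2 : p + q * y₀ + q * (y₁ - y₀ + (y₂ - y₁)) = p + q * y₂ := by ring
  have l3 : p + q * y₀ + q * (y₁ - y₀ + (y₂ - y₁) + (y₃ - y₂)) = p + q * y₃ := by ring
  have alg := crossRatio_algebra (l := y₁ - y₀) (m := y₂ - y₁) (r := y₃ - y₂) (l₀ := p + q * y₀)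
    (q := q) (θ := θ) (L := (F y₁ - F y₀) / α) (M := (F y₂ - F y₁) / α) (R := (F y₃ - F y₂) / α)
    (by linarith) (by linarith) (by linarith) hθpos hθ1 (by positivity) (by positivity)
    (by positivity) (by rw [l1]; exact pos1) (by rw [l2]; exact pos2) (by rw [l1, l2]; exact low)
    (by
      intro hl; rw [l1]
      exact up y₀ y₁ h0 h01 i1.2 le_rfl (by linarith) hl pos1 wL)
    (by
      rw [l2, l3]; intro hl
      exact up y₂ y₃ i2.1 h23 h3 (by linarith) le_rfl pos2 hl wR)
  have hθ4 : Real.exp (4 * Λ * (y₃ - y₀)) * θ ^ 4 = 1 := by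
    rw [hθ, ← Real.exp_nat_mul, ← Real.exp_add]
    rw [show 4 * Λ * (y₃ - y₀) + ((4 : ℕ) : ℝ) * -(Λ * (y₃ - y₀)) = 0 by push_cast; ring,
      Real.exp_zero]
  have alg' : θ ^ 4 * ((y₂ - y₁) * (y₃ - y₀) * ((F y₁ - F y₀) * (F y₃ - F y₂))) ≤
      (F y₂ - F y₁) * (F y₃ - F y₀) * ((y₁ - y₀) * (y₃ - y₂)) := by
    have k := mul_le_mul_of_nonneg_right alg (sq_nonneg α)
    have k1 : θ ^ 4 * ((y₂ - y₁) * (y₁ - y₀ + (y₂ - y₁) + (y₃ - y₂)) *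
        ((F y₁ - F y₀) / α * ((F y₃ - F y₂) / α))) * α ^ 2 =
        θ ^ 4 * ((y₂ - y₁) * (y₃ - y₀) * ((F y₁ - F y₀) * (F y₃ - F y₂))) := by
      field_simp; ring
    have k2 : (F y₂ - F y₁) / α * ((F y₁ - F y₀) / α + (F y₂ - F y₁) / α + (F y₃ - F y₂) / α) *
        ((y₁ - y₀) * (y₃ - y₂)) * α ^ 2 =
        (F y₂ - F y₁) * (F y₃ - F y₀) * ((y₁ - y₀) * (y₃ - y₂)) := by
      field_simp; ring
    rw [k1, k2] at k
    exact k
  have ex := Real.exp_pos (4 * Λ * (y₃ - y₀))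
  set X := Real.exp (4 * Λ * (y₃ - y₀))
  have fin : (y₂ - y₁) * (y₃ - y₀) * ((F y₁ - F y₀) * (F y₃ - F y₂)) ≤
      X * ((F y₂ - F y₁) * (F y₃ - F y₀) * ((y₁ - y₀) * (y₃ - y₂))) := by
    have := mul_le_mul_of_nonneg_left alg' ex.le
    rwa [← mul_assoc X, hθ4, one_mul] at this
  have d1 : 0 < (F y₂ - F y₀) * (F y₃ - F y₁) := mul_pos (by linarith) (by linarith)
  have d2 : 0 < (y₂ - y₀) * (y₃ - y₁) := mul_pos (by linarith) (by linarith)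
  unfold crossRatio
  rw [← mul_div_assoc, div_le_div_iff₀ d1 d2]
  have g1 : (y₂ - y₀) * (y₃ - y₁) = (y₁ - y₀) * (y₃ - y₂) + (y₂ - y₁) * (y₃ - y₀) := by ring
  have g2 : (F y₂ - F y₀) * (F y₃ - F y₁) =
      (F y₁ - F y₀) * (F y₃ - F y₂) + (F y₂ - F y₁) * (F y₃ - F y₀) := by ring
  rw [g1, g2]
  have d3 : 0 ≤ (F y₁ - F y₀) * (F y₃ - F y₂) * ((y₁ - y₀) * (y₃ - y₂)) := by
    have := mul_pos hL hR
    have := mul_pos (sub_pos.2 h01) (sub_pos.2 h23)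
    positivity
  nlinarith [mul_le_mul_of_nonneg_right he d3]

end PowerLike

/-! ### From the local normal form to power-like lifts -/

/-- A function with zero derivative at `0` that is a local diffeomorphism after a power: the power
is larger than one, and the derivative is a power up to a factor with smooth logarithm. -/
theorem log_deriv_of_power {φ h : ℝ → ℝ} {ℓ ε : ℝ} (hℓ : 0 < ℓ) (hε : 0 < ε)
    (hh : ContDiffOn ℝ 2 h (Ioo (-ε) ε)) (hne : ∀ t ∈ Ioo (-ε) ε, deriv h t ≠ 0)
    (heq : ∀ᶠ t in 𝓝[≥] 0, φ t = h (t ^ ℓ)) (hd : HasDerivAt φ 0 0) :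
    1 < ℓ ∧ ∃ D : ℝ → ℝ, ContDiffAt ℝ 1 D 0 ∧
      ∀ᶠ t in 𝓝[>] 0, Real.log (deriv φ t) = D t + (ℓ - 1) * Real.log t := by
  have hmem : (0 : ℝ) ∈ Ioo (-ε) ε := ⟨by linarith, hε⟩
  have hdiff : ∀ t ∈ Ioo (-ε) ε, HasDerivAt h (deriv h t) t := fun t ht =>
    ((hh.contDiffAt (Ioo_mem_nhds ht.1 ht.2)).differentiableAt (by norm_num)).hasDerivAt
  have htend : Tendsto (fun t : ℝ => t ^ ℓ) (𝓝[>] 0) (𝓝[>] 0) := by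
    refine tendsto_nhdsWithin_iff.2 ⟨?_, ?_⟩
    · have : Tendsto (fun t : ℝ => t ^ ℓ) (𝓝 0) (𝓝 (0 ^ ℓ)) :=
        (Real.continuousAt_rpow_const 0 ℓ (Or.inr hℓ.le)).tendsto
      rw [Real.zero_rpow hℓ.ne'] at this
      exact this.mono_left nhdsWithin_le_nhds
    · exact eventually_mem_nhdsWithin.mono fun t ht => Real.rpow_pos_of_pos ht _
  have hφ0 : φ 0 = h 0 := by
    have := heq.self_of_nhdsWithin (by simp)
    rwa [Real.zero_rpow hℓ.ne'] at this
  have h1 : 1 < ℓ := by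
    -- For `ℓ ≤ 1` the slopes of `φ` at `0` dominate in absolute value those of `h`, whose limit is
    -- not zero.
    by_contra hc
    rw [not_lt] at hc
    have t1 : Tendsto (fun t => |slope h 0 (t ^ ℓ)|) (𝓝[>] 0) (𝓝 |deriv h 0|) := by
      have := hasDerivAt_iff_tendsto_slope.1 (hdiff 0 hmem)
      exact ((this.mono_left (nhdsWithin_mono _ fun x hx => ne_of_gt hx)).comp htend).abs
    have t2 : Tendsto (fun t => |slope φ 0 t|) (𝓝[>] 0) (𝓝 |0|) := by
      have := hasDerivAt_iff_tendsto_slope.1 hd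
      exact (this.mono_left (nhdsWithin_mono _ fun x hx => ne_of_gt hx)).abs
    have hle : |deriv h 0| ≤ |0| := by
      refine le_of_tendsto_of_tendsto t1 t2 ?_
      filter_upwards [heq.filter_mono (nhdsWithin_mono _ Ioi_subset_Ici_self),
        Ioo_mem_nhdsGT (zero_lt_one' ℝ)] with t ht ht'
      rw [slope_def_field, slope_def_field, ht, hφ0, sub_zero, sub_zero, abs_div, abs_div]
      refine div_le_div_of_nonneg_left (abs_nonneg _) (abs_pos.2 ht'.1.ne') ?_
      rw [abs_of_pos ht'.1, abs_of_pos (Real.rpow_pos_of_pos ht'.1 _)]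
      calc t = t ^ (1 : ℝ) := (Real.rpow_one t).symm
        _ ≤ t ^ ℓ := Real.rpow_le_rpow_of_exponent_ge ht'.1 ht'.2.le hc
    rw [abs_zero, abs_nonpos_iff] at hle
    exact hne 0 hmem hle
  -- `t ^ ℓ` is continuously differentiable at `0` because `ℓ > 1`. The sign of `deriv h` does not
  -- matter, as `Real.log` is even.
  refine ⟨h1, fun t => Real.log (ℓ * deriv h (t ^ ℓ)), ?_, ?_⟩
  · have c1 : ContDiffAt ℝ 1 (fun t : ℝ => t ^ ℓ) 0 :=
      (Real.contDiff_rpow_const_of_le (n := 1) (by simpa using h1.le)).contDiffAt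
    have c2 : ContDiffAt ℝ 1 (deriv h) ((0 : ℝ) ^ ℓ) := by
      rw [Real.zero_rpow hℓ.ne']
      exact (hh.deriv_of_isOpen isOpen_Ioo (by norm_num)).contDiffAt (Ioo_mem_nhds hmem.1 hmem.2)
    refine (contDiffAt_const.mul (c2.comp (0 : ℝ) c1)).log ?_
    simp only [Function.comp, Real.zero_rpow hℓ.ne']
    exact mul_ne_zero hℓ.ne' (hne 0 hmem)
  · have hev : ∀ᶠ t in 𝓝[>] (0 : ℝ), ∀ᶠ s in 𝓝 t, φ s = h (s ^ ℓ) := by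
      obtain ⟨δ, hδ, hsub⟩ := (mem_nhdsGE_iff_exists_Ico_subset).1 heq
      filter_upwards [Ioo_mem_nhdsGT hδ] with t ht
      filter_upwards [Ioo_mem_nhds ht.1 ht.2] with s hs
      exact hsub ⟨hs.1.le, hs.2⟩
    filter_upwards [hev, htend.eventually (Ioo_mem_nhdsGT hε), self_mem_nhdsWithin] with t ht ht' ht0
    have ht0' : 0 < t := ht0
    have hmem' : t ^ ℓ ∈ Ioo (-ε) ε := ⟨by linarith [ht'.1], ht'.2⟩
    have d1 : HasDerivAt (fun s : ℝ => s ^ ℓ) (ℓ * t ^ (ℓ - 1)) t :=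
      Real.hasDerivAt_rpow_const (Or.inl ht0'.ne')
    have d2 := ((hdiff _ hmem').comp t d1).congr_of_eventuallyEq ht
    rw [d2.deriv, ← mul_assoc, Real.log_mul (mul_ne_zero (hne _ hmem') hℓ.ne')
      (Real.rpow_pos_of_pos ht0' _).ne', Real.log_rpow ht0', mul_comm (deriv h _)]

/-- A function on an open interval that agrees, near each point of the closed interval, with a
smooth function, is Lipschitz. -/
theorem exists_lipschitz_Ioo {u : ℝ → ℝ} {b c : ℝ}
    (h : ∀ x ∈ Icc b c, ∃ v : ℝ → ℝ, ContDiffAt ℝ 1 v x ∧ ∀ᶠ y in 𝓝 x, y ∈ Ioo b c → u y = v y) :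
    ∃ Λ, 0 ≤ Λ ∧ ∀ x ∈ Ioo b c, ∀ y ∈ Ioo b c, |u x - u y| ≤ Λ * |x - y| := by
  have hdiff : ∀ x ∈ Ioo b c, DifferentiableAt ℝ u x := by
    intro x hx
    obtain ⟨v, hv, he⟩ := h x (Ioo_subset_Icc_self hx)
    refine (hv.differentiableAt (by norm_num)).congr_of_eventuallyEq ?_
    filter_upwards [he, Ioo_mem_nhds hx.1 hx.2] with y hy hy'
    exact hy hy'
  have hbd : ∃ M : ℝ, 0 ≤ M ∧ ∀ x ∈ Icc b c, x ∈ Ioo b c → ‖deriv u x‖ ≤ M := by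
    refine isCompact_Icc.induction_on (p := fun s => ∃ M : ℝ, 0 ≤ M ∧
      ∀ x ∈ s, x ∈ Ioo b c → ‖deriv u x‖ ≤ M) ⟨0, le_rfl, by simp⟩ ?_ ?_ ?_
    · rintro s t hst ⟨M, hM, hs⟩
      exact ⟨M, hM, fun x hx => hs x (hst hx)⟩
    · rintro s t ⟨M, hM, hs⟩ ⟨M', hM', ht⟩
      refine ⟨max M M', le_max_of_le_left hM, fun x hx hx' => ?_⟩
      rcases hx with hx | hx
      · exact (hs x hx hx').trans (le_max_left _ _)
      · exact (ht x hx hx').trans (le_max_right _ _)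
    · intro x hx
      obtain ⟨v, hv, he⟩ := h x hx
      obtain ⟨K, t, ht, hK⟩ := hv.exists_lipschitzOnWith
      obtain ⟨O, hO, hOo, hxO⟩ := eventually_nhds_iff.1 (he.and ht)
      refine ⟨O, mem_nhdsWithin_of_mem_nhds (hOo.mem_nhds hxO), K, K.2, fun y hy hy' => ?_⟩
      refine norm_deriv_le_of_lipschitzOn (s := O ∩ Ioo b c)
        ((hOo.inter isOpen_Ioo).mem_nhds ⟨hy, hy'⟩) fun z hz z' hz' => ?_
      rw [(hO z hz.1).1 hz.2, (hO z' hz'.1).1 hz'.2]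
      exact hK (hO z hz.1).2 (hO z' hz'.1).2
  obtain ⟨M, hM, hb⟩ := hbd
  refine ⟨M, hM, fun x hx y hy => ?_⟩
  exact Convex.norm_image_sub_le_of_norm_deriv_le hdiff
    (fun z hz => hb z (Ioo_subset_Icc_self hz) hz) (convex_Ioo b c) hy hx

namespace FlatMap

variable (f : FlatMap)

theorem hasDerivAt_shift : HasDerivAt (fun t => f.lift (f.b + t)) 0 0 := by
  have h := f.flat f.b ⟨f.a_lt_b.le, le_rfl⟩
  have h2 : HasDerivAt f.lift 0 (f.b + 0) := by simpa using h
  exact h2.comp_const_add f.b 0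

theorem hasDerivAt_flip : HasDerivAt (fun t => -f.lift (f.a - t)) 0 0 := by
  have h := f.flat f.a ⟨le_rfl, f.a_lt_b.le⟩
  have h2 : HasDerivAt f.lift 0 (f.a - 0) := by simpa using h
  exact (h2.comp_const_sub f.a 0).neg.congr_deriv (by simp)

theorem log_deriv_right : 1 < f.exponent ∧ ∃ D : ℝ → ℝ, ContDiffAt ℝ 1 D 0 ∧
    ∀ᶠ t in 𝓝[>] 0, Real.log (deriv f.lift (f.b + t)) = D t + (f.exponent - 1) * Real.log t := by
  obtain ⟨h, ε, hε, hh, hne, he⟩ := f.right_form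
  have htend : Tendsto (fun t : ℝ => f.b + t) (𝓝[≥] 0) (𝓝[≥] f.b) := by
    refine tendsto_nhdsWithin_iff.2 ⟨?_, ?_⟩
    · have : Tendsto (fun t : ℝ => f.b + t) (𝓝 0) (𝓝 (f.b + 0)) :=
        (continuous_const.add continuous_id).tendsto 0
      rw [add_zero] at this
      exact this.mono_left nhdsWithin_le_nhds
    · exact eventually_mem_nhdsWithin.mono fun t ht => by simpa using ht
  obtain ⟨h1, D, hD, hev⟩ := log_deriv_of_power (φ := fun t => f.lift (f.b + t)) f.exponent_pos hε
    hh hne ((htend.eventually he).mono fun t ht => by rw [ht]; simp) f.hasDerivAt_shift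
  refine ⟨h1, D, hD, hev.mono fun t ht => ?_⟩
  rw [← ht, deriv_comp_const_add]

theorem log_deriv_left : ∃ D : ℝ → ℝ, ContDiffAt ℝ 1 D 0 ∧
    ∀ᶠ t in 𝓝[>] 0,
      Real.log (deriv f.lift (f.a + 1 - t)) = D t + (f.exponent - 1) * Real.log t := by
  obtain ⟨h, ε, hε, hh, hne, he⟩ := f.left_form
  have htend : Tendsto (fun t : ℝ => f.a - t) (𝓝[≥] 0) (𝓝[≤] f.a) := by
    refine tendsto_nhdsWithin_iff.2 ⟨?_, ?_⟩
    · have : Tendsto (fun t : ℝ => f.a - t) (𝓝 0) (𝓝 (f.a - 0)) :=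
        (continuous_const.sub continuous_id).tendsto 0
      rw [sub_zero] at this
      exact this.mono_left nhdsWithin_le_nhds
    · exact eventually_mem_nhdsWithin.mono fun t ht => by simpa using ht
  obtain ⟨h1, D, hD, hev⟩ := log_deriv_of_power (φ := fun t => -f.lift (f.a - t))
    (h := fun t => - h t) f.exponent_pos hε hh.neg
    (fun t ht => by rw [deriv.fun_neg]; exact neg_ne_zero.2 (hne t ht))
    ((htend.eventually he).mono fun t ht => by rw [ht]; simp) f.hasDerivAt_flip
  refine ⟨D, hD, hev.mono fun t ht => ?_⟩
  rw [← ht, deriv.fun_neg, deriv_comp_const_sub, neg_neg]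
  congr 1
  have e : (fun x => f.lift (x + 1)) = fun x => f.lift x + 1 := funext f.lift.map_add_one
  have := deriv_comp_add_const f.lift 1 (f.a - t)
  rw [e, deriv_add_const] at this
  rw [this]; congr 1; ring

/-- The logarithm of the derivative, without the powers that come from the endpoints. -/
def logFactor (x : ℝ) : ℝ := Real.log (deriv f.lift x) -
  (f.exponent - 1) * (Real.log (x - f.b) + Real.log (f.a + 1 - x))

/-- At each end of `[b, a + 1]` the normal form cancels the singular logarithm and the other one is
smooth there. So the remaining factor agrees locally with `C¹` functions on a compact interval. -/
theorem exists_powerLike :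
    ∃ Λ, PowerLike f.lift f.logFactor f.b (f.a + 1) (f.exponent - 1) Λ := by
  obtain ⟨h1, D, hD, hDe⟩ := f.log_deriv_right
  obtain ⟨D', hD', hDe'⟩ := f.log_deriv_left
  have hbc := f.b_lt
  obtain ⟨Λ, hΛ, hlip⟩ := exists_lipschitz_Ioo (u := f.logFactor) (b := f.b) (c := f.a + 1) (by
    intro x hx
    rcases hx.1.eq_or_lt with hxb | hxb
    · subst hxb
      refine ⟨fun y => D (y - f.b) - (f.exponent - 1) * Real.log (f.a + 1 - y), ?_, ?_⟩
      · have c1 : ContDiffAt ℝ 1 (fun y : ℝ => y - f.b) f.b := contDiffAt_id.sub contDiffAt_const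
        have c2 : ContDiffAt ℝ 1 D (f.b - f.b) := by rwa [sub_self]
        have c3 : ContDiffAt ℝ 1 (fun y => Real.log (f.a + 1 - y)) f.b :=
          (contDiffAt_const.sub contDiffAt_id).log (by simp only [id]; linarith)
        exact (ContDiffAt.comp (f := fun y : ℝ => y - f.b) f.b c2 c1).sub (contDiffAt_const.mul c3)
      · obtain ⟨δ, hδ, hsub⟩ := mem_nhdsGT_iff_exists_Ioo_subset.1 hDe
        have hδ' : (0 : ℝ) < δ := hδ
        filter_upwards [Iio_mem_nhds (show f.b < f.b + δ by linarith)] with y hy hy'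
        have hy2 : y < f.b + δ := hy
        have := hsub (show y - f.b ∈ Ioo 0 δ from ⟨by linarith [hy'.1], by linarith⟩)
        simp only [mem_ofPred_eq, add_sub_cancel] at this
        rw [logFactor, this]; ring
    rcases hx.2.eq_or_lt with hxc | hxc
    · subst hxc
      refine ⟨fun y => D' (f.a + 1 - y) - (f.exponent - 1) * Real.log (y - f.b), ?_, ?_⟩
      · have c1 : ContDiffAt ℝ 1 (fun y : ℝ => f.a + 1 - y) (f.a + 1) :=
          contDiffAt_const.sub contDiffAt_id
        have c2 : ContDiffAt ℝ 1 D' (f.a + 1 - (f.a + 1)) := by rwa [sub_self]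
        have c3 : ContDiffAt ℝ 1 (fun y => Real.log (y - f.b)) (f.a + 1) :=
          (contDiffAt_id.sub contDiffAt_const).log (by simp only [id]; linarith)
        exact (ContDiffAt.comp (f := fun y : ℝ => f.a + 1 - y) (f.a + 1) c2 c1).sub (contDiffAt_const.mul c3)
      · obtain ⟨δ, hδ, hsub⟩ := mem_nhdsGT_iff_exists_Ioo_subset.1 hDe'
        have hδ' : (0 : ℝ) < δ := hδ
        filter_upwards [Ioi_mem_nhds (show f.a + 1 - δ < f.a + 1 by linarith)] with y hy hy'
        have hy2 : f.a + 1 - δ < y := hy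
        have := hsub (show f.a + 1 - y ∈ Ioo 0 δ from ⟨by linarith [hy'.2], by linarith⟩)
        simp only [mem_ofPred_eq, sub_sub_cancel] at this
        rw [logFactor, this]; ring
    · refine ⟨f.logFactor, ?_, Eventually.of_forall fun _ _ => rfl⟩
      have hmem : x ∈ Ioo f.b (f.a + 1) := ⟨hxb, hxc⟩
      have c0 : ContDiffOn ℝ 2 f.lift (Ioo f.b (f.a + 1)) := fun y hy =>
        (f.contDiffAt y hy).contDiffWithinAt
      have c1 : ContDiffAt ℝ 1 (deriv f.lift) x :=
        (c0.deriv_of_isOpen isOpen_Ioo (by norm_num)).contDiffAt (Ioo_mem_nhds hxb hxc)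
      have c2 : ContDiffAt ℝ 1 (fun y => Real.log (f.a + 1 - y)) x :=
          (contDiffAt_const.sub contDiffAt_id).log (by simp only [id]; linarith)
      have c3 : ContDiffAt ℝ 1 (fun y => Real.log (y - f.b)) x :=
          (contDiffAt_id.sub contDiffAt_const).log (by simp only [id]; linarith)
      exact (c1.log (f.deriv_pos x hmem).2.ne').sub (contDiffAt_const.mul (c3.add c2)))
  refine ⟨Λ, hbc, by linarith, hΛ, f.continuous_lift.continuousOn, fun x hx => ?_, hlip⟩
  obtain ⟨d1, d2⟩ := f.deriv_pos x hx
  have e : f.logFactor x + (f.exponent - 1) * (Real.log (x - f.b) + Real.log (f.a + 1 - x)) =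
      Real.log (deriv f.lift x) := by rw [logFactor]; ring
  rw [e, Real.exp_log d2]
  exact d1.hasDerivAt

/-- The lift whose rotation number lies in `[0, 1)`. -/
def normLift (x : ℝ) : ℝ := f.lift x - (⌊f.lift.translationNumber⌋ : ℤ)

theorem normLift_iterate (k : ℕ) (x : ℝ) :
    f.normLift^[k] x = (f.lift ^ k) x - k * (⌊f.lift.translationNumber⌋ : ℤ) := by
  induction k generalizing x with
  | zero => simp
  | succ k ih =>
    rw [Function.iterate_succ_apply, ih, normLift, pow_succ, CircleDeg1Lift.mul_apply,
      CircleDeg1Lift.map_sub_int]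
    push_cast; ring

/-- The inequalities between orbits and the rotation are contrapositives of the bounds that one
displacement puts on the translation number; increments are unaffected by subtracting an integer. -/
theorem exists_flatLift (hirr : Irrational f.rotationNumber) :
    ∃ L : FlatLift, L.F = f.normLift ∧ L.a = f.a ∧ L.b = f.b ∧ L.τ = f.rotationNumber := by
  obtain ⟨Λ, h⟩ := f.exists_powerLike
  have hsub : ∀ x y, f.normLift x - f.normLift y = f.lift x - f.lift y := by
    intro x y; unfold normLift; ring
  have hbc : f.a + 1 - f.b ≤ 1 := by linarith [f.a_lt_b]
  have hfr : ∀ k : ℕ, (k : ℝ) * f.rotationNumber =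
      (f.lift ^ k).translationNumber - k * (⌊f.lift.translationNumber⌋ : ℤ) := by
    intro k
    rw [CircleDeg1Lift.translationNumber_pow, rotationNumber, Int.fract]; ring
  refine ⟨⟨f.normLift, fun x y hxy => sub_le_sub_right (f.lift.monotone hxy) _,
    f.continuous_lift.sub continuous_const, ?_, f.a, f.b, f.rotationNumber, f.a_lt_b, f.b_lt,
    ?_, ?_, hirr, ?_, ?_, 4 * Λ, mul_nonneg (by norm_num) h.Λ_nonneg, ?_,
    4 * Real.exp (Λ + (f.exponent - 1) * Real.log 8), by positivity, ?_, ?_⟩, rfl, rfl, rfl, rfl⟩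
  · intro x; unfold normLift; rw [f.lift.map_add_one]; ring
  · intro x hx
    have := constant_of_has_deriv_right_zero (f := f.lift) f.continuous_lift.continuousOn
      (fun x hx => (f.flat x (Ico_subset_Icc_self hx)).hasDerivWithinAt) x hx
    unfold normLift; rw [this]
  · intro x hx y hy hxy
    exact sub_lt_sub_right (h.strictMonoOn hx hy hxy) _
  · intro k m x hk
    rw [f.normLift_iterate]
    by_contra hc
    rw [hfr] at hk
    have := (f.lift ^ k).translationNumber_le_of_le_add_int (x := x)
      (m := m + k * ⌊f.lift.translationNumber⌋) (by push_cast; linarith)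
    push_cast at this; linarith
  · intro k m x hk
    rw [f.normLift_iterate]
    by_contra hc
    rw [hfr] at hk
    have := (f.lift ^ k).le_translationNumber_of_add_int_le (x := x)
      (m := m + k * ⌊f.lift.translationNumber⌋) (by push_cast; linarith)
    push_cast at this; linarith
  · intro y₀ y₁ y₂ y₃ h0 h01 h12 h23 h3
    have := h.crossRatio_le h0 h01 h12 h23 h3
    unfold crossRatio at this ⊢
    rw [hsub, hsub, hsub, hsub]
    exact this
  · intro u v y h0 h1 h2 h3
    rw [hsub, hsub]
    exact h.pow_left hbc h0 h1 h2 h3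
  · intro y u v h0 h1 h2 h3
    rw [hsub, hsub]
    exact h.pow_right hbc h0 h1 h2 h3

end FlatMap

/-! ### The invariant set and separation by preimages -/

namespace FlatLift

variable (L : FlatLift)

/-- The points whose orbit avoids the flat interval. -/
def K : Set ℝ := {x | ∀ p : Pos, p.1 ≤ 0 → x ≤ L.A p ∨ L.B p ≤ x}

/-- The closed interval between two translates. -/
def arc (p p' : Pos) : Set ℝ := Icc (min (L.B p) (L.B p')) (max (L.A p) (L.A p'))

/-- The second of three translates lies between the others. -/
def Btw (p q p' : Pos) : Prop := (L.v p < L.v q ∧ L.v q < L.v p') ∨ (L.v p' < L.v q ∧ L.v q < L.v p)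

/-- A translate separates two points. -/
def Sep (x y : ℝ) (q : Pos) : Prop := (x ≤ L.A q ∧ L.B q ≤ y) ∨ (y ≤ L.A q ∧ L.B q ≤ x)

theorem arc_comm (p p' : Pos) : L.arc p p' = L.arc p' p := by
  unfold arc; rw [min_comm, max_comm]

theorem arc_eq {p p' : Pos} (h : L.v p < L.v p') : L.arc p p' = Icc (L.B p) (L.A p') := by
  unfold arc; rw [max_eq_right (L.A_lt_A h).le, min_eq_left (L.B_lt_B h).le]

theorem abs_sub_le_gl {p p' : Pos} {x y : ℝ} (hx : x ∈ L.arc p p') (hy : y ∈ L.arc p p') :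
    |x - y| ≤ L.gl p p' := by
  unfold gl
  rw [abs_le]; constructor <;> linarith [hx.1, hx.2, hy.1, hy.2]

theorem arc_add_int {p p' : Pos} {m : ℤ} {x : ℝ} :
    x + m ∈ L.arc (p + (0, m)) (p' + (0, m)) ↔ x ∈ L.arc p p' := by
  unfold arc
  rw [A_add_int, A_add_int, B_add_int, B_add_int, max_add_add_right, min_add_add_right]
  simp [mem_Icc]

theorem Btw.gl_eq {L : FlatLift} {p q p' : Pos} (h : L.Btw p q p') :
    L.gl p p' = L.gl p q + L.w q + L.gl q p' := by
  rcases h with h | h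
  · exact L.gl_add h.1 h.2
  · rw [L.gl_comm, L.gl_add h.1 h.2, L.gl_comm p' q, L.gl_comm q p]; ring

theorem gl_nonneg (p p' : Pos) (h : p ≠ p') : 0 ≤ L.gl p p' := (L.gl_pos h).le

theorem Btw.ne {L : FlatLift} {p q p' : Pos} (h : L.Btw p q p') : p ≠ q ∧ q ≠ p' := by
  constructor
  · rintro rfl; rcases h with h | h
    · exact lt_irrefl _ h.1
    · exact lt_irrefl _ h.2
  · rintro rfl; rcases h with h | h
    · exact lt_irrefl _ h.2
    · exact lt_irrefl _ h.1

theorem Btw.gl_le {L : FlatLift} {p q p' : Pos} (h : L.Btw p q p') : L.gl q p' ≤ L.gl p p' := by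
  rw [h.gl_eq]
  linarith [L.w_nonneg q, L.gl_nonneg p q h.ne.1]

theorem Btw.A_mem {L : FlatLift} {p q p' : Pos} (h : L.Btw p q p') : L.A q ∈ L.arc p p' := by
  rcases h with h | h
  · rw [L.arc_eq (h.1.trans h.2)]; exact ⟨(L.B_lt_A h.1).le, (L.A_lt_A h.2).le⟩
  · rw [L.arc_comm, L.arc_eq (h.1.trans h.2)]; exact ⟨(L.B_lt_A h.1).le, (L.A_lt_A h.2).le⟩

theorem arc_split {p q p' : Pos} {x : ℝ} (hq : q.1 ≤ 0) (h : L.Btw p q p') (hx : x ∈ L.K)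
    (hxa : x ∈ L.arc p p') : x ∈ L.arc p q ∨ x ∈ L.arc q p' := by
  rcases h with h | h
  · rw [L.arc_eq (h.1.trans h.2)] at hxa
    rw [L.arc_eq h.1, L.arc_eq h.2]
    exact (hx q hq).imp (fun h1 => ⟨hxa.1, h1⟩) fun h1 => ⟨h1, hxa.2⟩
  · rw [L.arc_comm, L.arc_eq (h.1.trans h.2)] at hxa
    rw [L.arc_comm, L.arc_eq h.2, L.arc_comm, L.arc_eq h.1]
    exact (hx q hq).symm.imp (fun h1 => ⟨h1, hxa.2⟩) fun h1 => ⟨hxa.1, h1⟩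

theorem not_sep {q q' : Pos} {x y : ℝ} (hq : q.1 ≤ 0) (hne : q ≠ q') (hx : x ∈ L.arc q q')
    (hy : y ∈ L.arc q q') : ¬ L.Sep x y q := by
  have hAB := L.A_lt_B hq
  rcases lt_trichotomy (L.v q) (L.v q') with h | h | h
  · rw [L.arc_eq h] at hx hy
    rintro (⟨h1, h2⟩ | ⟨h1, h2⟩) <;> linarith [hx.1, hy.1]
  · exact absurd (L.v_inj h) hne
  · rw [L.arc_comm, L.arc_eq h] at hx hy
    rintro (⟨h1, h2⟩ | ⟨h1, h2⟩) <;> linarith [hx.2, hy.2]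

theorem sep_of_notMem {q q' : Pos} {x y : ℝ} (hq : q.1 ≤ 0) (hq' : q'.1 ≤ 0) (hne : q ≠ q')
    (hx : x ∈ L.K) (hxa : x ∉ L.arc q q') (hy : y ∈ L.arc q q') : L.Sep x y q ∨ L.Sep x y q' := by
  rcases lt_trichotomy (L.v q) (L.v q') with h | h | h
  · rw [L.arc_eq h] at hxa hy
    rcases hx q hq with h1 | h1
    · exact Or.inl (Or.inl ⟨h1, hy.1⟩)
    · rcases hx q' hq' with h2 | h2
      · exact absurd ⟨h1, h2⟩ hxa
      · exact Or.inr (Or.inr ⟨hy.2, h2⟩)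
  · exact absurd (L.v_inj h) hne
  · rw [L.arc_comm, L.arc_eq h] at hxa hy
    rcases hx q' hq' with h1 | h1
    · exact Or.inr (Or.inl ⟨h1, hy.1⟩)
    · rcases hx q hq with h2 | h2
      · exact absurd ⟨h1, h2⟩ hxa
      · exact Or.inl (Or.inr ⟨hy.2, h2⟩)

theorem Sep.w_le {L : FlatLift} {x y : ℝ} {q : Pos} (h : L.Sep x y q) : L.w q ≤ |x - y| := by
  unfold w
  rw [le_abs]
  rcases h with h | h
  · right; linarith [h.1, h.2]
  · left; linarith [h.1, h.2]

theorem K_add_int {x : ℝ} (hx : x ∈ L.K) (m : ℤ) : x + m ∈ L.K := by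
  intro p hp
  have := hx (p + (0, -m)) (by simpa using hp)
  rw [A_add_int, B_add_int] at this
  push_cast at this
  exact this.imp (fun h => by linarith) fun h => by linarith

theorem F_lt_B_iff {p : Pos} (hp : p.1 ≤ 0) {x : ℝ} : L.F x < L.B p ↔ x < L.B (p - (1, 0)) := by
  have := L.iter_lt_iff (p := p - (1, 0)) (i := 1) (by simp; omega) (x := x)
  simpa using this

theorem A_lt_F_iff {p : Pos} (hp : p.1 ≤ 0) {x : ℝ} : L.A p < L.F x ↔ L.A (p - (1, 0)) < x := by
  have := L.lt_iter_iff (p := p - (1, 0)) (i := 1) (by simp; omega) (x := x)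
  simpa using this

theorem F_mem_K {x : ℝ} (hx : x ∈ L.K) : L.F x ∈ L.K := by
  intro p hp
  rw [← not_lt, ← not_lt, L.A_lt_F_iff hp, L.F_lt_B_iff hp, not_lt, not_lt]
  exact hx _ (by simp; omega)

end FlatLift

/-! ### Gaps, their subdivision and nested chains -/

namespace CF

variable {L : FlatLift} (C : CF L)

/-- The long and short gaps of a dynamical partition. -/
def IsGap (n : ℕ) (g : Pos × Pos) : Prop :=
  (∃ p : Pos, -C.Q (n + 1) < p.1 ∧ p.1 ≤ 0 ∧ g = (p - C.E n, p)) ∨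
  (∃ p : Pos, -C.Q n < p.1 ∧ p.1 ≤ 0 ∧ g = (p - C.E (n + 1), p))

/-- The gaps of the next partition inside a gap. -/
def Child (n : ℕ) (g g' : Pos × Pos) : Prop :=
  (∃ p : Pos, -C.Q (n + 1) < p.1 ∧ p.1 ≤ 0 ∧ g = (p - C.E n, p) ∧
    ((∃ j, j < C.a n ∧ g' = (p + C.cut n (j + 1), p + C.cut n j)) ∨ g' = (p - C.E (n + 2), p))) ∨
  (∃ p : Pos, -C.Q n < p.1 ∧ p.1 ≤ 0 ∧ g = (p - C.E (n + 1), p) ∧ g' = g)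

theorem child_congr {L' : FlatLift} {C : CF L} {C' : CF L'} (hE : C'.E = C.E) (ha : C'.a = C.a)
    {n : ℕ} {g g' : Pos × Pos} (h : C.Child n g g') : C'.Child n g g' := by
  unfold Child Q cut at *
  rwa [hE, ha]

theorem IsGap.ne {C : CF L} {n : ℕ} {g : Pos × Pos} (h : C.IsGap n g) : g.1 ≠ g.2 := by
  rcases h with ⟨p, -, -, rfl⟩ | ⟨p, -, -, rfl⟩
  · exact fun h => C.E_ne_zero n (sub_eq_self.1 h)
  · exact fun h => C.E_ne_zero (n + 1) (sub_eq_self.1 h)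

theorem IsGap.fst_nonpos {C : CF L} {n : ℕ} {g : Pos × Pos} (h : C.IsGap n g) :
    g.1.1 ≤ 0 ∧ g.2.1 ≤ 0 := by
  rcases h with ⟨p, -, h, rfl⟩ | ⟨p, -, h, rfl⟩
  · refine ⟨?_, h⟩
    have : 0 ≤ (C.E n).1 := (C.Q_pos n).2
    simp; omega
  · refine ⟨?_, h⟩
    have : 0 ≤ (C.E (n + 1)).1 := (C.Q_pos (n + 1)).2
    simp; omega

theorem Child.isGap {C : CF L} {n : ℕ} {g g' : Pos × Pos} (h : C.Child n g g') :
    C.IsGap n g ∧ C.IsGap (n + 1) g' := by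
  have hQ := C.Q_pos n
  rcases h with ⟨p, h1, h2, rfl, ⟨j, hj, rfl⟩ | rfl⟩ | ⟨p, h1, h2, rfl, rfl⟩
  · refine ⟨Or.inl ⟨p, h1, h2, rfl⟩, Or.inl ⟨p + C.cut n j, ?_, ?_, ?_⟩⟩
    · rw [C.Q_succ, Prod.fst_add, C.cut_fst]
      have : (j : ℤ) + 1 ≤ C.a n := by exact_mod_cast hj
      nlinarith
    · have := C.cut_fst_nonpos n j
      simp; omega
    · rw [← C.cut_succ n j]; congr 1; abel
  · exact ⟨Or.inl ⟨p, h1, h2, rfl⟩, Or.inr ⟨p, h1, h2, rfl⟩⟩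
  · refine ⟨Or.inr ⟨p, h1, h2, rfl⟩, Or.inl ⟨p, ?_, h2, rfl⟩⟩
    have := C.Q_le_succ n
    have : C.Q (n + 1) ≤ C.Q (n + 2) := C.Q_le_succ (n + 1)
    show -C.Q (n + 2) < p.1
    omega

theorem btw_cut {n j : ℕ} (p : Pos) (h1 : 1 ≤ j) (h2 : j ≤ C.a n) :
    L.Btw (p - C.E n) (p + C.cut n j) p := by
  have m := C.mul_Δ_lt h2
  have d := C.Δ_pos (n + 1)
  have hj : (1 : ℝ) ≤ j := by exact_mod_cast h1
  unfold FlatLift.Btw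
  rw [L.v_sub, L.v_add, C.v_cut, C.v_E']
  rcases C.s_eq n with h | h <;> rw [h]
  · left; constructor <;> nlinarith
  · right; constructor <;> nlinarith

theorem btw_cut_succ {n j : ℕ} (p : Pos) (h2 : j < C.a n) :
    L.Btw (p + C.cut n j) (p + C.cut n (j + 1)) p := by
  have m := C.mul_Δ_lt (show j + 1 ≤ C.a n from h2)
  have d := C.Δ_pos (n + 1)
  unfold FlatLift.Btw
  rw [L.v_add, L.v_add, C.v_cut, C.v_cut]
  push_cast at *
  rcases C.s_eq n with h | h <;> rw [h]
  · left; constructor <;> nlinarith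
  · right; constructor <;> nlinarith

theorem btw_cut_cut {n j : ℕ} (p : Pos) (h1 : 1 ≤ j) :
    L.Btw (p - C.E n) (p + C.cut n j) (p + C.cut n (j + 1)) := by
  have d := C.Δ_pos (n + 1)
  have hj : (1 : ℝ) ≤ j := by exact_mod_cast h1
  unfold FlatLift.Btw
  rw [L.v_sub, L.v_add, L.v_add, C.v_cut, C.v_cut, C.v_E']
  push_cast
  rcases C.s_eq n with h | h <;> rw [h]
  · left; constructor <;> nlinarith
  · right; constructor <;> nlinarith

/-- A point of `K` lies on one side of each cut, so the pieces can be peeled off one by one. -/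
theorem exists_child {n : ℕ} {g : Pos × Pos} (hg : C.IsGap n g) {x : ℝ} (hx : x ∈ L.K)
    (hxg : x ∈ L.arc g.1 g.2) : ∃ g', C.Child n g g' ∧ x ∈ L.arc g'.1 g'.2 := by
  rcases hg with ⟨p, h1, h2, rfl⟩ | ⟨p, h1, h2, rfl⟩
  · have key : ∀ j ≤ C.a n, (∃ g', C.Child n (p - C.E n, p) g' ∧ x ∈ L.arc g'.1 g'.2) ∨
        x ∈ L.arc (p + C.cut n j) p := by
      intro j
      induction j with
      | zero => intro _; right; rw [C.cut_zero, ← sub_eq_add_neg]; exact hxg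
      | succ j ih =>
        intro hj
        rcases ih (by omega) with h | h
        · exact Or.inl h
        · have hc := C.cut_fst_nonpos n (j + 1)
          rcases L.arc_split (by simp; omega) (C.btw_cut_succ p hj) hx h with h3 | h3
          · left
            exact ⟨_, Or.inl ⟨p, h1, h2, rfl, Or.inl ⟨j, hj, rfl⟩⟩, L.arc_comm _ _ ▸ h3⟩
          · exact Or.inr h3
    rcases key _ le_rfl with h | h
    · exact h
    · refine ⟨(p - C.E (n + 2), p), Or.inl ⟨p, h1, h2, rfl, Or.inr rfl⟩, ?_⟩
      rwa [C.cut_last, ← sub_eq_add_neg] at h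
  · exact ⟨_, Or.inr ⟨p, h1, h2, rfl, rfl⟩, hxg⟩

/-- As `E 0` is a full turn, the gaps of level zero are the complementary arcs of the flat interval.
The `n`-th dynamical partition is level `n + 1`. -/
theorem exists_gap_zero {x : ℝ} (hx : x ∈ L.K) : ∃ g, C.IsGap 0 g ∧ x ∈ L.arc g.1 g.2 := by
  set m := ⌊x - L.b⌋
  have m1 : L.b + m ≤ x := by linarith [Int.floor_le (x - L.b)]
  have m2 : x < L.b + m + 1 := by linarith [Int.lt_floor_add_one (x - L.b)]
  have h1 : x ≤ L.a + (m + 1) := by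
    have h := hx (0, m + 1) le_rfl
    rw [L.A_int, L.B_int] at h
    push_cast at h
    rcases h with h | h
    · exact h
    · linarith
  have hmem : x ∈ L.arc (0, m) (0, m + 1) := by
    rw [L.arc_eq (by rw [L.v_int, L.v_int]; push_cast; linarith), L.B_int, L.A_int]
    push_cast
    exact ⟨m1, h1⟩
  have hQ : -C.Q (0 + 1) < 0 := by rw [zero_add, C.Q_one]; norm_num
  have hE : C.E 0 = (0, 1) ∨ C.E 0 = (0, -1) :=
    C.E_zero_snd.imp (fun h => Prod.ext C.E_zero_fst h) fun h => Prod.ext C.E_zero_fst h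
  rcases hE with h | h
  · refine ⟨(((0, m + 1) : Pos) - C.E 0, (0, m + 1)), Or.inl ⟨_, hQ, le_rfl, rfl⟩, ?_⟩
    simpa [h] using hmem
  · refine ⟨(((0, m) : Pos) - C.E 0, (0, m)), Or.inl ⟨_, hQ, le_rfl, rfl⟩, ?_⟩
    rw [L.arc_comm]
    simpa [h] using hmem

/-- A nested sequence of gaps around a point. -/
structure Chain (x : ℝ) (g : ℕ → Pos × Pos) : Prop where
  zero : C.IsGap 0 (g 0)
  child : ∀ n, C.Child n (g n) (g (n + 1))
  mem : ∀ n, x ∈ L.arc (g n).1 (g n).2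

theorem Chain.isGap {C : CF L} {x : ℝ} {g : ℕ → Pos × Pos} (h : C.Chain x g) (n : ℕ) :
    C.IsGap n (g n) := (h.child n).isGap.1

theorem exists_chain {x : ℝ} (hx : x ∈ L.K) : ∃ g, C.Chain x g := by
  obtain ⟨g₀, h0, h0'⟩ := C.exists_gap_zero hx
  -- The level is stored with the gap, because the choice of a child depends on it.
  let S := {g : Σ _ : ℕ, Pos × Pos // C.IsGap g.1 g.2 ∧ x ∈ L.arc g.2.1 g.2.2}
  have hs : ∀ s : S, ∃ g', C.Child s.1.1 s.1.2 g' ∧ x ∈ L.arc g'.1 g'.2 :=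
    fun s => C.exists_child s.2.1 hx s.2.2
  choose nx hnx using hs
  let st : S → S := fun s => ⟨⟨s.1.1 + 1, nx s⟩, (hnx s).1.isGap.2, (hnx s).2⟩
  let s₀ : S := ⟨⟨0, g₀⟩, h0, h0'⟩
  have hn : ∀ n, (st^[n] s₀).1.1 = n := by
    intro n
    induction n with
    | zero => rfl
    | succ n ih => rw [Function.iterate_succ_apply']; exact congrArg (· + 1) ih
  refine ⟨fun n => (st^[n] s₀).1.2, h0, fun n => ?_, fun n => (st^[n] s₀).2.2⟩
  have h := (hnx (st^[n] s₀)).1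
  rw [hn n] at h
  rw [Function.iterate_succ_apply']
  exact h

section Estimates

variable {C} {c : ℝ}

theorem Split.child_ge {n : ℕ} (hS : C.Split c n) (hc : c ≤ 1) {g g' : Pos × Pos}
    (h : C.Child n g g') : c * L.gl g.1 g.2 ≤ L.gl g'.1 g'.2 := by
  have hpos := L.gl_nonneg _ _ h.isGap.1.ne
  have hp : ∀ p : Pos, p.1 ≤ 0 → p = (-(((-p.1).toNat : ℕ) : ℤ), p.2) := fun p hp => by
    ext <;> simp; omega
  rcases h with ⟨p, h1, h2, rfl, ⟨j, hj, rfl⟩ | rfl⟩ | ⟨p, h1, h2, rfl, rfl⟩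
  · have := (hS (-p.1).toNat p.2 (by omega)).2.1 j hj
    rw [← hp p h2] at this
    rw [L.gl_comm (p + C.cut n (j + 1), p + C.cut n j).1]
    exact this
  · have := (hS (-p.1).toNat p.2 (by omega)).2.2
    rwa [← hp p h2] at this
  · nlinarith

theorem Split.cut_w {n : ℕ} (hS : C.Split c n) {p : Pos} (h1 : -C.Q (n + 1) < p.1) (h2 : p.1 ≤ 0)
    {j : ℕ} (hj : 1 ≤ j) (hj' : j ≤ C.a n) :
    c * L.gl (p - C.E n) p ≤ L.w (p + C.cut n j) := by
  have hp : p = (-(((-p.1).toNat : ℕ) : ℤ), p.2) := by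
    ext <;> simp; omega
  have := (hS (-p.1).toNat p.2 (by omega)).1 j hj hj'
  rwa [← hp] at this

/-- Each piece of a long gap misses at least one cut, and that cut is a fraction `c` of the gap. -/
theorem Split.child_le_of_long {n : ℕ} (hS : C.Split c n) {p : Pos} (h1 : -C.Q (n + 1) < p.1)
    (h2 : p.1 ≤ 0) {g' : Pos × Pos}
    (h : (∃ j, j < C.a n ∧ g' = (p + C.cut n (j + 1), p + C.cut n j)) ∨
      g' = (p - C.E (n + 2), p)) : L.gl g'.1 g'.2 ≤ (1 - c) * L.gl (p - C.E n) p := by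
  rcases h with ⟨j, hj, rfl⟩ | rfl
  · have b := C.btw_cut p (Nat.le_add_left 1 j) hj
    have hw := hS.cut_w h1 h2 (Nat.le_add_left 1 j) hj
    have e := b.gl_eq
    have h3 : L.gl (p + C.cut n (j + 1)) (p + C.cut n j) ≤
        L.gl (p - C.E n) (p + C.cut n (j + 1)) := by
      rw [L.gl_comm]
      rcases Nat.eq_zero_or_pos j with rfl | hj0
      · rw [C.cut_zero, ← sub_eq_add_neg]
      · exact (C.btw_cut_cut p hj0).gl_le
    have := L.gl_nonneg _ _ b.ne.2
    show L.gl (p + C.cut n (j + 1)) (p + C.cut n j) ≤ _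
    linarith
  · have b := C.btw_cut p (C.a_pos n) le_rfl
    have hw := hS.cut_w h1 h2 (C.a_pos n) le_rfl
    have e := b.gl_eq
    have := L.gl_nonneg _ _ b.ne.1
    rw [C.cut_last, ← sub_eq_add_neg] at *
    show L.gl (p - C.E (n + 2)) p ≤ _
    linarith

theorem Split.child_le {n : ℕ} (hS : C.Split c n) (hc : 0 ≤ c) {g g' : Pos × Pos}
    (h : C.Child n g g') : L.gl g'.1 g'.2 ≤ L.gl g.1 g.2 := by
  have hpos := L.gl_nonneg _ _ h.isGap.1.ne
  rcases h with ⟨p, h1, h2, rfl, h⟩ | ⟨p, h1, h2, rfl, rfl⟩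
  · have := hS.child_le_of_long h1 h2 h
    have h3 : L.gl (p - C.E n, p).1 (p - C.E n, p).2 = L.gl (p - C.E n) p := rfl
    rw [h3] at *
    nlinarith
  · exact le_rfl

/-- A short gap is unchanged for one level, becomes long, and is then divided; it cannot be short
twice in a row, since the two returns differ. So two levels always shrink the gap. -/
theorem child_child_le (hS : ∀ n, C.Split c n) (hc : 0 ≤ c) {n : ℕ}
    {g g' g'' : Pos × Pos} (h : C.Child n g g') (h' : C.Child (n + 1) g' g'') :
    L.gl g''.1 g''.2 ≤ (1 - c) * L.gl g.1 g.2 := by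
  have h0 := h
  rcases h with ⟨p, h1, h2, rfl, h⟩ | ⟨p, h1, h2, rfl, rfl⟩
  · exact ((hS _).child_le hc h').trans ((hS n).child_le_of_long h1 h2 h)
  · have e0 := h0.isGap.1.ne
    rcases h' with ⟨q, h3, h4, e, h⟩ | ⟨q, h3, h4, e, rfl⟩
    · have := (hS _).child_le_of_long h3 h4 h
      rw [e]; exact this
    · exfalso
      have e1 := (Prod.ext_iff.1 e).1
      have e2 := (Prod.ext_iff.1 e).2
      simp only at e1 e2
      rw [e2] at e1
      have e3 : C.E (n + 1) = C.E (n + 1 + 1) := sub_right_injective e1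
      have := congrArg (fun p => |L.v p|) e3
      simp only [C.v_E', abs_mul] at this
      have d1 := C.Δ_pos (n + 1)
      have d2 := C.Δ_pos (n + 1 + 1)
      rw [abs_of_pos d1, abs_of_pos d2] at this
      have := C.Δ_lt (n + 1)
      rcases C.s_eq (n + 1) with h | h <;> rcases C.s_eq (n + 1 + 1) with h' | h' <;>
        simp [h, h'] at * <;> linarith

/-- A point of a gap that does not lie in a given child is far from that child. -/
theorem Child.exists_sep {n : ℕ} {g g' : Pos × Pos} (h : C.Child n g g')
    {x y : ℝ} (hx : x ∈ L.K) (hxg : x ∈ L.arc g.1 g.2) (hyg : y ∈ L.arc g.1 g.2)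
    (hy : y ∈ L.arc g'.1 g'.2) (hx' : x ∉ L.arc g'.1 g'.2) :
    ∃ q : Pos, q.1 ≤ 0 ∧ L.Sep x y q ∧
      ∃ p j, g = (p - C.E n, p) ∧ -C.Q (n + 1) < p.1 ∧ p.1 ≤ 0 ∧ 1 ≤ j ∧ j ≤ C.a n ∧
        q = p + C.cut n j := by
  have hg1 := h.isGap.1
  have hne := h.isGap.2.ne
  have hfst := h.isGap.2.fst_nonpos
  rcases h with ⟨p, h1, h2, rfl, ⟨j, hj, rfl⟩ | rfl⟩ | ⟨p, h1, h2, rfl, rfl⟩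
  · rcases L.sep_of_notMem hfst.1 hfst.2 hne hx hx' hy with hs | hs
    · exact ⟨_, hfst.1, hs, p, j + 1, rfl, h1, h2, by omega, hj, rfl⟩
    · rcases Nat.eq_zero_or_pos j with rfl | hj0
      · exfalso
        simp only [C.cut_zero] at hs
        rw [← sub_eq_add_neg] at hs
        exact L.not_sep hg1.fst_nonpos.1 hg1.ne hxg hyg hs
      · exact ⟨_, hfst.2, hs, p, j, rfl, h1, h2, hj0, hj.le, rfl⟩
  · rcases L.sep_of_notMem hfst.1 hfst.2 hne hx hx' hy with hs | hs
    · refine ⟨_, hfst.1, hs, p, C.a n, rfl, h1, h2, C.a_pos n, le_rfl, ?_⟩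
      rw [C.cut_last, sub_eq_add_neg]
    · exfalso
      rw [L.arc_comm] at hxg hyg
      exact L.not_sep hg1.fst_nonpos.2 hg1.ne.symm hxg hyg hs
  · exact absurd hxg hx'

end Estimates

end CF

/-! ### Matching points of two lifts -/

/-- Two points of the invariant sets of two lifts that lie on the same sides of all preimages of
the flat intervals. -/
def FlatLift.Match (L L' : FlatLift) (x y : ℝ) : Prop :=
  ∀ p : Pos, p.1 ≤ 0 → (L.B p ≤ x → L'.B p ≤ y) ∧ (x ≤ L.A p → y ≤ L'.A p)

namespace FlatLift

variable {L L' : FlatLift}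

theorem v_congr (h : L'.τ = L.τ) (p : Pos) : L'.v p = L.v p := by unfold v; rw [h]

/-- A Dedekind cut: take the supremum of the right endpoints, for the second lift, of the preimages
that lie to the left of `x` for the first. Equal rotation numbers make the orders agree. -/
theorem exists_match (h : L'.τ = L.τ) (x : ℝ) : ∃ y, L.Match L' x y := by
  set S : Set ℝ := {t | ∃ p : Pos, p.1 ≤ 0 ∧ L.B p ≤ x ∧ t = L'.B p} with hS
  have key : ∀ p : Pos, p.1 ≤ 0 → x ≤ L.A p → ∀ t ∈ S, t ≤ L'.A p := by
    rintro p hp hx t ⟨q, hq, hqx, rfl⟩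
    refine (L'.B_lt_A ?_).le
    rw [v_congr h, v_congr h]
    by_contra hc
    have := L.B_mono (not_lt.1 hc)
    linarith [L.A_lt_B hp]
  have hne : S.Nonempty := by
    refine ⟨_, (0, ⌊x - L.b⌋), le_rfl, ?_, rfl⟩
    rw [L.B_int]; linarith [Int.floor_le (x - L.b)]
  have hbdd : BddAbove S := by
    refine ⟨_, fun t ht => key (0, ⌈x - L.a⌉) le_rfl ?_ t ht⟩
    rw [L.A_int]; linarith [Int.le_ceil (x - L.a)]
  exact ⟨sSup S, fun p hp => ⟨fun hx => le_csSup hbdd ⟨p, hp, hx, rfl⟩,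
    fun hx => csSup_le hne (key p hp hx)⟩⟩

namespace Match

variable {x y : ℝ}

theorem mem_K (h : L.Match L' x y) (hx : x ∈ L.K) : y ∈ L'.K := fun p hp =>
  (hx p hp).imp (h p hp).2 (h p hp).1

theorem mem_arc (hτ : L'.τ = L.τ) (h : L.Match L' x y) {p p' : Pos} (hp : p.1 ≤ 0)
    (hp' : p'.1 ≤ 0) (hne : p ≠ p') (hx : x ∈ L.arc p p') : y ∈ L'.arc p p' := by
  rcases lt_trichotomy (L.v p) (L.v p') with hv | hv | hv
  · rw [L.arc_eq hv] at hx
    rw [L'.arc_eq (by rwa [v_congr hτ, v_congr hτ])]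
    exact ⟨(h p hp).1 hx.1, (h p' hp').2 hx.2⟩
  · exact absurd (L.v_inj hv) hne
  · rw [L.arc_comm, L.arc_eq hv] at hx
    rw [L'.arc_comm, L'.arc_eq (by rwa [v_congr hτ, v_congr hτ])]
    exact ⟨(h p' hp').1 hx.1, (h p hp).2 hx.2⟩

theorem symm (h : L.Match L' x y) (hx : x ∈ L.K) : L'.Match L y x := by
  intro p hp
  have hAB := L'.A_lt_B hp
  exact ⟨fun h1 => (hx p hp).resolve_left fun h2 => by linarith [(h p hp).2 h2],
    fun h1 => (hx p hp).resolve_right fun h2 => by linarith [(h p hp).1 h2]⟩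

theorem map_F (h : L.Match L' x y) : L.Match L' (L.F x) (L'.F y) := by
  intro p hp
  have := h (p - (1, 0)) (by simp; omega)
  rw [← not_lt, ← not_lt, L.F_lt_B_iff hp, L'.F_lt_B_iff hp, ← not_lt, ← not_lt, L.A_lt_F_iff hp,
    L'.A_lt_F_iff hp, not_lt, not_lt, not_lt, not_lt]
  exact this

theorem add_int (h : L.Match L' x y) (m : ℤ) : L.Match L' (x + m) (y + m) := by
  intro p hp
  have := h (p + (0, -m)) (by simpa using hp)
  simp only [A_add_int, B_add_int] at this
  push_cast at this
  exact ⟨fun h => by linarith [this.1 (by linarith)], fun h => by linarith [this.2 (by linarith)]⟩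

theorem sep (h : L.Match L' x y) {x₁ y₁ : ℝ} (h₁ : L.Match L' x₁ y₁) {q : Pos} (hq : q.1 ≤ 0)
    (hs : L.Sep x x₁ q) : L'.Sep y y₁ q :=
  hs.imp (fun hs => ⟨(h q hq).2 hs.1, (h₁ q hq).1 hs.2⟩)
    fun hs => ⟨(h₁ q hq).2 hs.1, (h q hq).1 hs.2⟩

end Match
end FlatLift

/-! ### Decay along chains and quasi-symmetry on the line -/

/-- The properties of the sizes of nested gaps. -/
structure Decay (c : ℝ) (l : ℕ → ℝ) : Prop where
  pos : ∀ n, 0 < l n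
  anti : ∀ n, l (n + 1) ≤ l n
  ge : ∀ n, c * l n ≤ l (n + 1)
  two : ∀ n, l (n + 2) ≤ (1 - c) * l n

theorem Decay.two_mul_le {c : ℝ} {l : ℕ → ℝ} (h : Decay c l) (hc : c ≤ 1) (n k : ℕ) :
    l (n + 2 * k) ≤ (1 - c) ^ k * l n := by
  induction k with
  | zero => simp
  | succ k ih =>
    calc l (n + 2 * (k + 1)) ≤ (1 - c) * l (n + 2 * k) := h.two (n + 2 * k)
      _ ≤ (1 - c) * ((1 - c) ^ k * l n) := mul_le_mul_of_nonneg_left ih (by linarith)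
      _ = _ := by ring

theorem Decay.pow_mul_le {c : ℝ} {l : ℕ → ℝ} (h : Decay c l) (hc : 0 ≤ c) (n k : ℕ) :
    c ^ k * l n ≤ l (n + k) := by
  induction k with
  | zero => simp
  | succ k ih =>
    calc c ^ (k + 1) * l n = c * (c ^ k * l n) := by ring
      _ ≤ c * l (n + k) := mul_le_mul_of_nonneg_left ih hc
      _ ≤ _ := h.ge (n + k)

theorem Decay.exists_lt {c : ℝ} {l : ℕ → ℝ} (h : Decay c l) (hc : 0 < c) (hc1 : c ≤ 1) (n : ℕ)
    {ε : ℝ} (hε : 0 < ε) : ∃ m, n ≤ m ∧ l m < ε := by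
  obtain ⟨k, hk⟩ := exists_pow_lt_of_lt_one (div_pos hε (h.pos n)) (show 1 - c < 1 by linarith)
  refine ⟨n + 2 * k, by omega, (h.two_mul_le hc1 n k).trans_lt ?_⟩
  rwa [lt_div_iff₀ (h.pos n)] at hk

/-- If the sizes at two levels are comparable in one sequence, they are in the other. -/
theorem exists_ratio {c e : ℝ} (hc : 0 < c) (hc1 : c ≤ 1) (he : 0 < e) :
    ∃ κ > 0, ∀ l l', Decay c l → Decay c l' → ∀ N M, e * l N ≤ l M → κ * l' N ≤ l' M := by
  obtain ⟨k, hk⟩ := exists_pow_lt_of_lt_one he (show 1 - c < 1 by linarith)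
  refine ⟨c ^ (2 * k), by positivity, fun l l' h h' N M hNM => ?_⟩
  have hlt : M < N + 2 * k := by
    by_contra hcon
    have h1 : l M ≤ l (N + 2 * k) := antitone_nat_of_succ_le h.anti (not_lt.1 hcon)
    have h2 := h.two_mul_le hc1 N k
    have h3 := mul_lt_mul_of_pos_right hk (h.pos N)
    linarith
  have hp := h'.pos N
  rcases le_total M N with hMN | hMN
  · refine le_trans ?_ (antitone_nat_of_succ_le h'.anti hMN)
    have : c ^ (2 * k) ≤ 1 := pow_le_one₀ hc.le hc1
    nlinarith
  · obtain ⟨j, rfl⟩ := Nat.exists_eq_add_of_le hMN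
    refine le_trans ?_ (h'.pow_mul_le hc.le N j)
    exact mul_le_mul_of_nonneg_right (pow_le_pow_of_le_one hc.le hc1 (by omega)) hp.le

namespace CF

/-- The dynamical partitions have bounded geometry. -/
structure Geometry {L : FlatLift} (C : CF L) (c : ℝ) : Prop where
  pos : 0 < c
  le_one : c ≤ 1
  le_flat : c ≤ L.b - L.a
  le_gap : c ≤ L.a + 1 - L.b
  split : ∀ n, C.Split c n

theorem Geometry.mono {L : FlatLift} {C : CF L} {c c' : ℝ} (h : C.Geometry c) (h0 : 0 < c')
    (h1 : c' ≤ c) : C.Geometry c' :=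
  ⟨h0, h1.trans h.le_one, h1.trans h.le_flat, h1.trans h.le_gap, fun n => (h.split n).mono h1⟩

theorem exists_geometry {L : FlatLift} {C : CF L} {c : ℝ} (h0 : 0 < c) (h : ∀ n, C.Split c n) :
    ∃ c, C.Geometry c := by
  have h1 := L.a_lt_b
  have h2 := L.b_lt
  refine ⟨min (min c 1) (min (L.b - L.a) (L.a + 1 - L.b)), ?_, ?_, ?_, ?_, fun n => (h n).mono ?_⟩
  · exact lt_min (lt_min h0 one_pos) (lt_min (by linarith) (by linarith))
  · exact (min_le_left _ _).trans (min_le_right _ _)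
  · exact (min_le_right _ _).trans (min_le_left _ _)
  · exact (min_le_right _ _).trans (min_le_right _ _)
  · exact (min_le_left _ _).trans (min_le_left _ _)

/-- The sizes of nested gaps, starting with the size of the circle. -/
def size (L : FlatLift) (g : ℕ → Pos × Pos) : ℕ → ℝ
  | 0 => 1
  | n + 1 => L.gl (g n).1 (g n).2

theorem IsGap.gl_zero {L : FlatLift} {C : CF L} {g : Pos × Pos} (h : C.IsGap 0 g) :
    L.gl g.1 g.2 = 1 - (L.b - L.a) ∧ g.1.1 = 0 ∧ g.2.1 = 0 := by
  have hQ0 := C.Q_zero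
  have hQ1 := C.Q_one
  rcases h with ⟨p, h1, h2, rfl⟩ | ⟨p, h1, h2, rfl⟩
  · rw [zero_add, hQ1] at h1
    have hp : p.1 = 0 := by omega
    obtain ⟨k, m⟩ := p
    simp only at hp
    subst hp
    have hE : C.E 0 = (0, 1) ∨ C.E 0 = (0, -1) :=
      C.E_zero_snd.imp (fun h => Prod.ext C.E_zero_fst h) fun h => Prod.ext C.E_zero_fst h
    refine ⟨?_, by simp [C.E_zero_fst], rfl⟩
    rcases hE with h | h
    · rw [L.gl_eq (by simp [h, FlatLift.v]), h, Prod.mk_sub_mk, sub_zero, L.A_int, L.B_int]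
      push_cast; ring
    · rw [L.gl_comm, L.gl_eq (by simp [h, FlatLift.v]), h, Prod.mk_sub_mk, sub_zero, L.A_int,
        L.B_int]
      push_cast; ring
  · omega

theorem Chain.decay {L : FlatLift} {C : CF L} {c x : ℝ} {g : ℕ → Pos × Pos} (h : C.Chain x g)
    (hG : C.Geometry c) : Decay c (size L g) := by
  have h0 := h.zero.gl_zero.1
  have hc := hG.pos
  refine ⟨fun n => ?_, fun n => ?_, fun n => ?_, fun n => ?_⟩
  · cases n with
    | zero => exact one_pos
    | succ n => exact L.gl_pos (h.isGap n).ne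
  · cases n with
    | zero =>
      show L.gl (g 0).1 (g 0).2 ≤ 1
      linarith [hG.le_flat]
    | succ n => exact (hG.split n).child_le hc.le (h.child n)
  · cases n with
    | zero =>
      show c * 1 ≤ L.gl (g 0).1 (g 0).2
      linarith [hG.le_gap]
    | succ n => exact (hG.split n).child_ge hG.le_one (h.child n)
  · cases n with
    | zero =>
      show L.gl (g 1).1 (g 1).2 ≤ (1 - c) * 1
      have := (hG.split 0).child_le hc.le (h.child 0)
      linarith [hG.le_flat]
    | succ n => exact child_child_le hG.split hc.le (h.child n) (h.child (n + 1))

theorem Chain.of_match {L L' : FlatLift} {C : CF L} {C' : CF L'} (hτ : L'.τ = L.τ)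
    (hE : C'.E = C.E) (ha : C'.a = C.a) {x y : ℝ} (hxy : L.Match L' x y) {g : ℕ → Pos × Pos}
    (h : C.Chain x g) : C'.Chain y g := by
  have hc : ∀ n, C'.Child n (g n) (g (n + 1)) := fun n => child_congr hE ha (h.child n)
  exact ⟨(hc 0).isGap.1, hc, fun n => hxy.mem_arc hτ (h.isGap n).fst_nonpos.1
    (h.isGap n).fst_nonpos.2 (h.isGap n).ne (h.mem n)⟩

/-- Both matches lie in the same nested gaps, whose sizes tend to zero. -/
theorem match_unique {L L' : FlatLift} {C : CF L} {C' : CF L'} (hτ : L'.τ = L.τ)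
    (hE : C'.E = C.E) (ha : C'.a = C.a) {c : ℝ} (hG : C'.Geometry c) {x y y' : ℝ} (hx : x ∈ L.K)
    (h : L.Match L' x y) (h' : L.Match L' x y') : y = y' := by
  obtain ⟨g, hg⟩ := C.exists_chain hx
  have k := hg.of_match hτ hE ha h
  have k' := hg.of_match hτ hE ha h'
  by_contra hne
  obtain ⟨m, hm, hlt⟩ := (k.decay hG).exists_lt hG.pos hG.le_one 1 (abs_pos.2 (sub_ne_zero.2 hne))
  obtain ⟨n, rfl⟩ := Nat.exists_eq_add_of_le' hm
  exact absurd (L'.abs_sub_le_gl (k.mem n) (k'.mem n)) (not_le.2 hlt)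

/-- The level at which a point is separated from a nested sequence of gaps. -/
def SepAt {L : FlatLift} (C : CF L) (g : ℕ → Pos × Pos) (x y : ℝ) (N : ℕ) : Prop :=
  (N = 0 ∧ ∃ m : ℤ, L.Sep x y (0, m)) ∨
  ∃ n, N = n + 1 ∧ x ∈ L.arc (g n).1 (g n).2 ∧ ∃ p j, g n = (p - C.E n, p) ∧
    -C.Q (n + 1) < p.1 ∧ p.1 ≤ 0 ∧ 1 ≤ j ∧ j ≤ C.a n ∧ L.Sep x y (p + C.cut n j)

/-- The gaps shrink, so `x` leaves the chain of `y` at a first level, and there a cut of the last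
common gap separates them; if it is never in the chain, the flat interval does. -/
theorem Chain.exists_sepAt {L : FlatLift} {C : CF L} {c x y : ℝ} {g : ℕ → Pos × Pos}
    (h : C.Chain y g) (hG : C.Geometry c) (hx : x ∈ L.K) (hne : x ≠ y) :
    ∃ N, C.SepAt g x y N := by
  by_cases h0 : x ∈ L.arc (g 0).1 (g 0).2
  · have hex : ∃ n, x ∉ L.arc (g n).1 (g n).2 := by
      obtain ⟨m, hm, hlt⟩ := (h.decay hG).exists_lt hG.pos hG.le_one 1
        (abs_pos.2 (sub_ne_zero.2 hne))
      obtain ⟨n, rfl⟩ := Nat.exists_eq_add_of_le' hm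
      exact ⟨n, fun hmem => absurd (L.abs_sub_le_gl hmem (h.mem n)) (not_le.2 hlt)⟩
    classical
    obtain ⟨n, hn, hmin⟩ : ∃ n, x ∉ L.arc (g (n + 1)).1 (g (n + 1)).2 ∧
        x ∈ L.arc (g n).1 (g n).2 := by
      have h1 := Nat.find_spec hex
      have h2 : Nat.find hex ≠ 0 := fun h3 => by rw [h3] at h1; exact h1 h0
      obtain ⟨n, hn⟩ := Nat.exists_eq_succ_of_ne_zero h2
      refine ⟨n, by rwa [hn] at h1, ?_⟩
      have := Nat.find_min hex (show n < Nat.find hex by omega)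
      rwa [not_not] at this
    obtain ⟨q, hq, hs, p, j, e, h1, h2, h3, h4, rfl⟩ :=
      (h.child n).exists_sep hx hmin (h.mem n) (h.mem (n + 1)) hn
    exact ⟨n + 1, Or.inr ⟨n, rfl, hmin, p, j, e, h1, h2, h3, h4, hs⟩⟩
  · obtain ⟨-, e1, e2⟩ := h.zero.gl_zero
    refine ⟨0, Or.inl ⟨rfl, ?_⟩⟩
    rcases L.sep_of_notMem e1.le e2.le h.zero.ne hx h0 (h.mem 0) with hs | hs
    · exact ⟨(g 0).1.2, by rwa [← e1]⟩
    · exact ⟨(g 0).2.2, by rwa [← e2]⟩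

theorem SepAt.of_match {L L' : FlatLift} {C : CF L} {C' : CF L'} (hτ : L'.τ = L.τ)
    (hE : C'.E = C.E) (ha : C'.a = C.a) {x y x' y' : ℝ} (hx : L.Match L' x x')
    (hy : L.Match L' y y') {g : ℕ → Pos × Pos} (hg : C.Chain y g) {N : ℕ}
    (h : C.SepAt g x y N) : C'.SepAt g x' y' N := by
  rcases h with ⟨rfl, m, hs⟩ | ⟨n, rfl, hmem, p, j, e, h1, h2, h3, h4, hs⟩
  · exact Or.inl ⟨rfl, m, hx.sep hy le_rfl hs⟩
  · have hc : C'.cut n j = C.cut n j := by unfold cut; rw [hE]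
    have hn := C.cut_fst_nonpos n j
    refine Or.inr ⟨n, rfl, hx.mem_arc hτ (hg.isGap n).fst_nonpos.1 (hg.isGap n).fst_nonpos.2
      (hg.isGap n).ne hmem, p, j, by rw [hE]; exact e, by unfold Q at *; rwa [hE], h2, h3,
      by rwa [ha], ?_⟩
    rw [hc]
    exact hx.sep hy (by simp; omega) hs

/-- The separating preimage bounds the distance from below, the last common gap from above. Hence
the level determines the distance up to constants, and by `SepAt.of_match` it is common to both
maps. -/
theorem SepAt.bounds {L : FlatLift} {C : CF L} {c x y : ℝ} {g : ℕ → Pos × Pos} {N : ℕ}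
    (h : C.SepAt g x y N) (hg : C.Chain y g) (hG : C.Geometry c) (h1 : |x - y| ≤ 1) :
    c * size L g N ≤ |x - y| ∧ |x - y| ≤ size L g N := by
  rcases h with ⟨rfl, m, hs⟩ | ⟨n, rfl, hmem, p, j, e, h2, h3, h4, h5, hs⟩
  · refine ⟨?_, h1⟩
    refine le_trans ?_ hs.w_le
    show c * 1 ≤ L.B (0, m) - L.A (0, m)
    rw [L.B_int, L.A_int]; linarith [hG.le_flat]
  · refine ⟨?_, L.abs_sub_le_gl hmem (hg.mem n)⟩
    refine le_trans ?_ hs.w_le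
    show c * L.gl (g n).1 (g n).2 ≤ _
    rw [e]
    exact (hG.split n).cut_w h2 h3 h4 h5

section Pair

variable {L L' : FlatLift} {C : CF L} {C' : CF L'} {c : ℝ}

/-- If the order were reversed, a preimage would separate the images in the wrong order, and
matching would carry this back to the source. -/
theorem match_mono (hG' : C'.Geometry c) {x y x' y' : ℝ} (hx : x ∈ L.K) (hy : y ∈ L.K)
    (mx : L.Match L' x x') (my : L.Match L' y y') (h : x ≤ y) : x' ≤ y' := by
  by_contra hc
  rw [not_le] at hc
  obtain ⟨g, hg⟩ := C'.exists_chain (my.mem_K hy)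
  obtain ⟨N, hN⟩ := hg.exists_sepAt hG' (mx.mem_K hx) hc.ne'
  have key : ∀ q : Pos, q.1 ≤ 0 → ¬ L'.Sep x' y' q := by
    rintro q hq (hs | hs)
    · linarith [hs.1, hs.2, L'.A_lt_B hq]
    · have h1 := ((my.symm hy) q hq).2 hs.1
      have h2 := ((mx.symm hx) q hq).1 hs.2
      linarith [L.A_lt_B hq]
  rcases hN with ⟨-, m, hs⟩ | ⟨n, -, -, p, j, -, -, h2, -, -, hs⟩
  · exact key (0, m) le_rfl hs
  · have := C'.cut_fst_nonpos n j
    exact key _ (by simp; omega) hs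

theorem match_abs_sub_le_one (hG' : C'.Geometry c) {x y x' y' : ℝ} (hx : x ∈ L.K) (hy : y ∈ L.K)
    (mx : L.Match L' x x') (my : L.Match L' y y') (h : |x - y| ≤ 1) : |x' - y'| ≤ 1 := by
  have mx1 := mx.add_int 1
  have my1 := my.add_int 1
  push_cast at mx1 my1
  have hx1 := L.K_add_int hx 1
  have hy1 := L.K_add_int hy 1
  push_cast at hx1 hy1
  rw [abs_le] at h ⊢
  have a1 := match_mono hG' hy hx1 my mx1 (by linarith)
  have a2 := match_mono hG' hx hy1 mx my1 (by linarith)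
  constructor <;> linarith

/-- Equal distances are sent to comparable distances. -/
theorem exists_quasiSymm (hτ : L'.τ = L.τ) (hE : C'.E = C.E) (ha : C'.a = C.a)
    (hG : C.Geometry c) (hG' : C'.Geometry c) : ∃ κ > 0, ∀ x y z x' y' z', x ∈ L.K → y ∈ L.K →
      z ∈ L.K → L.Match L' x x' → L.Match L' y y' → L.Match L' z z' → x ≠ y →
      |x - y| = |z - y| → |x - y| ≤ 1 → κ * |x' - y'| ≤ |z' - y'| := by
  obtain ⟨κ, hκ, hr⟩ := exists_ratio hG.pos hG.le_one hG.pos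
  have hc := hG.pos
  refine ⟨c * κ, mul_pos hc hκ, fun x y z x' y' z' hx hy hz mx my mz hne hxz h1 => ?_⟩
  have hne' : z ≠ y := by
    rintro rfl
    rw [sub_self, abs_zero, abs_eq_zero, sub_eq_zero] at hxz
    exact hne hxz
  obtain ⟨g, hg⟩ := C.exists_chain hy
  have hg' := hg.of_match hτ hE ha my
  obtain ⟨N, hN⟩ := hg.exists_sepAt hG hx hne
  obtain ⟨M, hM⟩ := hg.exists_sepAt hG hz hne'
  have bN := hN.bounds hg hG h1
  have bM := hM.bounds hg hG (hxz ▸ h1)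
  have bN' := (hN.of_match (C' := C') hτ hE ha mx my hg).bounds hg' hG'
    (match_abs_sub_le_one hG' hx hy mx my h1)
  have bM' := (hM.of_match (C' := C') hτ hE ha mz my hg).bounds hg' hG'
    (match_abs_sub_le_one hG' hz hy mz my (hxz ▸ h1))
  -- Equal distances make the sizes at levels `N` and `M` comparable in the source; decay transfers
  -- this to the target along the same chain.
  have h2 := hr _ _ (hg.decay hG) (hg'.decay hG') N M (by linarith [bN.1, bM.2])
  calc c * κ * |x' - y'| ≤ c * κ * size L' g N :=
        mul_le_mul_of_nonneg_left bN'.2 (mul_pos hc hκ).le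
    _ = c * (κ * size L' g N) := by ring
    _ ≤ c * size L' g M := mul_le_mul_of_nonneg_left h2 hc.le
    _ ≤ _ := bM'.1

/-- Points that are not on the long side of each other are not sent close to each other around the
circle. -/
theorem exists_complement (hτ : L'.τ = L.τ) (hE : C'.E = C.E) (ha : C'.a = C.a)
    (hG : C.Geometry c) (hG' : C'.Geometry c) : ∃ δ > 0, ∀ x y x' y', x ∈ L.K → y ∈ L.K →
      L.Match L' x x' → L.Match L' y y' → |x - y| ≤ 1 / 2 → δ ≤ 1 - |x' - y'| := by
  obtain ⟨κ, hκ, hr⟩ := exists_ratio hG.pos hG.le_one (show (0 : ℝ) < 1 / 2 by norm_num)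
  have hc := hG.pos
  refine ⟨c * κ, mul_pos hc hκ, ?_⟩
  have key : ∀ x y x' y', x ∈ L.K → y ∈ L.K → L.Match L' x x' → L.Match L' y y' → x ≤ y →
      y - x ≤ 1 / 2 → c * κ ≤ 1 - |x' - y'| := by
    intro x y x' y' hx hy mx my hxy h
    -- The complementary arc runs from `y` to `x + 1` and has length at least one half, so its
    -- separation level is comparable to level zero, where the size is one.
    have mx1 := mx.add_int 1
    have hx1 := L.K_add_int hx 1
    push_cast at mx1 hx1
    have a1 := match_mono hG' hx hy mx my hxy
    have a2 := match_mono hG' hy hx1 my mx1 (by linarith)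
    obtain ⟨g, hg⟩ := C.exists_chain hy
    have hg' := hg.of_match hτ hE ha my
    have hd : |x + 1 - y| = x + 1 - y := abs_of_nonneg (by linarith)
    have hd' : |x' + 1 - y'| = x' + 1 - y' := abs_of_nonneg (by linarith)
    obtain ⟨N, hN⟩ := hg.exists_sepAt hG hx1 (by intro h; linarith)
    have b := hN.bounds hg hG (by rw [hd]; linarith)
    have b' := (hN.of_match (C' := C') hτ hE ha mx1 my hg).bounds hg' hG' (by rw [hd']; linarith)
    rw [hd] at b
    rw [hd'] at b'
    have h2 := hr _ _ (hg.decay hG) (hg'.decay hG') 0 N (by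
      show 1 / 2 * 1 ≤ size L g N
      linarith [b.2])
    have h3 : κ * 1 ≤ size L' g N := h2
    have h4 := mul_le_mul_of_nonneg_left h3 hc.le
    rw [abs_sub_comm, abs_of_nonneg (by linarith)]
    linarith [b'.1]
  intro x y x' y' hx hy mx my h
  rw [abs_le] at h
  rcases le_total x y with hxy | hxy
  · exact key x y x' y' hx hy mx my hxy (by linarith)
  · rw [abs_sub_comm]
    exact key y x y' x' hy hx my mx hxy (by linarith)

end Pair

end CF

/-! ### Representing a circle map by its lift -/

theorem coe_eq_coe_iff {x y : ℝ} : (x : Circ) = (y : Circ) ↔ ∃ m : ℤ, x = y + m := by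
  rw [← sub_eq_zero, ← AddCircle.coe_sub, AddCircle.coe_eq_zero_iff]
  exact ⟨fun ⟨n, hn⟩ => ⟨n, by simp at hn; linarith⟩, fun ⟨n, hn⟩ => ⟨n, by simp; linarith⟩⟩

theorem coe_add_int (x : ℝ) (m : ℤ) : ((x + m : ℝ) : Circ) = (x : Circ) :=
  coe_eq_coe_iff.2 ⟨m, rfl⟩

namespace FlatLift

variable {L : FlatLift}

theorem iter_mem_arc {p p' : Pos} {i : ℕ} (hp : p.1 + i ≤ 0) (hp' : p'.1 + i ≤ 0) (hne : p ≠ p')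
    {x : ℝ} : L.F^[i] x ∈ L.arc (p + ((i : ℤ), 0)) (p' + ((i : ℤ), 0)) ↔ x ∈ L.arc p p' := by
  rcases lt_trichotomy (L.v p) (L.v p') with hv | hv | hv
  · rw [L.arc_eq hv, L.arc_eq (by rw [L.v_add, L.v_add]; linarith), mem_Icc, mem_Icc, ← not_lt,
      ← not_lt, L.iter_lt_iff hp, L.lt_iter_iff hp', not_lt, not_lt]
  · exact absurd (L.v_inj hv) hne
  · rw [L.arc_comm, L.arc_comm p, L.arc_eq hv, L.arc_eq (by rw [L.v_add, L.v_add]; linarith),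
      mem_Icc, mem_Icc, ← not_lt, ← not_lt, L.iter_lt_iff hp', L.lt_iter_iff hp, not_lt, not_lt]

end FlatLift

/-- A lift with closest returns that represents a circle map. -/
structure Model (f : FlatMap) (L : FlatLift) (C : CF L) : Prop where
  F_eq : L.F = f.normLift
  a_eq : L.a = f.a
  b_eq : L.b = f.b
  q_eq : ∀ n, (f.q n : ℤ) = C.Q (n + 1)
  ε_eq : C.ε = -1

namespace Model

variable {f : FlatMap} {L : FlatLift} {C : CF L}

theorem s_even (M : Model f L C) {n : ℕ} (h : Even n) : C.s (n + 1) = 1 := by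
  rw [CF.s, M.ε_eq, pow_succ, h.neg_one_pow]; norm_num

theorem s_odd (M : Model f L C) {n : ℕ} (h : ¬ Even n) : C.s (n + 1) = -1 := by
  rw [CF.s, M.ε_eq, pow_succ, (Nat.not_even_iff_odd.1 h).neg_one_pow]; norm_num

theorem coe_F (M : Model f L C) (x : ℝ) : f (x : Circ) = (L.F x : Circ) := by
  rw [M.F_eq, FlatMap.normLift, f.toFun_coe, coe_eq_coe_iff]
  exact ⟨⌊f.lift.translationNumber⌋, by ring⟩

theorem coe_iter (M : Model f L C) (i : ℕ) (x : ℝ) : f^[i] (x : Circ) = (L.F^[i] x : Circ) := by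
  induction i with
  | zero => rfl
  | succ i ih => rw [Function.iterate_succ_apply', ih, M.coe_F, Function.iterate_succ_apply']

theorem mem_preimageFlat (M : Model f L C) {i : ℕ} {x : ℝ} :
    (x : Circ) ∈ f.preimageFlat i ↔ ∃ m : ℤ, L.A (-(i : ℤ), m) < x ∧ x < L.B (-(i : ℤ), m) := by
  have h1 : ∀ m : ℤ, (L.A (-(i : ℤ), m) < x ↔ L.a + m < L.F^[i] x) := by
    intro m
    rw [← L.lt_iter_iff (i := i) (by simp)]
    simp [L.A_int]
  have h2 : ∀ m : ℤ, (x < L.B (-(i : ℤ), m) ↔ L.F^[i] x < L.b + m) := by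
    intro m
    rw [← L.iter_lt_iff (i := i) (by simp)]
    simp [L.B_int]
  simp only [h1, h2]
  rw [FlatMap.preimageFlat, mem_preimage, M.coe_iter, FlatMap.flatInterval]
  constructor
  · rintro ⟨t, ht, e⟩
    obtain ⟨m, hm⟩ := coe_eq_coe_iff.1 e.symm
    exact ⟨m, by rw [M.a_eq]; linarith [ht.1], by rw [M.b_eq]; linarith [ht.2]⟩
  · rintro ⟨m, hm1, hm2⟩
    rw [M.a_eq] at hm1
    rw [M.b_eq] at hm2
    refine ⟨L.F^[i] x - m, ⟨by linarith, by linarith⟩, ?_⟩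
    exact coe_eq_coe_iff.2 ⟨-m, by push_cast; ring⟩

theorem neg_E_eq (M : Model f L C) (n : ℕ) (m : ℤ) : ((-(f.q n : ℤ), m) : Pos) =
    -C.E (n + 1) + (0, m + (C.E (n + 1)).2) := by
  ext
  · simp [M.q_eq, CF.Q]
  · simp

/-- The preimages of time `qₙ` are the integer translates of `-E (n + 1)`. Those with `k ≤ 0` end
before the arc starts, and those with `k ≥ 1` lie to the right of `a` because `Δ < 1`; only `k = 0`
bounds the gap. -/
theorem mem_baseGap_aux_even (M : Model f L C) {n : ℕ} (h : Even n) {y : ℝ} :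
    (y ≤ f.a ∧ ∀ t ∈ Ioo y f.a, (t : Circ) ∉ f.preimageFlat (f.q n)) ↔
      y ∈ L.arc (-C.E (n + 1)) 0 := by
  have hs := M.s_even h
  have hv : L.v (-C.E (n + 1)) = -C.Δ (n + 1) := by rw [L.v_neg, C.v_E', hs]; ring
  have hΔ := C.Δ_pos (n + 1)
  have hΔ1 : C.Δ (n + 1) < 1 := (C.Δ_lt n).trans_le (C.Δ_le_one n)
  have hE1 : (-C.E (n + 1)).1 ≤ 0 := by
    have : 0 ≤ (C.E (n + 1)).1 := (C.Q_pos (n + 1)).2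
    simp; omega
  have hAB := L.A_lt_B hE1
  rw [L.arc_eq (by rw [L.v_zero, hv]; linarith), L.A_zero, M.a_eq]
  have hBa : L.B (-C.E (n + 1)) < f.a := by
    rw [← M.a_eq, ← L.A_zero]; exact L.B_lt_A (by rw [L.v_zero, hv]; linarith)
  constructor
  · rintro ⟨h1, h2⟩
    refine ⟨?_, h1⟩
    by_contra hc
    rw [not_le] at hc
    obtain ⟨t, ht1, ht2⟩ := exists_between (max_lt hc hAB)
    refine h2 t ⟨(le_max_left _ _).trans_lt ht1, ht2.trans hBa⟩ (M.mem_preimageFlat.2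
      ⟨-(C.E (n + 1)).2, ?_⟩)
    rw [M.neg_E_eq, neg_add_cancel, Prod.mk_zero_zero, add_zero]
    exact ⟨(le_max_right _ _).trans_lt ht1, ht2⟩
  · rintro ⟨h1, h2⟩
    refine ⟨h2, fun t ht hmem => ?_⟩
    obtain ⟨m, hm1, hm2⟩ := M.mem_preimageFlat.1 hmem
    rw [M.neg_E_eq] at hm1 hm2
    set k := m + (C.E (n + 1)).2
    rw [L.B_add_int] at hm2
    rcases le_or_gt k 0 with hk | hk
    · have : (k : ℝ) ≤ 0 := by exact_mod_cast hk
      linarith [ht.1]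
    · have hk1 : (1 : ℝ) ≤ k := by exact_mod_cast hk
      have := L.A_lt_A (p := 0) (p' := -C.E (n + 1) + (0, k)) (by
        rw [L.v_zero, L.v_add, hv, L.v_int]; linarith)
      rw [L.A_zero, M.a_eq] at this
      linarith [ht.2]

theorem mem_baseGap_aux_odd (M : Model f L C) {n : ℕ} (h : ¬ Even n) {y : ℝ} :
    (f.b ≤ y ∧ ∀ t ∈ Ioo f.b y, (t : Circ) ∉ f.preimageFlat (f.q n)) ↔
      y ∈ L.arc (-C.E (n + 1)) 0 := by
  have hs := M.s_odd h
  have hv : L.v (-C.E (n + 1)) = C.Δ (n + 1) := by rw [L.v_neg, C.v_E', hs]; ring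
  have hΔ := C.Δ_pos (n + 1)
  have hΔ1 : C.Δ (n + 1) < 1 := (C.Δ_lt n).trans_le (C.Δ_le_one n)
  have hE1 : (-C.E (n + 1)).1 ≤ 0 := by
    have : 0 ≤ (C.E (n + 1)).1 := (C.Q_pos (n + 1)).2
    simp; omega
  have hAB := L.A_lt_B hE1
  rw [L.arc_comm, L.arc_eq (by rw [L.v_zero, hv]; linarith), L.B_zero, M.b_eq]
  have hBa : f.b < L.A (-C.E (n + 1)) := by
    rw [← M.b_eq, ← L.B_zero]; exact L.B_lt_A (by rw [L.v_zero, hv]; linarith)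
  constructor
  · rintro ⟨h1, h2⟩
    refine ⟨h1, ?_⟩
    by_contra hc
    rw [not_le] at hc
    obtain ⟨t, ht1, ht2⟩ := exists_between (lt_min hc hAB)
    refine h2 t ⟨hBa.trans ht1, ht2.trans_le (min_le_left _ _)⟩ (M.mem_preimageFlat.2
      ⟨-(C.E (n + 1)).2, ?_⟩)
    rw [M.neg_E_eq, neg_add_cancel, Prod.mk_zero_zero, add_zero]
    exact ⟨ht1, ht2.trans_le (min_le_right _ _)⟩
  · rintro ⟨h1, h2⟩
    refine ⟨h1, fun t ht hmem => ?_⟩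
    obtain ⟨m, hm1, hm2⟩ := M.mem_preimageFlat.1 hmem
    rw [M.neg_E_eq] at hm1 hm2
    set k := m + (C.E (n + 1)).2
    rw [L.A_add_int] at hm1
    rcases le_or_gt 0 k with hk | hk
    · have : (0 : ℝ) ≤ k := by exact_mod_cast hk
      linarith [ht.2]
    · have hk1 : (k : ℝ) ≤ -1 := by exact_mod_cast (show k ≤ -1 by omega)
      have := L.B_lt_B (p := -C.E (n + 1) + (0, k)) (p' := 0) (by
        rw [L.v_zero, L.v_add, hv, L.v_int]; linarith)
      rw [L.B_zero, M.b_eq] at this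
      linarith [ht.1]

theorem mem_baseGap (M : Model f L C) {n : ℕ} {t : ℝ} : (t : Circ) ∈ f.baseGap n ↔
    ∃ m : ℤ, t ∈ L.arc (-C.E (n + 1) + (0, m)) (0 + (0, m)) := by
  have key : (t : Circ) ∈ f.baseGap n ↔ ∃ y ∈ L.arc (-C.E (n + 1)) 0, (y : Circ) = t := by
    unfold FlatMap.baseGap
    split_ifs with h
    · exact exists_congr fun y => and_congr_left fun _ => M.mem_baseGap_aux_even h
    · exact exists_congr fun y => and_congr_left fun _ => M.mem_baseGap_aux_odd h
  rw [key]
  constructor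
  · rintro ⟨y, hy, e⟩
    obtain ⟨m, rfl⟩ := coe_eq_coe_iff.1 e.symm
    exact ⟨m, L.arc_add_int.2 hy⟩
  · rintro ⟨m, hm⟩
    refine ⟨t - m, ?_, coe_eq_coe_iff.2 ⟨-m, by push_cast; ring⟩⟩
    rw [← L.arc_add_int (m := m)]
    simpa using hm

theorem mem_gap (M : Model f L C) {n i : ℕ} {x : ℝ} : (x : Circ) ∈ f.gap n i ↔
    ∃ m : ℤ, x ∈ L.arc ((-(i : ℤ), m) - C.E (n + 1)) (-(i : ℤ), m) := by
  rw [FlatMap.gap, mem_preimage, M.coe_iter, M.mem_baseGap]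
  refine exists_congr fun m => ?_
  have hQ : 0 ≤ (C.E (n + 1)).1 := (C.Q_pos (n + 1)).2
  rw [← L.iter_mem_arc (p := (-(i : ℤ), m) - C.E (n + 1)) (p' := (-(i : ℤ), m)) (i := i)
    (by simp; omega) (by simp) (fun h => C.E_ne_zero (n + 1) (sub_eq_self.1 h))]
  have e1 : ((-(i : ℤ), m) : Pos) - C.E (n + 1) + ((i : ℤ), 0) = -C.E (n + 1) + (0, m) := by
    ext <;> simp <;> ring
  have e2 : ((-(i : ℤ), m) : Pos) + ((i : ℤ), 0) = 0 + (0, m) := by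
    ext <;> simp
  rw [e1, e2]

/-- A component of a preimage of the flat interval never meets itself again, as equal positions have
equal times. Conversely, every neighbourhood of a point of `K` contains a gap, and this gap contains
endpoints of `p - E (l + 2)` and `p - E (l + 4)`, one of which is an iterate of the other on the
circle. -/
theorem mem_nonWandering (M : Model f L C) {c : ℝ} (hG : C.Geometry c) {x : ℝ} :
    (x : Circ) ∈ f.nonWandering ↔ x ∈ L.K := by
  constructor
  · intro h p hp
    by_contra hc
    rw [not_or, not_le, not_le] at hc
    obtain ⟨n, hn, z, ⟨u', hu', rfl⟩, ⟨_, ⟨u, hu, rfl⟩, e⟩⟩ :=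
      h ((fun x : ℝ => (x : Circ)) '' Ioo (L.A p) (L.B p))
        (QuotientAddGroup.isOpenMap_coe _ isOpen_Ioo) ⟨x, hc, rfl⟩
    rw [M.coe_iter] at e
    obtain ⟨m, hm⟩ := coe_eq_coe_iff.1 e
    have k1 := L.iter_mono n hu.1.le
    have k2 := L.iter_mono n hu.2.le
    rw [← L.A_add_nat] at k1
    rw [← L.B_add_nat] at k2
    have k3 := L.A_add_int p m
    have k4 := L.B_add_int p m
    rcases lt_trichotomy (L.v (p + ((n : ℤ), 0))) (L.v (p + (0, m))) with hv | hv | hv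
    · linarith [L.B_lt_A hv, hu'.1]
    · have := congrArg Prod.fst (L.v_inj hv)
      simp at this; omega
    · linarith [L.B_lt_A hv, hu'.2]
  · intro hx V hV hxV
    have hV' : IsOpen ((fun x : ℝ => (x : Circ)) ⁻¹' V) := hV.preimage (AddCircle.continuous_mk' 1)
    obtain ⟨ε, hε, hball⟩ := Metric.isOpen_iff.1 hV' x hxV
    obtain ⟨g, hg⟩ := C.exists_chain hx
    obtain ⟨k, hk, hlt⟩ := (hg.decay hG).exists_lt hG.pos hG.le_one 1 hε
    obtain ⟨n, rfl⟩ := Nat.exists_eq_add_of_le' hk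
    have hmem : ∀ y ∈ L.arc (g n).1 (g n).2, (y : Circ) ∈ V := fun y hy =>
      hball ((L.abs_sub_le_gl hy (hg.mem n)).trans_lt hlt)
    obtain ⟨p, l, e⟩ : ∃ p l, g n = (p - C.E l, p) := by
      rcases hg.isGap n with ⟨p, -, -, e⟩ | ⟨p, -, -, e⟩
      exacts [⟨p, _, e⟩, ⟨p, _, e⟩]
    rw [e] at hmem
    have hb : ∀ j, C.s j = C.s l → C.Δ j < C.Δ l → L.Btw (p - C.E l) (p - C.E j) p := by
      intro j hj hj'
      have := C.Δ_pos j
      unfold FlatLift.Btw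
      rw [L.v_sub, L.v_sub, C.v_E', C.v_E', hj]
      rcases C.s_eq l with h | h <;> rw [h]
      · left; constructor <;> linarith
      · right; constructor <;> linarith
    have d2 : C.Δ (l + 2) < C.Δ l := (C.Δ_lt (l + 1)).trans (C.Δ_lt l)
    have d4 : C.Δ (l + 4) < C.Δ l := (C.Δ_lt (l + 3)).trans ((C.Δ_lt (l + 2)).trans d2)
    have s2 : C.s (l + 2) = C.s l := by rw [C.s_succ, C.s_succ, neg_neg]
    have s4 : C.s (l + 4) = C.s l := by rw [C.s_succ, C.s_succ, neg_neg, s2]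
    have m2 := hmem _ (hb _ s2 d2).A_mem
    have m4 := hmem _ (hb _ s4 d4).A_mem
    have hQ : C.Q (l + 2) < C.Q (l + 4) := by
      have h1 : C.Q (l + 3) + C.Q (l + 2) ≤ C.Q (l + 4) := C.Q_add_le (l + 2)
      have h2 : 1 ≤ C.Q (l + 3) := (C.Q_pos (l + 2)).1
      omega
    refine ⟨(C.Q (l + 4) - C.Q (l + 2)).toNat, by omega, _, m2, _, m4, ?_⟩
    rw [M.coe_iter, ← L.A_add_nat]
    have e : p - C.E (l + 4) + (((C.Q (l + 4) - C.Q (l + 2)).toNat : ℤ), 0) =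
        p - C.E (l + 2) + (0, (C.E (l + 2)).2 - (C.E (l + 4)).2) := by
      rw [Int.toNat_of_nonneg (by omega)]
      ext <;> simp [CF.Q]
    rw [e, L.A_add_int, coe_add_int]

theorem gapDist_eq (M : Model f L C) (n : ℕ) :
    f.gapDist n = Metric.infDist (L.A (C.E (n + 1)) : Circ) f.flatInterval := by
  unfold FlatMap.gapDist
  congr 1
  rw [M.coe_iter, ← M.a_eq]
  have h : C.E (n + 1) = ((f.q n : ℤ), 0) + (0, (C.E (n + 1)).2) := by
    ext <;> simp [M.q_eq, CF.Q]
  rw [h, L.A_add_int, coe_add_int, L.A_nat]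
  simp

theorem gapDist_le (M : Model f L C) (n : ℕ) : f.gapDist n ≤ L.gl 0 (C.E (n + 1)) := by
  rw [M.gapDist_eq, ← Metric.infDist_closure]
  have hcl : ∀ t ∈ Icc f.a f.b, (t : Circ) ∈ closure f.flatInterval := by
    intro t ht
    rw [← closure_Ioo f.a_lt_b.ne] at ht
    exact image_closure_subset_closure_image (AddCircle.continuous_mk' 1) ⟨t, ht, rfl⟩
  have hd : ∀ t ∈ Icc f.a f.b, Metric.infDist (L.A (C.E (n + 1)) : Circ) (closure f.flatInterval) ≤
      |L.A (C.E (n + 1)) - t| := by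
    intro t ht
    refine (Metric.infDist_le_dist_of_mem (hcl t ht)).trans ?_
    rw [dist_eq_norm, ← AddCircle.coe_sub, UnitAddCircle.norm_eq]
    simpa using round_le (L.A (C.E (n + 1)) - t) 0
  have hΔ := C.Δ_pos (n + 1)
  have hab := f.a_lt_b
  have hAB : L.A (C.E (n + 1)) = L.B (C.E (n + 1)) := L.A_eq_B (C.Q_pos n).1
  rcases C.s_eq (n + 1) with hs | hs
  · have hv : L.v 0 < L.v (C.E (n + 1)) := by rw [L.v_zero, C.v_E', hs]; linarith
    rw [L.gl_eq hv, L.B_zero, M.b_eq]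
    have := L.B_lt_A hv
    rw [L.B_zero, M.b_eq] at this
    have h1 := hd f.b ⟨hab.le, le_rfl⟩
    rwa [abs_of_pos (by linarith)] at h1
  · have hv : L.v (C.E (n + 1)) < L.v 0 := by rw [L.v_zero, C.v_E', hs]; linarith
    rw [L.gl_comm, L.gl_eq hv, L.A_zero, M.a_eq, ← hAB]
    have := L.B_lt_A hv
    rw [L.A_zero, M.a_eq, ← hAB] at this
    have h1 := hd f.a ⟨le_rfl, hab.le⟩
    rwa [abs_of_neg (by linarith), neg_sub] at h1

/-- The distance on the circle might be attained around the other way. On each side the outermost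
returns, `E 1` and `E 2`, bound that detour from below. -/
theorem exists_le_gapDist (M : Model f L C) : ∃ η > 0, ∀ n, η * L.gl 0 (C.E (n + 1)) ≤ f.gapDist n := by
  have hs1 : C.s 1 = 1 := M.s_even Even.zero
  have hs2 : C.s 2 = -1 := M.s_odd (by decide)
  have h1 : 0 < L.a + 1 - L.A (C.E 1) := by
    have := L.A_lt_A (p := C.E 1) (p' := (0, 1)) (by
      rw [C.v_E', hs1, L.v_int]; push_cast; linarith [C.Δ_lt 0, C.Δ_zero])
    rw [L.A_int] at this; push_cast at this; linarith
  have h2 : 0 < L.A (C.E 2) - (L.b - 1) := by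
    have := L.B_lt_A (p := (0, -1)) (p' := C.E 2) (by
      rw [C.v_E', hs2, L.v_int]; push_cast; linarith [C.Δ_lt 0, C.Δ_lt 1, C.Δ_zero])
    rw [L.B_int] at this; push_cast at this; linarith
  set η := min 1 (min (L.a + 1 - L.A (C.E 1)) (L.A (C.E 2) - (L.b - 1)))
  have e1 : η ≤ 1 := min_le_left _ _
  have e2 : η ≤ L.a + 1 - L.A (C.E 1) := (min_le_right _ _).trans (min_le_left _ _)
  have e3 : η ≤ L.A (C.E 2) - (L.b - 1) := (min_le_right _ _).trans (min_le_right _ _)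
  have hη : 0 < η := lt_min one_pos (lt_min h1 h2)
  refine ⟨η, hη, fun n => ?_⟩
  have hΔ := C.Δ_pos (n + 1)
  have hΔ1 := C.Δ_le_one (n + 1)
  have hab := f.a_lt_b
  have hAB : L.A (C.E (n + 1)) = L.B (C.E (n + 1)) := L.A_eq_B (C.Q_pos n).1
  have hD0 : 0 < L.gl 0 (C.E (n + 1)) := L.gl_pos (C.E_ne_zero _).symm
  have hD1 : L.gl 0 (C.E (n + 1)) ≤ 1 := L.gl_le_one (by
    rw [L.v_zero, sub_zero, C.v_E']
    rcases C.s_eq (n + 1) with h | h <;> rw [h] <;> simp <;> rw [abs_of_pos hΔ] <;> exact hΔ1)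
  have hU : f.flatInterval.Nonempty := (nonempty_Ioo.2 hab).image _
  rw [M.gapDist_eq, Metric.le_infDist hU]
  rintro _ ⟨u, hu, rfl⟩
  rw [dist_eq_norm, ← AddCircle.coe_sub, UnitAddCircle.norm_eq]
  set k := round (L.A (C.E (n + 1)) - u)
  have g1 : η * L.gl 0 (C.E (n + 1)) ≤ L.gl 0 (C.E (n + 1)) := by nlinarith
  have g2 : η * L.gl 0 (C.E (n + 1)) ≤ η := by nlinarith
  rw [← M.a_eq, ← M.b_eq] at hu
  rcases C.s_eq (n + 1) with hs | hs
  · have hv : L.v 0 < L.v (C.E (n + 1)) := by rw [L.v_zero, C.v_E', hs]; linarith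
    rw [L.gl_eq hv, L.B_zero] at g1 g2 ⊢
    have hle : L.A (C.E (n + 1)) ≤ L.A (C.E 1) := L.A_mono (by
      rw [C.v_E', C.v_E', hs, hs1]; linarith [C.Δ_anti (show 1 ≤ n + 1 by omega)])
    rcases le_or_gt k 0 with hk | hk
    · have hk' : (k : ℝ) ≤ 0 := by exact_mod_cast hk
      refine le_trans ?_ (le_abs_self _)
      linarith [hu.2]
    · have hk' : (1 : ℝ) ≤ k := by exact_mod_cast hk
      refine le_trans ?_ (neg_le_abs _)
      linarith [hu.1]
  · have hv : L.v (C.E (n + 1)) < L.v 0 := by rw [L.v_zero, C.v_E', hs]; linarith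
    rw [L.gl_comm, L.gl_eq hv, L.A_zero, ← hAB] at g1 g2 ⊢
    have hn : 2 ≤ n + 1 := by
      by_contra hc
      have : n = 0 := by omega
      subst this
      rw [zero_add, hs1] at hs
      norm_num at hs
    have hle : L.A (C.E 2) ≤ L.A (C.E (n + 1)) := L.A_mono (by
      rw [C.v_E', C.v_E', hs, hs2]; linarith [C.Δ_anti hn])
    rcases le_or_gt 0 k with hk | hk
    · have hk' : (0 : ℝ) ≤ k := by exact_mod_cast hk
      refine le_trans ?_ (neg_le_abs _)
      linarith [hu.1]
    · have hk' : (k : ℝ) ≤ -1 := by exact_mod_cast (show k ≤ -1 by omega)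
      refine le_trans ?_ (le_abs_self _)
      linarith [hu.2]

/-- The scalings control all returns from `E 1` on; the full turn `E 0` has no scaling and is
compared with `E 2` directly. -/
theorem exists_BG (M : Model f L C) (h : f.BoundedGeometry) : ∃ c > 0, C.BG c := by
  obtain ⟨η, hη, hle⟩ := M.exists_le_gapDist
  obtain ⟨c, hc, hB⟩ := h
  have p0 : 0 < L.gl 0 (C.E 0) := L.gl_pos (C.E_ne_zero _).symm
  have p2 : 0 < L.gl 0 (C.E 2) := L.gl_pos (C.E_ne_zero _).symm
  refine ⟨min (c * η) (L.gl 0 (C.E 2) / L.gl 0 (C.E 0)), by positivity, fun n => ?_⟩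
  have hp : 0 < L.gl 0 (C.E n) := L.gl_pos (C.E_ne_zero _).symm
  rcases n with _ | n
  · calc _ ≤ L.gl 0 (C.E 2) / L.gl 0 (C.E 0) * L.gl 0 (C.E 0) :=
          mul_le_mul_of_nonneg_right (min_le_right _ _) p0.le
      _ = _ := div_mul_cancel₀ _ p0.ne'
  · have h1 := hB (n + 2) (by omega)
    have h2 : 0 < f.gapDist n := (mul_pos hη hp).trans_le (hle n)
    rw [FlatMap.scaling, Nat.add_sub_cancel, le_div_iff₀ h2] at h1
    calc _ ≤ c * η * L.gl 0 (C.E (n + 1)) :=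
          mul_le_mul_of_nonneg_right (min_le_left _ _) hp.le
      _ = c * (η * L.gl 0 (C.E (n + 1))) := by ring
      _ ≤ c * f.gapDist n := mul_le_mul_of_nonneg_left (hle n) hc.le
      _ ≤ f.gapDist (n + 2) := h1
      _ ≤ _ := M.gapDist_le (n + 2)

end Model

/-! ### Nearest lifts and models of the two maps -/

theorem dist_coe_le (s t : ℝ) : dist (s : Circ) (t : Circ) ≤ |s - t| := by
  rw [dist_eq_norm, ← AddCircle.coe_sub, UnitAddCircle.norm_eq]
  simpa using round_le (s - t) 0

theorem exists_coe_dist (t : ℝ) (x : Circ) : ∃ s : ℝ, (s : Circ) = x ∧ |s - t| = dist x (t : Circ) := by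
  obtain ⟨u, rfl⟩ := QuotientAddGroup.mk_surjective x
  refine ⟨u - round (u - t), coe_eq_coe_iff.2 ⟨-round (u - t), by push_cast; ring⟩, ?_⟩
  rw [dist_eq_norm]
  have : ‖((u - t : ℝ) : Circ)‖ = |u - t - round (u - t)| := UnitAddCircle.norm_eq
  rw [AddCircle.coe_sub] at this
  refine Eq.trans ?_ this.symm
  congr 1; ring

theorem dist_le_half (x y : Circ) : dist x y ≤ 1 / 2 := by
  rw [dist_eq_norm]
  simpa using AddCircle.norm_le_half_period (1 : ℝ) one_ne_zero (x := x - y)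

/-- If the nearest integer to `s - t` is zero, the distance is `|s - t|`; otherwise it is at least
`1 - |s - t|`. -/
theorem le_dist_coe {δ s t : ℝ} (hδ : 0 ≤ δ) (h : δ ≤ 1 - |s - t|) :
    δ * |s - t| ≤ dist (s : Circ) (t : Circ) := by
  rw [dist_eq_norm, ← AddCircle.coe_sub, UnitAddCircle.norm_eq]
  set k := round (s - t)
  have h0 := abs_nonneg (s - t)
  rcases eq_or_ne k 0 with hk | hk
  · rw [hk, Int.cast_zero, sub_zero]
    nlinarith
  · have hk1 : (1 : ℝ) ≤ |(k : ℝ)| := by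
      rw [← Int.cast_abs]; exact_mod_cast Int.one_le_abs hk
    have h1 : |(k : ℝ)| - |s - t| ≤ |s - t - k| := by
      rw [abs_sub_comm (s - t)]; exact abs_sub_abs_le_abs_sub _ _
    nlinarith

theorem exists_model {f : FlatMap} (hf : f.IsBounded) : ∃ (L : FlatLift) (C : CF L) (c : ℝ),
    Model f L C ∧ C.Geometry c ∧ L.τ = f.rotationNumber ∧ C.E = returns f.rotationNumber ∧
      C.a = quot f.rotationNumber := by
  have hirr := hf.irrational
  have h0 : 0 < f.rotationNumber := lt_of_le_of_ne (Int.fract_nonneg _) hirr.ne_zero.symm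
  have h1 : f.rotationNumber < 1 := Int.fract_lt_one _
  obtain ⟨L, hF, ha, hb, hτ⟩ := f.exists_flatLift hirr
  have hM : Model f L (L.cf (hτ ▸ h0) (hτ ▸ h1)) := by
    refine ⟨hF, ha, hb, fun n => ?_, rfl⟩
    show ((⌊(GenContFract.of f.rotationNumber).dens n⌋₊ : ℕ) : ℤ) = (returns L.τ (n + 1)).1
    rw [dens_eq hirr h0 h1, hτ]
    have h2 : (1 : ℤ) ≤ (returns L.τ (n + 1)).1 := ((L.cf (hτ ▸ h0) (hτ ▸ h1)).Q_pos n).1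
    rw [hτ] at h2
    obtain ⟨k, hk⟩ := Int.eq_ofNat_of_zero_le (show 0 ≤ (returns f.rotationNumber (n + 1)).1 by omega)
    rw [hk]
    simp
  obtain ⟨B, hB⟩ := quot_lt_of_isBoundedType hirr h0 h1 hf.boundedType
  obtain ⟨cB, hcB, hBG⟩ := hM.exists_BG hf.boundedGeometry
  obtain ⟨c, hc, hS⟩ := CF.split_all (C := L.cf (hτ ▸ h0) (hτ ▸ h1)) (M := B)
    (fun n => by show quot L.τ n ≤ B; rw [hτ]; exact hB n) hcB hBG
  obtain ⟨c', hG⟩ := CF.exists_geometry hc hS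
  refine ⟨L, _, c', hM, hG, hτ, ?_, ?_⟩
  · show returns L.τ = _; rw [hτ]
  · show quot L.τ = _; rw [hτ]

/-- Models of two maps with the same rotation number. -/
structure Models (f g : FlatMap) (L L' : FlatLift) (C : CF L) (C' : CF L') (c : ℝ) : Prop where
  left : Model f L C
  right : Model g L' C'
  τ_eq : L'.τ = L.τ
  E_eq : C'.E = C.E
  a_eq : C'.a = C.a
  geom_left : C.Geometry c
  geom_right : C'.Geometry c

/-- Two points of the circle have lifts on the same sides of all preimages of the flat
intervals. -/
def Rel (L L' : FlatLift) (x y : Circ) : Prop :=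
  ∃ t t' : ℝ, (t : Circ) = x ∧ (t' : Circ) = y ∧ t ∈ L.K ∧ L.Match L' t t'

theorem Rel.exists_lift {L L' : FlatLift} {x y : Circ} (h : Rel L L' x y) {t : ℝ}
    (ht : (t : Circ) = x) : ∃ t' : ℝ, (t' : Circ) = y ∧ t ∈ L.K ∧ L.Match L' t t' := by
  obtain ⟨s, s', rfl, rfl, hs, hm⟩ := h
  obtain ⟨m, rfl⟩ := coe_eq_coe_iff.1 ht
  exact ⟨s' + m, coe_add_int _ _, L.K_add_int hs m, hm.add_int m⟩

theorem Rel.symm {L L' : FlatLift} {x y : Circ} (h : Rel L L' x y) : Rel L' L y x := by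
  obtain ⟨s, s', rfl, rfl, hs, hm⟩ := h
  exact ⟨s', s, rfl, rfl, hm.mem_K hs, hm.symm hs⟩

/-! ### The code-preserving conjugacy -/

namespace Models

variable {f g : FlatMap} {L L' : FlatLift} {C : CF L} {C' : CF L'} {c : ℝ}

theorem symm (h : Models f g L L' C C' c) : Models g f L' L C' C c :=
  ⟨h.right, h.left, h.τ_eq.symm, h.E_eq.symm, h.a_eq.symm, h.geom_right, h.geom_left⟩

theorem exists_rel (h : Models f g L L' C C' c) {x : Circ} (hx : x ∈ f.nonWandering) :
    ∃ y : g.nonWandering, Rel L L' x y := by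
  obtain ⟨t, rfl⟩ := QuotientAddGroup.mk_surjective x
  have ht := (h.left.mem_nonWandering h.geom_left).1 hx
  obtain ⟨t', hm⟩ := FlatLift.exists_match h.τ_eq t
  exact ⟨⟨t', (h.right.mem_nonWandering h.geom_right).2 (hm.mem_K ht)⟩, t, t', rfl, rfl, ht, hm⟩

theorem rel_unique (h : Models f g L L' C C' c) {x y y' : Circ} (h₁ : Rel L L' x y)
    (h₂ : Rel L L' x y') : y = y' := by
  obtain ⟨t, t', rfl, rfl, ht, hm⟩ := h₁
  obtain ⟨s', rfl, -, hm'⟩ := h₂.exists_lift rfl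
  rw [CF.match_unique h.τ_eq h.E_eq h.a_eq h.geom_right ht hm hm']

theorem rel_map (h : Models f g L L' C C' c) {x y : Circ} (hr : Rel L L' x y) :
    f x ∈ f.nonWandering ∧ Rel L L' (f x) (g y) := by
  obtain ⟨t, t', rfl, rfl, ht, hm⟩ := hr
  rw [h.left.coe_F, h.right.coe_F]
  exact ⟨(h.left.mem_nonWandering h.geom_left).2 (L.F_mem_K ht), _, _, rfl, rfl, L.F_mem_K ht,
    hm.map_F⟩

theorem rel_gap (h : Models f g L L' C C' c) {x y : Circ} (hr : Rel L L' x y) {n i : ℕ}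
    (hx : x ∈ f.gap n i) : y ∈ g.gap n i := by
  obtain ⟨t, t', rfl, rfl, ht, hm⟩ := hr
  obtain ⟨m, hmem⟩ := h.left.mem_gap.1 hx
  refine h.right.mem_gap.2 ⟨m, ?_⟩
  rw [h.E_eq]
  have : 0 ≤ (C.E (n + 1)).1 := (C.Q_pos (n + 1)).2
  exact hm.mem_arc h.τ_eq (by simp; omega) (by simp)
    (fun h => C.E_ne_zero (n + 1) (sub_eq_self.1 h)) hmem

/-- A point closer to `x` than the lengths of the two preimages bounding a gap around `x` cannot be
separated from `x` by them, so its image lies in the corresponding small gap. -/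
theorem rel_continuous (h : Models f g L L' C C' c) {x y : Circ} (hr : Rel L L' x y) {ε : ℝ}
    (hε : 0 < ε) : ∃ δ > 0, ∀ x₁ y₁, Rel L L' x₁ y₁ → dist x₁ x < δ → dist y₁ y < ε := by
  obtain ⟨t, t', rfl, rfl, ht, hm⟩ := hr
  obtain ⟨γ, hγ⟩ := C.exists_chain ht
  have hγ' := hγ.of_match (C' := C') h.τ_eq h.E_eq h.a_eq hm
  obtain ⟨k, hk, hlt⟩ := (hγ'.decay h.geom_right).exists_lt h.geom_right.pos h.geom_right.le_one 1 hε
  obtain ⟨n, rfl⟩ := Nat.exists_eq_add_of_le' hk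
  obtain ⟨n1, n2⟩ := (hγ.isGap n).fst_nonpos
  have hne := (hγ.isGap n).ne
  refine ⟨min (L.w (γ n).1) (L.w (γ n).2), lt_min (L.w_pos n1) (L.w_pos n2), ?_⟩
  intro x₁ y₁ hr₁ hd
  obtain ⟨s, hs, hsd⟩ := exists_coe_dist t x₁
  obtain ⟨s', rfl, hsK, hsm⟩ := hr₁.exists_lift hs
  rw [← hsd] at hd
  have hmem : s ∈ L.arc (γ n).1 (γ n).2 := by
    by_contra hc
    rcases L.sep_of_notMem n1 n2 hne hsK hc (hγ.mem n) with hsep | hsep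
    · exact absurd (hd.trans_le (min_le_left _ _)) (not_lt.2 hsep.w_le)
    · exact absurd (hd.trans_le (min_le_right _ _)) (not_lt.2 hsep.w_le)
  refine (dist_coe_le s' t').trans_lt (lt_of_le_of_lt ?_ hlt)
  exact L'.abs_sub_le_gl (hsm.mem_arc h.τ_eq n1 n2 hne hmem) (hγ'.mem n)

/-- A code-preserving map is the matching of points. -/
theorem eq_of_preservesCodes (h : Models f g L L' C C' c) {ψ : f.nonWandering → g.nonWandering}
    (hψ : PreservesCodes f g ψ) (x : f.nonWandering) {y : Circ} (hr : Rel L L' x y) :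
    (ψ x : Circ) = y := by
  obtain ⟨t, t', htx, rfl, ht, hm⟩ := hr
  obtain ⟨γ, hγ⟩ := C.exists_chain ht
  have hγ' := hγ.of_match (C' := C') h.τ_eq h.E_eq h.a_eq hm
  refine dist_le_zero.1 (le_of_forall_pos_le_add fun ε hε => ?_)
  -- Start at `2`: sizes are shifted by one, and level zero of the chain is not a dynamical
  -- partition, so the gap used is `γ (n + 1)`, of the `n`-th partition.
  obtain ⟨k, hk, hlt⟩ := (hγ'.decay h.geom_right).exists_lt h.geom_right.pos h.geom_right.le_one 2 hε
  obtain ⟨n, rfl⟩ := Nat.exists_eq_add_of_le' hk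
  have key : ∀ (l : ℕ) (p : Pos), γ (n + 1) = (p - C.E (l + 1), p) → p.1 ≤ 0 →
      ((x : Circ) ∈ f.gap l (-p.1).toNat → (ψ x : Circ) ∈ g.gap l (-p.1).toNat) →
      dist (ψ x : Circ) (t' : Circ) ≤ 0 + ε := by
    intro l p e hp himp
    have hpe : (-(((-p.1).toNat : ℕ) : ℤ), p.2) = p := by ext <;> simp; omega
    have h1 : (x : Circ) ∈ f.gap l (-p.1).toNat := by
      rw [← htx]
      refine h.left.mem_gap.2 ⟨p.2, ?_⟩
      rw [hpe]
      have := hγ.mem (n + 1)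
      rwa [e] at this
    obtain ⟨s, hs⟩ := QuotientAddGroup.mk_surjective (ψ x : Circ)
    have h2 := himp h1
    rw [← hs] at h2 ⊢
    obtain ⟨m, hmem⟩ := h.right.mem_gap.1 h2
    have h3 := (L'.arc_add_int (m := p.2 - m)).2 hmem
    have e1 : ((-(((-p.1).toNat : ℕ) : ℤ), m) : Pos) + (0, p.2 - m) = p := by
      rw [Prod.mk_add_mk, add_zero, add_sub_cancel, hpe]
    rw [sub_add_eq_add_sub, e1, h.E_eq] at h3
    have h4 := hγ'.mem (n + 1)
    have h5 : L'.gl (γ (n + 1)).1 (γ (n + 1)).2 < ε := hlt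
    rw [e] at h4 h5
    have h6 := dist_coe_le (s + ((p.2 - m : ℤ) : ℝ)) t'
    rw [coe_add_int] at h6
    have h7 := L'.abs_sub_le_gl h3 h4
    show dist (s : Circ) (t' : Circ) ≤ 0 + ε
    linarith
  rcases hγ.isGap (n + 1) with ⟨p, h1, h2, e⟩ | ⟨p, h1, h2, e⟩
  · refine key n p e h2 ((hψ x n _).1 ?_)
    have := h.left.q_eq (n + 1)
    omega
  · refine key (n + 1) p e h2 ((hψ x n _).2 ?_)
    have := h.left.q_eq n
    omega

/-- Nearest lifts are chosen in the source, but their matches need not be nearest in the target. The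
lower bound on the complementary arc repairs this at the cost of a factor `δ`. -/
theorem exists_quasiSymm (h : Models f g L L' C C' c) : ∃ κ > 0, ∀ x y z x' y' z' : Circ,
    Rel L L' x x' → Rel L L' y y' → Rel L L' z z' → x ≠ y → dist x y = dist z y →
      κ * dist x' y' ≤ dist z' y' := by
  obtain ⟨κ, hκ, hq⟩ := CF.exists_quasiSymm h.τ_eq h.E_eq h.a_eq h.geom_left h.geom_right
  obtain ⟨δ, hδ, hc⟩ := CF.exists_complement h.τ_eq h.E_eq h.a_eq h.geom_left h.geom_right
  refine ⟨δ * κ, mul_pos hδ hκ, fun x y z x' y' z' rx ry rz hne hd => ?_⟩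
  obtain ⟨t, t', rfl, rfl, ht, hm⟩ := ry
  obtain ⟨s, hs, hsd⟩ := exists_coe_dist t x
  obtain ⟨s', rfl, hsK, hsm⟩ := rx.exists_lift hs
  obtain ⟨r, hr, hrd⟩ := exists_coe_dist t z
  obtain ⟨r', rfl, hrK, hrm⟩ := rz.exists_lift hr
  have h1 : |s - t| ≤ 1 / 2 := hsd ▸ dist_le_half _ _
  have h2 : |r - t| ≤ 1 / 2 := hrd ▸ dist_le_half _ _
  have h3 := hq s t r s' t' r' hsK ht hrK hsm hm hrm (fun e => hne (by rw [← hs, e]))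
    (by rw [hsd, hrd, hd]) (by linarith)
  have h4 := le_dist_coe hδ.le (hc r t r' t' hrK ht hrm hm h2)
  calc δ * κ * dist (s' : Circ) (t' : Circ) ≤ δ * κ * |s' - t'| :=
        mul_le_mul_of_nonneg_left (dist_coe_le _ _) (mul_pos hδ hκ).le
    _ = δ * (κ * |s' - t'|) := by ring
    _ ≤ δ * |r' - t'| := mul_le_mul_of_nonneg_left h3 hδ.le
    _ ≤ _ := h4

theorem continuous_of_rel (h : Models f g L L' C C' c) {φ : f.nonWandering → g.nonWandering}
    (hφ : ∀ x : f.nonWandering, Rel L L' x (φ x)) : Continuous φ := by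
  refine Metric.continuous_iff.2 fun x ε hε => ?_
  obtain ⟨δ, hδ, hd⟩ := h.rel_continuous (hφ x) hε
  exact ⟨δ, hδ, fun x₁ hx₁ => hd _ _ (hφ x₁) hx₁⟩

end Models

end FlatCircle

end

theorem mainTheorem3 (f g : FlatCircle.FlatMap) (hf : f.IsBounded) (hg : g.IsBounded)
    (hρ : f.rotationNumber = g.rotationNumber) :
    ∃ φ : f.nonWandering ≃ₜ g.nonWandering,
      (∀ ψ : f.nonWandering → g.nonWandering, FlatCircle.PreservesCodes f g ψ ↔ ψ = φ) ∧
      (∀ x : f.nonWandering, ∃ hx : f x ∈ f.nonWandering, (φ ⟨f x, hx⟩ : FlatCircle.Circ) = g (φ x)) ∧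
      ∃ C : ℝ, 0 < C ∧ ∀ x y z : f.nonWandering, x ≠ y → dist x y = dist y z →
        C⁻¹ ≤ dist (φ x) (φ y) / dist (φ y) (φ z) ∧
        dist (φ x) (φ y) / dist (φ y) (φ z) ≤ C := by
  obtain ⟨L, C, c, hM, hG, hτ, hE, ha⟩ := FlatCircle.exists_model hf
  obtain ⟨L', C', c', hM', hG', hτ', hE', ha'⟩ := FlatCircle.exists_model hg
  have hc := lt_min hG.pos hG'.pos
  have H : FlatCircle.Models f g L L' C C' (min c c') :=
    ⟨hM, hM', by rw [hτ, hτ', hρ], by rw [hE, hE', hρ], by rw [ha, ha', hρ],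
      hG.mono hc (min_le_left _ _), hG'.mono hc (min_le_right _ _)⟩
  choose φ hφ using fun x : f.nonWandering => H.exists_rel x.2
  choose φ' hφ' using fun y : g.nonWandering => H.symm.exists_rel y.2
  refine ⟨⟨⟨φ, φ', fun x => Subtype.ext (H.symm.rel_unique (hφ' _) (hφ x).symm),
    fun y => Subtype.ext (H.rel_unique (hφ _) (hφ' y).symm)⟩, H.continuous_of_rel hφ,
    H.symm.continuous_of_rel hφ'⟩, fun ψ => ⟨fun hψ => ?_, ?_⟩, fun x => ?_, ?_⟩
  · exact funext fun x => Subtype.ext (H.eq_of_preservesCodes hψ x (hφ x))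
  · rintro rfl x n i
    exact ⟨fun _ hx => H.rel_gap (hφ x) hx, fun _ hx => H.rel_gap (hφ x) hx⟩
  · obtain ⟨h1, h2⟩ := H.rel_map (hφ x)
    exact ⟨h1, H.rel_unique (hφ ⟨f x, h1⟩) h2⟩
  · obtain ⟨κ, hκ, hq⟩ := H.exists_quasiSymm
    refine ⟨κ⁻¹, inv_pos.2 hκ, fun x y z hne hd => ?_⟩
    show κ⁻¹⁻¹ ≤ dist (φ x : FlatCircle.Circ) (φ y) / dist (φ y : FlatCircle.Circ) (φ z) ∧
      dist (φ x : FlatCircle.Circ) (φ y) / dist (φ y : FlatCircle.Circ) (φ z) ≤ κ⁻¹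
    have hd' : dist (x : FlatCircle.Circ) y = dist (z : FlatCircle.Circ) y := by
      rw [dist_comm (z : FlatCircle.Circ)]; exact hd
    have hyz : z ≠ y := fun e => hne (dist_eq_zero.1 (by rw [hd, e, dist_self]))
    have h1 := hq x y z _ _ _ (hφ x) (hφ y) (hφ z) (fun e => hne (Subtype.ext e)) hd'
    -- The estimate is one-sided; exchanging `x` and `z` gives the other bound.
    have h2 := hq z y x _ _ _ (hφ z) (hφ y) (hφ x) (fun e => hyz (Subtype.ext e)) hd'.symm
    have h3 : 0 < dist (φ z : FlatCircle.Circ) (φ y) := by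
      refine dist_pos.2 fun e => hyz (Subtype.ext (H.symm.rel_unique (hφ z).symm ?_))
      rw [e]; exact (hφ y).symm
    rw [dist_comm (φ y : FlatCircle.Circ), inv_inv, le_div_iff₀ h3, div_le_iff₀ h3,
      inv_mul_eq_div, le_div_iff₀ hκ]
    exact ⟨h2, by linarith⟩
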